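/- Let $E$ be a super-reflexive (real or complex) Banach space, i.e. a Banach space that admits an equivalent uniformly convex norm. Then the (discrete) group $\mathrm{SL}_3(\mathbb{Z})$ has Banach property $(T_E)$: for every linear isometric representation $\pi : \mathrm{SL}_3(\mathbb{Z}) \to O(E)$, where $O(E)$ is the group of invertible linear isometries of $E$, the quotient representation $\pi' : \mathrm{SL}_3(\mathbb{Z}) \to O(E / E^{\pi(\mathrm{SL}_3(\mathbb{Z}))})$ on the quotient by the closed subspace of invariant vectors (with the quotient norm) does not have almost invariant vectors. That is, there are a finite set $K \subseteq \mathrm{SL}_3(\mathbb{Z})$ and an $\varepsilon > 0$ such that no unit vector $\xi \in E / E^{\pi(\mathrm{SL}_3(\mathbb{Z}))}$ satisfies $\|\pi'(g)\xi - \xi\| < \varepsilon$ for all $g \in K$. -/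

import Mathlib

/-- `E` is super-reflexive: it carries an equivalent uniformly convex norm `N`. -/
def IsSuperReflexive (𝕜 : Type*) [RCLike 𝕜] (E : Type*) [NormedAddCommGroup E]
    [NormedSpace 𝕜 E] : Prop :=
  ∃ N : Seminorm 𝕜 E,
    (∃ c C : ℝ, 0 < c ∧ 0 < C ∧ ∀ x : E, c * ‖x‖ ≤ N x ∧ N x ≤ C * ‖x‖) ∧
    @UniformConvexSpace E N.toAddGroupSeminorm.toSeminormedAddCommGroup

/-- A continuous linear isometric representation of `G` on `E`: a homomorphism into the group of
invertible linear isometries of `E`, continuous for the strong operator topology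
(the topology of pointwise convergence), that is, with continuous orbit maps. -/
structure IsometricRep (𝕜 : Type*) [RCLike 𝕜] (G : Type*) [Group G] [TopologicalSpace G]
    (E : Type*) [SeminormedAddCommGroup E] [NormedSpace 𝕜 E] where
  toHom : G →* (E ≃ₗᵢ[𝕜] E)
  continuous_orbit : ∀ x : E, Continuous fun g : G => toHom g x

namespace IsometricRep

/-- The subspace `E^{π(G)}` of invariant vectors. -/
def invariants {𝕜 : Type*} [RCLike 𝕜] {G : Type*} [Group G] [TopologicalSpace G]
    {E : Type*} [SeminormedAddCommGroup E] [NormedSpace 𝕜 E]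
    (π : IsometricRep 𝕜 G E) : Submodule 𝕜 E where
  carrier := {x | ∀ g : G, π.toHom g x = x}
  add_mem' := fun hx hy g => by rw [map_add, hx g, hy g]
  zero_mem' := fun g => map_zero _
  smul_mem' := fun c x hx g => by rw [map_smul, hx g]

/-- `E^{π(G)}` is closed, so the quotient seminorm on `E / E^{π(G)}` is a norm. -/
theorem isClosed_invariants {𝕜 : Type*} [RCLike 𝕜] {G : Type*} [Group G] [TopologicalSpace G]
    {E : Type*} [NormedAddCommGroup E] [NormedSpace 𝕜 E]
    (π : IsometricRep 𝕜 G E) : IsClosed (π.invariants : Set E) := by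
  have h : (π.invariants : Set E) = ⋂ g : G, {x | π.toHom g x = x} := by
    ext x
    simp [invariants]
  rw [h]
  exact isClosed_iInter fun g => isClosed_eq (π.toHom g).continuous continuous_id

theorem map_mem_invariants {𝕜 : Type*} [RCLike 𝕜] {G : Type*} [Group G] [TopologicalSpace G]
    {E : Type*} [SeminormedAddCommGroup E] [NormedSpace 𝕜 E]
    (π : IsometricRep 𝕜 G E) (g : G) :
    π.invariants ≤ π.invariants.comap (π.toHom g).toLinearEquiv.toLinearMap := by
  intro x hx
  have h : π.toHom g x = x := hx g
  change π.toHom g x ∈ π.invariants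
  rwa [h]

/-- The linear map induced by `π(g)` on `E / E^{π(G)}`. -/
def quotientMap {𝕜 : Type*} [RCLike 𝕜] {G : Type*} [Group G] [TopologicalSpace G]
    {E : Type*} [SeminormedAddCommGroup E] [NormedSpace 𝕜 E]
    (π : IsometricRep 𝕜 G E) (g : G) : (E ⧸ π.invariants) →ₗ[𝕜] (E ⧸ π.invariants) :=
  π.invariants.mapQ π.invariants (π.toHom g).toLinearEquiv.toLinearMap (π.map_mem_invariants g)

theorem quotientMap_mk {𝕜 : Type*} [RCLike 𝕜] {G : Type*} [Group G] [TopologicalSpace G]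
    {E : Type*} [SeminormedAddCommGroup E] [NormedSpace 𝕜 E]
    (π : IsometricRep 𝕜 G E) (g : G) (x : E) :
    π.quotientMap g (Submodule.Quotient.mk x) = Submodule.Quotient.mk (π.toHom g x) := rfl

theorem quotientMap_mul {𝕜 : Type*} [RCLike 𝕜] {G : Type*} [Group G] [TopologicalSpace G]
    {E : Type*} [SeminormedAddCommGroup E] [NormedSpace 𝕜 E]
    (π : IsometricRep 𝕜 G E) (g h : G) (x : E ⧸ π.invariants) :
    π.quotientMap (g * h) x = π.quotientMap g (π.quotientMap h x) := by
  obtain ⟨x, rfl⟩ := Submodule.Quotient.mk_surjective _ x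
  simp only [quotientMap_mk, map_mul]
  rfl

theorem quotientMap_one {𝕜 : Type*} [RCLike 𝕜] {G : Type*} [Group G] [TopologicalSpace G]
    {E : Type*} [SeminormedAddCommGroup E] [NormedSpace 𝕜 E]
    (π : IsometricRep 𝕜 G E) (x : E ⧸ π.invariants) : π.quotientMap 1 x = x := by
  obtain ⟨x, rfl⟩ := Submodule.Quotient.mk_surjective _ x
  simp only [quotientMap_mk, map_one, LinearIsometryEquiv.coe_one, id]

theorem norm_quotientMap_le {𝕜 : Type*} [RCLike 𝕜] {G : Type*} [Group G] [TopologicalSpace G]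
    {E : Type*} [SeminormedAddCommGroup E] [NormedSpace 𝕜 E]
    (π : IsometricRep 𝕜 G E) (g : G) (x : E ⧸ π.invariants) :
    ‖π.quotientMap g x‖ ≤ ‖x‖ := by
  refine le_of_forall_pos_lt_add fun ε hε => ?_
  obtain ⟨y, rfl, hy⟩ := Submodule.Quotient.norm_mk_lt x hε
  rw [quotientMap_mk]
  refine lt_of_le_of_lt (Submodule.Quotient.norm_mk_le _ _) ?_
  rwa [LinearIsometryEquiv.norm_map]

theorem norm_quotientMap {𝕜 : Type*} [RCLike 𝕜] {G : Type*} [Group G] [TopologicalSpace G]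
    {E : Type*} [SeminormedAddCommGroup E] [NormedSpace 𝕜 E]
    (π : IsometricRep 𝕜 G E) (g : G) (x : E ⧸ π.invariants) :
    ‖π.quotientMap g x‖ = ‖x‖ := by
  refine le_antisymm (π.norm_quotientMap_le g x) ?_
  have h := π.norm_quotientMap_le g⁻¹ (π.quotientMap g x)
  rwa [← quotientMap_mul, inv_mul_cancel, quotientMap_one] at h

/-- The quotient representation `π'` of `G` on `E / E^{π(G)}` with the quotient norm,
given by `π'(g) [x] = [π(g) x]`. -/
noncomputable def quotient {𝕜 : Type*} [RCLike 𝕜] {G : Type*} [Group G] [TopologicalSpace G]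
    {E : Type*} [SeminormedAddCommGroup E] [NormedSpace 𝕜 E]
    (π : IsometricRep 𝕜 G E) : IsometricRep 𝕜 G (E ⧸ π.invariants) where
  toHom :=
    { toFun := fun g =>
        { toLinearEquiv := LinearEquiv.ofLinearMap (π.quotientMap g) (π.quotientMap g⁻¹)
            (LinearMap.ext fun x => by
              simp [← quotientMap_mul, quotientMap_one])
            (LinearMap.ext fun x => by
              simp [← quotientMap_mul, quotientMap_one])
          norm_map' := fun x => π.norm_quotientMap g x }
      map_one' := LinearIsometryEquiv.ext fun x => π.quotientMap_one x
      map_mul' := fun g h => LinearIsometryEquiv.ext fun x => π.quotientMap_mul g h x }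
  continuous_orbit := fun x => by
    obtain ⟨x, rfl⟩ := Submodule.Quotient.mk_surjective _ x
    exact (continuous_quot_mk).comp (π.continuous_orbit x)

/-- `π` has almost invariant vectors. On a non-empty compact set the continuous function
`g ↦ ‖π(g) ξ - ξ‖` attains its supremum, so `sup_K < ε` is the pointwise bound on `K`. -/
def HasAlmostInvariantVectors {𝕜 : Type*} [RCLike 𝕜] {G : Type*} [Group G] [TopologicalSpace G]
    {E : Type*} [SeminormedAddCommGroup E] [NormedSpace 𝕜 E] (π : IsometricRep 𝕜 G E) : Prop :=
  ∀ K : Set G, IsCompact K → ∀ ε : ℝ, 0 < ε →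
    ∃ ξ : E, ‖ξ‖ = 1 ∧ ∀ g ∈ K, ‖π.toHom g ξ - ξ‖ < ε

end IsometricRep

/-- Banach property `(T_E)` of the topological group `G`. -/
def HasBanachPropertyT (𝕜 : Type*) [RCLike 𝕜] (G : Type*) [Group G] [TopologicalSpace G]
    (E : Type*) [NormedAddCommGroup E] [NormedSpace 𝕜 E] : Prop :=
  ∀ π : IsometricRep 𝕜 G E, ¬ π.quotient.HasAlmostInvariantVectors

/-! The theorem combines relative property (T) for the six root subgroups of `SL₃(ℤ)` with bounded
generation by elementary matrices. The action on `E / E^π` has no nonzero invariant vector, since an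
isometric action cannot drift linearly, and the quotient keeps an equivalent uniformly convex gauge.

The analytic core is an estimate for Heisenberg triples. If `x y = y x u` with `u` central, then `x
^ i * y ^ l = y ^ l * x ^ i * u ^ (i * l)`, so averaging over powers of `x` and of `y` is a Fourier
transform with kernel `u ^ (i * l)`. On vectors where `u` has spectral scale `2 ^ (-k)` this
transform factors, as in the Cooley–Tukey algorithm, into butterflies forming means `(a + B c) / 2`.
Uniform convexity makes each butterfly a strict contraction in mean square: otherwise `a` would be
close to most of the `B c`, whose average is almost zero. With `m` separated digits the decay is
exponential in `m`, while the required scales are only quadratic in `m` (`butterfly_le`,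
`digitAvg_fourier_le`, `norm_isoAvg_isoAvg_sq_le`).

Hence, in a product of averages of lengths `2 ^ a`, `2 ^ b`, `2 ^ c` over `x`, `y` and the centre,
`c` may be changed almost for free while it stays well below `a + b`; when it is well above `a + b`,
the averages over `x` and `y` almost commute instead. In the `A₂` hexagon every root lies between
two roots whose commutator it is, so these two rules let all scales in a product of six averages
grow. The errors are summable, so the products are Cauchy in operator norm. A vector almost fixed by
a finite set is almost fixed by one such product, hence by all later ones, whose ranges are less and
less moved by a given power of the first root element. Thus it is almost fixed by every root
subgroup, uniformly (`IsHexagon.exists_finite_norm_zpow_sub_le`).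

By bounded generation (`mem_elementaryBall`, after Carter and Keller) the whole orbit of the vector
then stays within half its length. The limit of a norm-minimising sequence in the convex hull of the
orbit is a nonzero invariant vector (`exists_invariant_ne_zero`), a contradiction. -/

/-! ### Averages over integers with prescribed digits -/

/-- Digit averages: the average of `f` over all `∑ j < n, 2 ^ s j * λ j` with digits `λ j < Λ`. -/
noncomputable def digitAvg {V : Type*} [AddCommGroup V] [Module ℝ V] (Λ : ℕ) (s : ℕ → ℕ) :
    ℕ → ((ℕ → V) →ₗ[ℝ] V)
  | 0 => LinearMap.proj 0
  | n + 1 => (Λ : ℝ)⁻¹ • ∑ c ∈ Finset.range Λ,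
      (digitAvg Λ s n).comp (LinearMap.funLeft ℝ V (fun i => i + 2 ^ s n * c))

section DigitAvg

variable {V : Type*} [AddCommGroup V] [Module ℝ V]

theorem digitAvg_zero (Λ : ℕ) (s : ℕ → ℕ) (f : ℕ → V) : digitAvg Λ s 0 f = f 0 := rfl

theorem digitAvg_succ (Λ : ℕ) (s : ℕ → ℕ) (n : ℕ) (f : ℕ → V) :
    digitAvg Λ s (n + 1) f =
      (Λ : ℝ)⁻¹ • ∑ c ∈ Finset.range Λ, digitAvg Λ s n (fun i => f (i + 2 ^ s n * c)) := by
  simp only [digitAvg, LinearMap.smul_apply, LinearMap.sum_apply, LinearMap.comp_apply]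
  rfl

theorem digitAvg_two_succ (s : ℕ → ℕ) (n : ℕ) (f : ℕ → V) :
    digitAvg 2 s (n + 1) f =
      (2 : ℝ)⁻¹ • (digitAvg 2 s n f + digitAvg 2 s n (fun i => f (i + 2 ^ s n))) := by
  rw [digitAvg_succ]
  simp [Finset.sum_range_succ]

theorem map_digitAvg {W : Type*} [AddCommGroup W] [Module ℝ W] (T : V →ₗ[ℝ] W) (Λ : ℕ)
    (s : ℕ → ℕ) (n : ℕ) (f : ℕ → V) :
    T (digitAvg Λ s n f) = digitAvg Λ s n (fun i => T (f i)) := by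
  induction n generalizing f with
  | zero => rfl
  | succ n ih => simp only [digitAvg_succ, map_smul, map_sum, ih]

theorem digitAvg_const {Λ : ℕ} (hΛ : 0 < Λ) (s : ℕ → ℕ) (n : ℕ) (v : V) :
    digitAvg Λ s n (fun _ => v) = v := by
  induction n with
  | zero => rfl
  | succ n ih =>
    have h : (Λ : ℝ) ≠ 0 := by positivity
    rw [digitAvg_succ]
    simp only [ih, Finset.sum_const, Finset.card_range]
    rw [← Nat.cast_smul_eq_nsmul ℝ, smul_smul, inv_mul_cancel₀ h, one_smul]

theorem digitAvg_comm (Λ Λ' : ℕ) (s s' : ℕ → ℕ) (n n' : ℕ) (f : ℕ → ℕ → V) :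
    digitAvg Λ s n (fun i => digitAvg Λ' s' n' (fun j => f i j)) =
      digitAvg Λ' s' n' (fun j => digitAvg Λ s n (fun i => f i j)) := by
  induction n generalizing f with
  | zero => rfl
  | succ n ih =>
    simp only [digitAvg_succ Λ, ih]
    have := (digitAvg Λ' s' n').map_smul (Λ : ℝ)⁻¹
      (∑ c ∈ Finset.range Λ, fun j => digitAvg Λ s n (fun i => f (i + 2 ^ s n * c) j))
    rw [map_sum] at this
    rw [← this]
    congr 1
    ext j
    simp

theorem digitAvg_mono (Λ : ℕ) (s : ℕ → ℕ) (n : ℕ) {f g : ℕ → ℝ} (h : ∀ i, f i ≤ g i) :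
    digitAvg Λ s n f ≤ digitAvg Λ s n g := by
  induction n generalizing f g with
  | zero => exact h 0
  | succ n ih =>
    simp only [digitAvg_succ, smul_eq_mul]
    gcongr
    exact ih fun i => h _

theorem norm_digitAvg_le {F : Type*} [SeminormedAddCommGroup F] [NormedSpace ℝ F] (Λ : ℕ)
    (s : ℕ → ℕ) (n : ℕ) (f : ℕ → F) :
    ‖digitAvg Λ s n f‖ ≤ digitAvg Λ s n (fun i => ‖f i‖) := by
  induction n generalizing f with
  | zero => exact le_rfl
  | succ n ih =>
    simp only [digitAvg_succ, smul_eq_mul]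
    rw [norm_smul, Real.norm_of_nonneg (by positivity)]
    gcongr
    exact (norm_sum_le _ _).trans (Finset.sum_le_sum fun c _ => ih _)

theorem sq_digitAvg_le {Λ : ℕ} (hΛ : 0 < Λ) (s : ℕ → ℕ) (n : ℕ) (f : ℕ → ℝ) :
    (digitAvg Λ s n f) ^ 2 ≤ digitAvg Λ s n (fun i => f i ^ 2) := by
  set m := digitAvg Λ s n f with hm
  have h0 : (0 : ℝ) ≤ digitAvg Λ s n (fun i => (f i - m) ^ 2) := by
    rw [← digitAvg_const hΛ s n (0 : ℝ)]
    exact digitAvg_mono _ _ _ fun i => sq_nonneg _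
  have h1 : (fun i => (f i - m) ^ 2) =
      (fun i => f i ^ 2) + ((-2 * m) • f + fun _ => m ^ 2) := by
    ext i; simp; ring
  rw [h1, map_add, map_add, map_smul, digitAvg_const hΛ, ← hm, smul_eq_mul] at h0
  nlinarith

/-- Binary digit averages only see indices below `2 ^ b` when all digit positions are below `b`. -/
theorem digitAvg_two_le {s : ℕ → ℕ} (hs : StrictMono s) (n b : ℕ) (hb : ∀ j < n, s j < b)
    {f : ℕ → ℝ} {e : ℝ} (h : ∀ i < 2 ^ b, f i ≤ e) : digitAvg 2 s n f ≤ e := by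
  induction n generalizing b f with
  | zero => exact h 0 (by positivity)
  | succ n ih =>
    have hlt : 2 ^ (s n + 1) ≤ 2 ^ b := Nat.pow_le_pow_right (by norm_num) (hb n (by omega))
    rw [pow_succ] at hlt
    rw [digitAvg_two_succ, smul_eq_mul]
    have h1 : digitAvg 2 s n f ≤ e := ih (s n) (fun j hj => hs hj) fun i hi => h i (by omega)
    have h2 : digitAvg 2 s n (fun i => f (i + 2 ^ s n)) ≤ e :=
      ih (s n) (fun j hj => hs hj) fun i hi => h _ (by omega)
    linarith

theorem norm_digitAvg_two_sub_le {F : Type*} [SeminormedAddCommGroup F] [NormedSpace ℝ F]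
    {s : ℕ → ℕ} (hs : StrictMono s) (n b : ℕ) (hb : ∀ j < n, s j < b)
    {f g : ℕ → F} {e : ℝ} (h : ∀ i < 2 ^ b, ‖f i - g i‖ ≤ e) :
    ‖digitAvg 2 s n f - digitAvg 2 s n g‖ ≤ e := by
  rw [← map_sub]
  exact (norm_digitAvg_le _ _ _ _).trans (digitAvg_two_le hs n b hb h)

end DigitAvg

theorem norm_digitAvg_two_le {F : Type*} [SeminormedAddCommGroup F] [NormedSpace ℝ F]
    (s : ℕ → ℕ) (n : ℕ) {f : ℕ → F} {e : ℝ} (h : ∀ i, ‖f i‖ ≤ e) : ‖digitAvg 2 s n f‖ ≤ e := by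
  refine (norm_digitAvg_le _ _ _ _).trans ?_
  rw [← digitAvg_const (by norm_num : 0 < 2) s n e]
  exact digitAvg_mono _ _ _ h

theorem sq_norm_avg_le {F : Type*} [SeminormedAddCommGroup F] [NormedSpace ℝ F] {Λ : ℕ}
    (f : ℕ → F) :
    ‖(Λ : ℝ)⁻¹ • ∑ c ∈ Finset.range Λ, f c‖ ^ 2 ≤ (Λ : ℝ)⁻¹ * ∑ c ∈ Finset.range Λ, ‖f c‖ ^ 2 := by
  rcases Nat.eq_zero_or_pos Λ with rfl | hΛ
  · simp
  have h := sq_digitAvg_le hΛ (fun _ => 0) 1 (fun i => ‖f i‖)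
  have h2 := norm_digitAvg_le Λ (fun _ => 0) 1 f
  simp only [digitAvg_succ, digitAvg_zero, smul_eq_mul, pow_zero, one_mul, zero_add] at h h2
  exact (pow_le_pow_left₀ (norm_nonneg _) h2 2).trans h

/-! ### Butterflies and the vector-valued Fourier estimate -/

/-- The contraction factor of one butterfly step in a space with convexity constant `C`. -/
noncomputable def butterflyRate (C : ℝ) : ℝ := (1 / 2 + 9 / 2 * C) / (1 + 9 / 2 * C)

theorem butterflyRate_pos {C : ℝ} (hC : 0 ≤ C) : 0 < butterflyRate C := by
  unfold butterflyRate; positivity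

theorem butterflyRate_lt_one {C : ℝ} (hC : 0 ≤ C) : butterflyRate C < 1 := by
  unfold butterflyRate
  rw [div_lt_one (by positivity)]
  linarith

theorem LinearIsometryEquiv.coe_mul_apply {F : Type*} [SeminormedAddCommGroup F]
    [NormedSpace ℝ F] (x y : F ≃ₗᵢ[ℝ] F) (v : F) : (x * y) v = x (y v) := rfl

theorem avg_digitAvg {V : Type*} [AddCommGroup V] [Module ℝ V] (Λ Λ' : ℕ) (s : ℕ → ℕ) (n : ℕ)
    (G : ℕ → ℕ → V) :
    (Λ : ℝ)⁻¹ • ∑ c ∈ Finset.range Λ, digitAvg Λ' s n (fun i => G c i) =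
      digitAvg Λ' s n (fun i => (Λ : ℝ)⁻¹ • ∑ c ∈ Finset.range Λ, G c i) := by
  have h := digitAvg_comm Λ Λ' (fun _ => 0) s 1 n G
  simpa only [digitAvg_succ Λ, digitAvg_zero, pow_zero, one_mul, zero_add] using h

section Fourier

variable {F : Type*} [SeminormedAddCommGroup F] [NormedSpace ℝ F]

/-- With `A`, `Q`, `O` the mean squares of `a`, `a - B` and `(a + B) / 2`, three inequalities
suffice: `Q + C * O ≤ (1/9 + C) * N` by convexity, `O ≤ 2 * A + Q / 2` by the triangle inequality,
and `A ≤ 2 * Q + 2 * ε ^ 2` because `a` is the mean of `a - B c` plus the small mean of `B c`.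
Eliminating `A` and `Q` gives the rate; the constant `1/18` is small enough to make it less than
one. -/
theorem butterfly_le {C : ℝ} (hC : 0 ≤ C)
    (hUC : ∀ x y : F, ‖x - y‖ ^ 2 ≤ 1 / 18 * (‖x‖ ^ 2 + ‖y‖ ^ 2) +
      C * ((‖x‖ ^ 2 + ‖y‖ ^ 2) / 2 - ‖(2 : ℝ)⁻¹ • (x + y)‖ ^ 2))
    {Λ : ℕ} (hΛ : 0 < Λ) (t : ℕ → ℕ) (n : ℕ) (a b : ℕ → F) (B : ℕ → ℕ → F) {ε N : ℝ}
    (hB : ∀ c l, ‖B c l‖ = ‖b l‖)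
    (hε : ∀ l, ‖(Λ : ℝ)⁻¹ • ∑ c ∈ Finset.range Λ, B c l‖ ≤ ε)
    (ha : digitAvg Λ t n (fun l => ‖a l‖ ^ 2) ≤ N)
    (hb : digitAvg Λ t n (fun l => ‖b l‖ ^ 2) ≤ N) :
    (Λ : ℝ)⁻¹ * ∑ c ∈ Finset.range Λ, digitAvg Λ t n (fun l => ‖(2 : ℝ)⁻¹ • (a l + B c l)‖ ^ 2) ≤
      butterflyRate C * N + 4 * ε ^ 2 := by
  have hΛ' : (0 : ℝ) < Λ := by exact_mod_cast hΛ
  set D := digitAvg (V := ℝ) Λ t n with hD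
  set A := D (fun l => ‖a l‖ ^ 2)
  set q : ℕ → ℕ → ℝ := fun c l => ‖a l - B c l‖ ^ 2 with hq
  set o : ℕ → ℕ → ℝ := fun c l => ‖(2 : ℝ)⁻¹ • (a l + B c l)‖ ^ 2 with ho
  set Q := (Λ : ℝ)⁻¹ * ∑ c ∈ Finset.range Λ, D (q c) with hQ
  set O := (Λ : ℝ)⁻¹ * ∑ c ∈ Finset.range Λ, D (o c) with hO
  have avg_le : ∀ f g : ℕ → ℝ, (∀ c, f c ≤ g c) →
      (Λ : ℝ)⁻¹ * ∑ c ∈ Finset.range Λ, f c ≤ (Λ : ℝ)⁻¹ * ∑ c ∈ Finset.range Λ, g c := by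
    intro f g h
    gcongr
    exact h _
  have avg_const : ∀ x : ℝ, (Λ : ℝ)⁻¹ * ∑ c ∈ Finset.range Λ, x = x := by
    intro x
    rw [Finset.sum_const, Finset.card_range, nsmul_eq_mul]
    field_simp
  have h1 : Q ≤ (1 / 9 + C) * N - C * O := by
    have hc : ∀ c, D (q c) + C * D (o c) ≤ (1 / 9 + C) * N := by
      intro c
      have h := digitAvg_mono Λ t n (f := q c + C • o c)
        (g := (1 / 18 + C / 2) • ((fun l => ‖a l‖ ^ 2) + fun l => ‖b l‖ ^ 2)) (by
          intro l
          have := hUC (a l) (B c l)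
          rw [hB] at this
          simp only [Pi.add_apply, Pi.smul_apply, smul_eq_mul, hq, ho]
          linarith)
      simp only [map_add, map_smul, smul_eq_mul] at h
      have hC' : 0 ≤ 1 / 18 + C / 2 := by positivity
      nlinarith
    have h := avg_le _ _ hc
    rw [avg_const, Finset.sum_add_distrib, ← Finset.mul_sum, mul_add] at h
    have : C * O = (Λ : ℝ)⁻¹ * (C * ∑ c ∈ Finset.range Λ, D (o c)) := by rw [hO]; ring
    linarith
  have h2 : O ≤ 2 * A + 1 / 2 * Q := by
    have hc : ∀ c, D (o c) ≤ 2 * A + 1 / 2 * D (q c) := by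
      intro c
      have h := digitAvg_mono Λ t n (f := o c)
        (g := (2 : ℝ) • (fun l => ‖a l‖ ^ 2) + (1 / 2 : ℝ) • q c) (by
          intro l
          have e : (2 : ℝ)⁻¹ • (a l + B c l) = a l - (2 : ℝ)⁻¹ • (a l - B c l) := by module
          have h3 : ‖(2 : ℝ)⁻¹ • (a l + B c l)‖ ≤ ‖a l‖ + 2⁻¹ * ‖a l - B c l‖ := by
            rw [e]
            refine (norm_sub_le _ _).trans ?_
            rw [norm_smul, Real.norm_of_nonneg (by norm_num)]
          simp only [Pi.add_apply, Pi.smul_apply, smul_eq_mul, hq, ho]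
          have h4 := pow_le_pow_left₀ (norm_nonneg _) h3 2
          nlinarith [sq_nonneg (‖a l‖ - 2⁻¹ * ‖a l - B c l‖)])
      simpa only [map_add, map_smul, smul_eq_mul] using h
    have h := avg_le _ _ hc
    rw [Finset.sum_add_distrib, ← Finset.mul_sum _ (fun c => D (q c)), mul_add, avg_const] at h
    have : 1 / 2 * Q = (Λ : ℝ)⁻¹ * (1 / 2 * ∑ c ∈ Finset.range Λ, D (q c)) := by rw [hQ]; ring
    linarith
  have h3 : A ≤ 2 * Q + 2 * ε ^ 2 := by
    have h := digitAvg_mono Λ t n (f := fun l => ‖a l‖ ^ 2)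
      (g := (2 : ℝ) • ((Λ : ℝ)⁻¹ • ∑ c ∈ Finset.range Λ, q c) + fun _ => 2 * ε ^ 2) (by
        intro l
        have e : a l = (Λ : ℝ)⁻¹ • ∑ c ∈ Finset.range Λ, (a l - B c l) +
            (Λ : ℝ)⁻¹ • ∑ c ∈ Finset.range Λ, B c l := by
          rw [← smul_add, ← Finset.sum_add_distrib]
          simp only [sub_add_cancel, Finset.sum_const, Finset.card_range]
          rw [← Nat.cast_smul_eq_nsmul ℝ, smul_smul, inv_mul_cancel₀ hΛ'.ne', one_smul]
        have h4 : ‖a l‖ ≤ ‖(Λ : ℝ)⁻¹ • ∑ c ∈ Finset.range Λ, (a l - B c l)‖ + ε := by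
          conv_lhs => rw [e]
          exact (norm_add_le _ _).trans (by gcongr; exact hε l)
        have h5 := sq_norm_avg_le (Λ := Λ) (fun c => a l - B c l)
        have h6 := pow_le_pow_left₀ (norm_nonneg _) h4 2
        simp only [Pi.add_apply, Pi.smul_apply, smul_eq_mul, Finset.sum_apply, hq]
        nlinarith [sq_nonneg (‖(Λ : ℝ)⁻¹ • ∑ c ∈ Finset.range Λ, (a l - B c l)‖ - ε)])
    simp only [map_add, map_smul, map_sum, smul_eq_mul, digitAvg_const hΛ] at h
    exact h
  have h7 : O * (1 + 9 / 2 * C) ≤ (1 / 2 + 9 / 2 * C) * N + 4 * ε ^ 2 := by nlinarith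
  have h8 : O ≤ ((1 / 2 + 9 / 2 * C) * N + 4 * ε ^ 2) / (1 + 9 / 2 * C) := by
    rw [le_div_iff₀ (by positivity)]; exact h7
  refine h8.trans ?_
  have h9 : butterflyRate C * N = (1 / 2 + 9 / 2 * C) * N / (1 + 9 / 2 * C) := by
    unfold butterflyRate; ring
  rw [add_div, h9]
  exact add_le_add_right (div_le_self (by positivity) (by linarith)) _

/-- A vector-valued Cooley–Tukey estimate for the "Fourier transform" with kernel `z ^ (i * l)`,
where `z` is an isometry and `ζ` localizes `z` at scale `2 ^ (-k)`. -/
theorem digitAvg_fourier_le {C : ℝ} (hC : 0 ≤ C)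
    (hUC : ∀ x y : F, ‖x - y‖ ^ 2 ≤ 1 / 18 * (‖x‖ ^ 2 + ‖y‖ ^ 2) +
      C * ((‖x‖ ^ 2 + ‖y‖ ^ 2) / 2 - ‖(2 : ℝ)⁻¹ • (x + y)‖ ^ 2))
    {Λ : ℕ} (hΛ : 0 < Λ) (s t : ℕ → ℕ) (hs : StrictMono s) (k n : ℕ)
    (hst : ∀ j < n, s j + t j = k)
    (z : F ≃ₗᵢ[ℝ] F) (ζ : F →L[ℝ] F) (hz : ∀ (m : ℕ) (v : F), (z ^ m) (ζ v) = ζ ((z ^ m) v))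
    {e ε : ℝ}
    (h0 : ∀ v, ‖ζ v‖ ≤ 2 * ‖v‖)
    (h1 : ∀ j < n, ∃ b, (∀ j' < j, s j' < b) ∧ ∀ c < Λ, ∀ i < 2 ^ b, ∀ v,
      ‖ζ ((z ^ (i * (2 ^ t j * c))) v) - ζ v‖ ≤ e * ‖v‖)
    (h2 : ∀ v, ‖(Λ : ℝ)⁻¹ • ∑ c ∈ Finset.range Λ, (z ^ (2 ^ k * c)) (ζ v)‖ ≤ ε * ‖v‖)
    (he : 0 ≤ e) (hε : 0 ≤ ε)
    (f : ℕ → F) (hf : ∀ i, ‖f i‖ ≤ 1) :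
    digitAvg Λ t n (fun l => ‖digitAvg 2 s n (fun i => (z ^ (i * l)) (ζ (f i)))‖ ^ 2) ≤
      4 * butterflyRate C ^ n + (4 * ε ^ 2 + 4 * e + e ^ 2) / (1 - butterflyRate C) := by
  have hr0 := butterflyRate_pos hC
  have hr1 := butterflyRate_lt_one hC
  induction n generalizing f with
  | zero =>
    simp only [digitAvg_zero, pow_zero, mul_one, mul_zero, LinearIsometryEquiv.coe_one, id]
    have h3 : ‖ζ (f 0)‖ ≤ 2 := by linarith [h0 (f 0), hf 0]
    have h4 : 0 ≤ (4 * ε ^ 2 + 4 * e + e ^ 2) / (1 - butterflyRate C) :=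
      div_nonneg (by positivity) (by linarith)
    nlinarith [norm_nonneg (ζ (f 0))]
  | succ n ih =>
    have ih' := ih (fun j hj => hst j (by omega)) (fun j hj => h1 j (by omega))
    set N := 4 * butterflyRate C ^ n + (4 * ε ^ 2 + 4 * e + e ^ 2) / (1 - butterflyRate C) with hN
    -- The top binary digit of `i` is split off: `a` collects digit `0` and `b` digit `1`. As `s n +
    -- t n = k`, the new digit `c` of `l` multiplies the second half by `z ^ (2 ^ k * c)`, which
    -- oscillates; its effect on the lower digits of `i` is bounded by `e`.
    set a : ℕ → F := fun l => digitAvg 2 s n (fun i => (z ^ (i * l)) (ζ (f i))) with ha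
    set b : ℕ → F := fun l => digitAvg 2 s n (fun i => (z ^ (i * l)) (ζ (f (i + 2 ^ s n)))) with hb
    set B : ℕ → ℕ → F := fun c l => (z ^ (2 ^ k * c)) ((z ^ (2 ^ s n * l)) (b l)) with hB
    have map_z : ∀ (m : ℕ) (g : ℕ → F),
        (z ^ m) (digitAvg 2 s n g) = digitAvg 2 s n (fun i => (z ^ m) (g i)) := fun m g =>
      map_digitAvg ((z ^ m).toLinearEquiv : F →ₗ[ℝ] F) 2 s n g
    have hbfly := butterfly_le hC hUC hΛ t n a b B (ε := ε) (N := N)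
      (fun c l => by simp only [hB, LinearIsometryEquiv.norm_map])
      (fun l => by
        have e1 : (Λ : ℝ)⁻¹ • ∑ c ∈ Finset.range Λ, B c l = digitAvg 2 s n (fun i =>
            (z ^ (2 ^ s n * l + i * l))
              ((Λ : ℝ)⁻¹ • ∑ c ∈ Finset.range Λ, (z ^ (2 ^ k * c)) (ζ (f (i + 2 ^ s n))))) := by
          simp only [hB, hb, map_z]
          rw [avg_digitAvg]
          congr 1
          ext i
          rw [map_smul, map_sum]
          congr 1
          refine Finset.sum_congr rfl fun c _ => ?_
          simp only [← LinearIsometryEquiv.coe_mul_apply, ← pow_add]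
          congr 2
          ring
        rw [e1]
        refine norm_digitAvg_two_le s n fun i => ?_
        rw [LinearIsometryEquiv.norm_map]
        exact (h2 _).trans (by nlinarith [hf (i + 2 ^ s n), hε]))
      (ih' f hf) (ih' _ fun i => hf _)
    rw [digitAvg_succ, smul_eq_mul]
    have key : ∀ c ∈ Finset.range Λ, digitAvg Λ t n (fun l => ‖digitAvg 2 s (n + 1)
        (fun i => (z ^ (i * (l + 2 ^ t n * c))) (ζ (f i)))‖ ^ 2) ≤
        digitAvg Λ t n (fun l => ‖(2 : ℝ)⁻¹ • (a l + B c l)‖ ^ 2) + (4 * e + e ^ 2) := by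
      intro c hc
      have hcΛ : c < Λ := Finset.mem_range.1 hc
      rw [← digitAvg_const hΛ t n (4 * e + e ^ 2), ← map_add]
      refine digitAvg_mono _ _ _ fun l => ?_
      rw [Pi.add_apply]
      set Φ := digitAvg 2 s (n + 1) (fun i => (z ^ (i * (l + 2 ^ t n * c))) (ζ (f i))) with hΦ
      obtain ⟨bd, hbd, hbd'⟩ := h1 n (by omega)
      have step : ∀ (g : ℕ → F), (∀ i, ‖g i‖ ≤ 1) →
          ‖digitAvg 2 s n (fun i => (z ^ (i * l + i * (2 ^ t n * c))) (ζ (g i))) -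
            digitAvg 2 s n (fun i => (z ^ (i * l)) (ζ (g i)))‖ ≤ e := by
        intro g hg
        refine norm_digitAvg_two_sub_le hs n bd hbd fun i hi => ?_
        rw [pow_add, LinearIsometryEquiv.coe_mul_apply, ← map_sub, LinearIsometryEquiv.norm_map, hz]
        exact (hbd' c hcΛ i hi _).trans (by nlinarith [hg i])
      have hΦ' : Φ = (2 : ℝ)⁻¹ • (digitAvg 2 s n
            (fun i => (z ^ (i * l + i * (2 ^ t n * c))) (ζ (f i))) +
          (z ^ (2 ^ k * c)) ((z ^ (2 ^ s n * l)) (digitAvg 2 s n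
            (fun i => (z ^ (i * l + i * (2 ^ t n * c))) (ζ (f (i + 2 ^ s n))))))) := by
        rw [hΦ, digitAvg_two_succ, map_z, map_z]
        congr 3
        · ext i
          rw [mul_add]
        · ext i
          simp only [← LinearIsometryEquiv.coe_mul_apply, ← pow_add]
          congr 2
          rw [← hst n (by omega), pow_add]
          ring
      have hd : ‖Φ - (2 : ℝ)⁻¹ • (a l + B c l)‖ ≤ e := by
        rw [hΦ', ← smul_sub, add_sub_add_comm, norm_smul, Real.norm_of_nonneg (by norm_num)]
        have s1 := step f hf
        have s2 := step (fun i => f (i + 2 ^ s n)) fun i => hf _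
        have s3 := norm_add_le
          (digitAvg 2 s n (fun i => (z ^ (i * l + i * (2 ^ t n * c))) (ζ (f i))) - a l)
          ((z ^ (2 ^ k * c)) ((z ^ (2 ^ s n * l)) (digitAvg 2 s n
            (fun i => (z ^ (i * l + i * (2 ^ t n * c))) (ζ (f (i + 2 ^ s n)))))) - B c l)
        simp only [hB, ← map_sub, LinearIsometryEquiv.norm_map] at s3 ⊢
        linarith
      have hle2 : ‖(2 : ℝ)⁻¹ • (a l + B c l)‖ ≤ 2 := by
        have bz : ∀ g : ℕ → F, (∀ i, ‖g i‖ ≤ 1) →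
            ‖digitAvg 2 s n (fun i => (z ^ (i * l)) (ζ (g i)))‖ ≤ 2 := by
          intro g hg
          refine norm_digitAvg_two_le s n fun i => ?_
          rw [LinearIsometryEquiv.norm_map]
          exact (h0 _).trans (by linarith [hg i])
        rw [norm_smul, Real.norm_of_nonneg (by norm_num)]
        have s1 := bz f hf
        have s2 := bz (fun i => f (i + 2 ^ s n)) fun i => hf _
        have s3 := norm_add_le (a l) (B c l)
        simp only [hB, LinearIsometryEquiv.norm_map] at s3 ⊢
        linarith
      have h5 : ‖Φ‖ ≤ ‖(2 : ℝ)⁻¹ • (a l + B c l)‖ + e := by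
        have := norm_add_le (Φ - (2 : ℝ)⁻¹ • (a l + B c l)) ((2 : ℝ)⁻¹ • (a l + B c l))
        rw [sub_add_cancel] at this
        linarith
      -- The mean has norm at most `2`, so an error `e` in norm costs `4 * e + e ^ 2` in the square.
      nlinarith [norm_nonneg Φ, norm_nonneg ((2 : ℝ)⁻¹ • (a l + B c l))]
    have hΛ' : (0 : ℝ) < Λ := by exact_mod_cast hΛ
    have hsum := Finset.sum_le_sum key
    rw [Finset.sum_add_distrib, Finset.sum_const, Finset.card_range, nsmul_eq_mul] at hsum
    have h6 := mul_le_mul_of_nonneg_left hsum (inv_nonneg.2 hΛ'.le)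
    rw [mul_add, inv_mul_cancel_left₀ hΛ'.ne'] at h6
    -- The recursion is `N ↦ r * N + const`, and `const / (1 - r)` is its fixed point.
    refine h6.trans ((add_le_add_left hbfly _).trans (le_of_eq ?_))
    have : 1 - butterflyRate C ≠ 0 := by linarith
    rw [hN]
    field_simp
    ring

end Fourier

/-! ### Dyadic polynomials and averages of powers of an isometry -/

open Polynomial in
/-- The polynomial `∏ j ∈ S, (1 + X ^ (2 ^ j)) / 2`. -/
noncomputable def dyadicPoly (S : Finset ℕ) : ℝ[X] :=
  ∏ j ∈ S, (2 : ℝ)⁻¹ • (1 + X ^ (2 ^ j))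

open Polynomial in
theorem dyadicPoly_Ico (t H : ℕ) :
    dyadicPoly (Finset.Ico t (t + H)) =
      ((2 ^ H : ℕ) : ℝ)⁻¹ • ∑ c ∈ Finset.range (2 ^ H), X ^ (2 ^ t * c) := by
  induction H with
  | zero => simp [dyadicPoly]
  | succ H ih =>
    rw [dyadicPoly, ← add_assoc, Finset.prod_Ico_succ_top (by omega), ← dyadicPoly, ih,
      smul_mul_smul_comm]
    have h : (2 : ℕ) ^ (H + 1) = 2 ^ H + 2 ^ H := by ring
    rw [h, Finset.sum_range_add, mul_add, mul_one, Finset.sum_mul]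
    congr 1
    · push_cast
      rw [← mul_inv]
      congr 1
      ring
    · congr 1
      refine Finset.sum_congr rfl fun c _ => ?_
      rw [← pow_add]
      congr 1
      ring

theorem dyadicPoly_eq_mul {S T : Finset ℕ} (h : S ⊆ T) :
    dyadicPoly T = dyadicPoly (T \ S) * dyadicPoly S := (Finset.prod_sdiff h).symm

/-- Digit averages and full averages of powers thereby become products of the same factors `(1 + X ^
(2 ^ j)) / 2`, so a digit average with separated blocks is a divisor of a full average. -/
theorem digitAvg_pow_apply {F : Type*} [SeminormedAddCommGroup F] [NormedSpace ℝ F]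
    (T : F →L[ℝ] F) (H : ℕ) (t : ℕ → ℕ) (n : ℕ) (u : F) :
    digitAvg (2 ^ H) t n (fun l => (T ^ l) u) =
      Polynomial.aeval T (∏ j ∈ Finset.range n, dyadicPoly (Finset.Ico (t j) (t j + H))) u := by
  induction n generalizing u with
  | zero => simp [digitAvg_zero]
  | succ n ih =>
    rw [digitAvg_succ, Finset.prod_range_succ, map_mul, dyadicPoly_Ico, mul_apply_eq_comp]
    have e : ∀ c, digitAvg (2 ^ H) t n (fun l => (T ^ (l + 2 ^ t n * c)) u) =
        digitAvg (2 ^ H) t n (fun l => (T ^ l) ((T ^ (2 ^ t n * c)) u)) := fun c => by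
      simp only [pow_add, mul_apply_eq_comp]
    simp only [e, ih, ← map_sum, ← map_smul]
    congr 1
    simp

section IsoAvg

variable {F : Type*} [SeminormedAddCommGroup F] [NormedSpace ℝ F]

/-- Isometries as bounded operators. -/
def isomHom : (F ≃ₗᵢ[ℝ] F) →* (F →L[ℝ] F) where
  toFun x := x.toContinuousLinearEquiv.toContinuousLinearMap
  map_one' := rfl
  map_mul' _ _ := rfl

@[simp]
theorem isomHom_apply (x : F ≃ₗᵢ[ℝ] F) (v : F) : isomHom x v = x v := rfl

theorem aeval_isomHom_X_pow (x : F ≃ₗᵢ[ℝ] F) (m : ℕ) (v : F) :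
    Polynomial.aeval (isomHom x) ((Polynomial.X : Polynomial ℝ) ^ m) v = (x ^ m) v := by
  rw [map_pow, Polynomial.aeval_X, ← map_pow, isomHom_apply]

/-- The average of `x ^ i` over `i < 2 ^ s`. -/
noncomputable def isoAvg (x : F ≃ₗᵢ[ℝ] F) (s : ℕ) : F →L[ℝ] F :=
  ((2 ^ s : ℕ) : ℝ)⁻¹ • ∑ i ∈ Finset.range (2 ^ s), isomHom x ^ i

theorem isoAvg_eq_aeval (x : F ≃ₗᵢ[ℝ] F) (s : ℕ) :
    isoAvg x s = Polynomial.aeval (isomHom x) (dyadicPoly (Finset.range s)) := by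
  have h := dyadicPoly_Ico 0 s
  rw [zero_add, pow_zero] at h
  rw [Finset.range_eq_Ico, h, isoAvg]
  simp

theorem isoAvg_apply (x : F ≃ₗᵢ[ℝ] F) (s : ℕ) (v : F) :
    isoAvg x s v = ((2 ^ s : ℕ) : ℝ)⁻¹ • ∑ i ∈ Finset.range (2 ^ s), (x ^ i) v := by
  simp only [isoAvg, smul_apply, sum_apply, ← map_pow,
    isomHom_apply]

/-- Each factor is the mean of the identity and an isometry. Hence discarding factors can only
increase the norm, which is how a full average gets replaced by a sparse digit average. -/
theorem norm_aeval_dyadicPoly_le (x : F ≃ₗᵢ[ℝ] F) (S : Finset ℕ) (v : F) :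
    ‖Polynomial.aeval (isomHom x) (dyadicPoly S) v‖ ≤ ‖v‖ := by
  induction S using Finset.induction_on generalizing v with
  | empty => simp [dyadicPoly]
  | insert j S hj ih =>
    have e : dyadicPoly (insert j S) =
        dyadicPoly S * ((2 : ℝ)⁻¹ • (1 + Polynomial.X ^ (2 ^ j))) := by
      rw [dyadicPoly, Finset.prod_insert hj, mul_comm, ← dyadicPoly]
    rw [e, map_mul, mul_apply_eq_comp]
    refine (ih _).trans ?_
    have e2 : (Polynomial.aeval (isomHom x)) ((2 : ℝ)⁻¹ • (1 + (Polynomial.X : Polynomial ℝ) ^ (2 ^ j))) v =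
        (2 : ℝ)⁻¹ • (v + (x ^ (2 ^ j)) v) := by
      simp [aeval_isomHom_X_pow, -map_pow]
    rw [e2, norm_smul, Real.norm_of_nonneg (by norm_num)]
    have := norm_add_le v ((x ^ (2 ^ j)) v)
    rw [LinearIsometryEquiv.norm_map] at this
    linarith

theorem norm_isoAvg_apply_le (x : F ≃ₗᵢ[ℝ] F) (s : ℕ) (v : F) : ‖isoAvg x s v‖ ≤ ‖v‖ := by
  rw [isoAvg_eq_aeval]
  exact norm_aeval_dyadicPoly_le x _ v

theorem norm_isoAvg_le (x : F ≃ₗᵢ[ℝ] F) (s : ℕ) : ‖isoAvg x s‖ ≤ 1 :=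
  ContinuousLinearMap.opNorm_le_bound _ zero_le_one fun v => by
    simpa using norm_isoAvg_apply_le x s v

theorem isoAvg_sub_succ (x : F ≃ₗᵢ[ℝ] F) (s : ℕ) (v : F) :
    isoAvg x s v - isoAvg x (s + 1) v = (2 : ℝ)⁻¹ • isoAvg x s (v - (x ^ (2 ^ s)) v) := by
  have e : dyadicPoly (Finset.range (s + 1)) =
      dyadicPoly (Finset.range s) * ((2 : ℝ)⁻¹ • (1 + Polynomial.X ^ (2 ^ s))) := by
    rw [dyadicPoly, Finset.prod_range_succ, ← dyadicPoly]
  have e2 : (Polynomial.aeval (isomHom x)) ((2 : ℝ)⁻¹ • (1 + (Polynomial.X : Polynomial ℝ) ^ (2 ^ s))) v =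
      (2 : ℝ)⁻¹ • (v + (x ^ (2 ^ s)) v) := by
    simp [aeval_isomHom_X_pow, -map_pow]
  rw [isoAvg_eq_aeval x (s + 1), e, map_mul, mul_apply_eq_comp, e2,
    ← isoAvg_eq_aeval, map_smul, map_add, map_sub]
  module

theorem commute_isoAvg {T : F →L[ℝ] F} {x : F ≃ₗᵢ[ℝ] F} (h : Commute T (isomHom x)) (s : ℕ) :
    Commute T (isoAvg x s) := by
  refine Commute.smul_right ?_ _
  exact Commute.sum_right _ _ _ fun i _ => h.pow_right i

/-- Shifting the average by one step only exchanges its two end terms, a change of `2 / 2 ^ s`; `m`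
shifts add up. -/
theorem norm_isoAvg_pow_sub_le (x : F ≃ₗᵢ[ℝ] F) (s m : ℕ) (v : F) :
    ‖(x ^ m) (isoAvg x s v) - isoAvg x s v‖ ≤ 2 * m / 2 ^ s * ‖v‖ := by
  induction m with
  | zero => simp
  | succ m ih =>
    have e : x (isoAvg x s v) - isoAvg x s v =
        ((2 ^ s : ℕ) : ℝ)⁻¹ • ((x ^ (2 ^ s)) v - v) := by
      rw [isoAvg_apply, map_smul, ← smul_sub, map_sum, ← Finset.sum_sub_distrib]
      congr 1
      have := Finset.sum_range_sub (fun i => (x ^ i) v) (2 ^ s)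
      simp only [pow_zero, LinearIsometryEquiv.coe_one, id] at this
      rw [← this]
      refine Finset.sum_congr rfl fun i _ => ?_
      rw [pow_succ']; rfl
    have h1 : ‖x (isoAvg x s v) - isoAvg x s v‖ ≤ 2 / 2 ^ s * ‖v‖ := by
      rw [e, norm_smul, norm_inv, Real.norm_of_nonneg (by positivity)]
      have := norm_sub_le ((x ^ (2 ^ s)) v) v
      rw [LinearIsometryEquiv.norm_map] at this
      push_cast
      rw [div_mul_eq_mul_div, inv_mul_eq_div]
      gcongr
      linarith
    have e2 : (x ^ (m + 1)) (isoAvg x s v) - isoAvg x s v =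
        (x ^ m) (x (isoAvg x s v) - isoAvg x s v) + ((x ^ m) (isoAvg x s v) - isoAvg x s v) := by
      rw [map_sub, pow_succ, LinearIsometryEquiv.coe_mul_apply]
      abel
    rw [e2]
    refine (norm_add_le _ _).trans ?_
    rw [LinearIsometryEquiv.norm_map]
    refine (add_le_add h1 ih).trans (le_of_eq ?_)
    push_cast
    ring

end IsoAvg

theorem prod_dyadicPoly_Ico {n H : ℕ} {t : ℕ → ℕ}
    (h : ∀ i < n, ∀ j < n, i < j → t i + H ≤ t j ∨ t j + H ≤ t i) :
    ∏ j ∈ Finset.range n, dyadicPoly (Finset.Ico (t j) (t j + H)) =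
      dyadicPoly ((Finset.range n).biUnion fun j => Finset.Ico (t j) (t j + H)) := by
  unfold dyadicPoly
  rw [Finset.prod_biUnion]
  intro i hi j hj hij
  simp only [Finset.coe_range, Set.mem_Iio] at hi hj
  rw [Function.onFun, Finset.disjoint_left]
  intro c hc hc'
  rw [Finset.mem_Ico] at hc hc'
  rcases lt_or_gt_of_ne hij with h' | h'
  · rcases h i hi j hj h' with h' | h' <;> omega
  · rcases h j hj i hi h' with h' | h' <;> omega

/-! ### The Heisenberg estimate -/

section Heisenberg

variable {F : Type*} [SeminormedAddCommGroup F] [NormedSpace ℝ F]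

/-- The smallest admissible scale for the Fourier estimate with parameter `m`. -/
def scaleUnit (m : ℕ) : ℕ := 4 * (m * m)

/-- The decay in the Heisenberg estimate. -/
noncomputable def heisenbergBound (C : ℝ) (m : ℕ) : ℝ :=
  4 * butterflyRate C ^ m +
    (4 * (2 / ((2 ^ m : ℕ) : ℝ)) ^ 2 + 4 * (8 / 2 ^ m) + (8 / 2 ^ m) ^ 2) / (1 - butterflyRate C)

theorem pow_mul_pow_of_heisenberg {G : Type*} [Group G] {x y u : G} (hxy : x * y = y * x * u)
    (hxu : Commute x u) (hyu : Commute y u) (i l : ℕ) :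
    x ^ i * y ^ l = y ^ l * x ^ i * u ^ (i * l) := by
  have h1 : ∀ i, x ^ i * y = y * x ^ i * u ^ i := by
    intro i
    induction i with
    | zero => simp
    | succ i ih =>
      calc x ^ (i + 1) * y = x * (x ^ i * y) := by rw [pow_succ']; group
        _ = x * y * x ^ i * u ^ i := by rw [ih]; group
        _ = y * x * (u * x ^ i) * u ^ i := by rw [hxy]; group
        _ = y * x * (x ^ i * u) * u ^ i := by rw [(hxu.pow_left i).eq]
        _ = y * (x * x ^ i) * (u * u ^ i) := by group
        _ = y * x ^ (i + 1) * u ^ (i + 1) := by rw [← pow_succ', ← pow_succ']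
  induction l with
  | zero => simp
  | succ l ih =>
    calc x ^ i * y ^ (l + 1) = (x ^ i * y ^ l) * y := by rw [pow_succ]; group
      _ = y ^ l * x ^ i * (u ^ (i * l) * y) := by rw [ih]; group
      _ = y ^ l * x ^ i * (y * u ^ (i * l)) := by rw [(hyu.pow_right (i * l)).eq]
      _ = y ^ l * (x ^ i * y) * u ^ (i * l) := by group
      _ = y ^ l * y * x ^ i * (u ^ i * u ^ (i * l)) := by rw [h1]; group
      _ = y ^ (l + 1) * x ^ i * u ^ (i * (l + 1)) := by
        rw [← pow_succ, ← pow_add, mul_add, mul_one, add_comm i]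

/-- Only some digits of the two averages are kept: single binary digits for `x`, blocks of `m`
digits for `y`. Moving `y ^ l` to the left creates the kernel `u ^ (i * l)`, and Jensen's inequality
over `l` leaves exactly the quantity of `digitAvg_fourier_le`. -/
theorem norm_isoAvg_isoAvg_sq_le {C : ℝ} (hC : 0 ≤ C)
    (hUC : ∀ x y : F, ‖x - y‖ ^ 2 ≤ 1 / 18 * (‖x‖ ^ 2 + ‖y‖ ^ 2) +
      C * ((‖x‖ ^ 2 + ‖y‖ ^ 2) / 2 - ‖(2 : ℝ)⁻¹ • (x + y)‖ ^ 2))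
    {x y u : F ≃ₗᵢ[ℝ] F} (hxy : x * y = y * x * u) (hxu : Commute x u) (hyu : Commute y u)
    (ζ : F →L[ℝ] F) (hζx : Commute ζ (isomHom x)) (hζy : Commute ζ (isomHom y))
    (hζu : Commute ζ (isomHom u)) {k : ℕ}
    (h0 : ∀ v, ‖ζ v‖ ≤ 2 * ‖v‖)
    (h1 : ∀ (m : ℕ) (v : F), ‖ζ ((u ^ m) v) - ζ v‖ ≤ 4 * m / 2 ^ k * ‖v‖)
    (h2 : ∀ (Λ : ℕ) (v : F), 0 < Λ →
      ‖(Λ : ℝ)⁻¹ • ∑ c ∈ Finset.range Λ, (u ^ (2 ^ k * c)) (ζ v)‖ ≤ 2 / Λ * ‖v‖)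
    {m a b : ℕ} (hm : 0 < m) (ha : scaleUnit m ≤ a) (hb : scaleUnit m ≤ b)
    (hk : scaleUnit m ≤ k) (hab : k + scaleUnit m ≤ a + b) {v : F} (hv : ‖v‖ ≤ 1) :
    ‖isoAvg x a (isoAvg y b (ζ v))‖ ^ 2 ≤ heisenbergBound C m := by
  unfold scaleUnit at *
  -- The offset `k + m - b`, truncated at `0`, is the least one for which the blocks of `y` at `t j
  -- = k - s j` end below `b`; `hab` leaves room for all `s j` below `a`. Spacing `2 * m` leaves a
  -- gap of `m` beyond the block length.
  set s : ℕ → ℕ := fun j => (k + m - b) + j * (2 * m) with hs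
  set t : ℕ → ℕ := fun j => k - s j with ht
  have hjm : ∀ j < m, j * (2 * m) + 2 * m ≤ 2 * (m * m) := by
    intro j hj
    have : (j + 1) * m ≤ m * m := Nat.mul_le_mul_right _ hj
    nlinarith
  have hmm : m ≤ m * m := Nat.le_mul_self m
  have hsa : ∀ j < m, s j + 1 ≤ a := by
    intro j hj
    have := hjm j hj
    simp only [hs]; omega
  have hsk : ∀ j < m, s j ≤ k := by
    intro j hj
    have := hjm j hj
    simp only [hs]; omega
  have htb : ∀ j < m, t j + m ≤ b := by
    intro j hj
    have := hjm j hj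
    simp only [ht, hs]; omega
  have hstep : ∀ i j, i < j → s i + 2 * m ≤ s j := by
    intro i j hij
    have : (i + 1) * (2 * m) ≤ j * (2 * m) := Nat.mul_le_mul_right _ hij
    have e : (i + 1) * (2 * m) = i * (2 * m) + 2 * m := by ring
    simp only [hs]; omega
  have hmono : StrictMono s := fun i j hij => by have := hstep i j hij; omega
  have hTd : ∀ i < m, ∀ j < m, i < j → t i + m ≤ t j ∨ t j + m ≤ t i := by
    intro i hi j hj hij
    have h3 := hstep i j hij
    have h4 := hsk j hj
    simp only [ht]; omega
  have hSd : ∀ i < m, ∀ j < m, i < j → s i + 1 ≤ s j ∨ s j + 1 ≤ s i := by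
    intro i hi j hj hij
    have h3 := hstep i j hij
    omega
  set S := (Finset.range m).biUnion fun j => Finset.Ico (s j) (s j + 1) with hS
  set T := (Finset.range m).biUnion fun j => Finset.Ico (t j) (t j + m) with hT
  have hSa : S ⊆ Finset.range a := by
    intro c hc
    simp only [hS, Finset.mem_biUnion, Finset.mem_range, Finset.mem_Ico] at hc ⊢
    obtain ⟨j, hj, hc⟩ := hc
    have := hsa j hj
    omega
  have hTb : T ⊆ Finset.range b := by
    intro c hc
    simp only [hT, Finset.mem_biUnion, Finset.mem_range, Finset.mem_Ico] at hc ⊢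
    obtain ⟨j, hj, hc⟩ := hc
    have := htb j hj
    omega
  -- The discarded digits of `y` commute with `ζ` and are absorbed into the vector; those of `x` are
  -- dropped as a contraction on the left.
  set v' := Polynomial.aeval (isomHom y) (dyadicPoly (Finset.range b \ T)) v with hv'
  have hv'1 : ‖v'‖ ≤ 1 := (norm_aeval_dyadicPoly_le _ _ _).trans hv
  have hζv : ∀ w, Polynomial.aeval (isomHom y) (dyadicPoly (Finset.range b \ T)) (ζ w) =
      ζ (Polynomial.aeval (isomHom y) (dyadicPoly (Finset.range b \ T)) w) := by
    intro w
    have : Commute ζ (Polynomial.aeval (isomHom y) (dyadicPoly (Finset.range b \ T))) := by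
      rw [Polynomial.aeval_eq_sum_range]
      exact Commute.sum_right _ _ _ fun i _ => (hζy.pow_right i).smul_right _
    exact (DFunLike.congr_fun this.eq w).symm
  have hle : ‖isoAvg x a (isoAvg y b (ζ v))‖ ≤ ‖digitAvg 2 s m (fun i =>
      (x ^ i) (digitAvg (2 ^ m) t m (fun l => (y ^ l) (ζ v'))))‖ := by
    have hY := digitAvg_pow_apply (isomHom y) m t m (ζ v')
    rw [prod_dyadicPoly_Ico hTd, ← hT] at hY
    have hX := digitAvg_pow_apply (isomHom x) 1 s m
      (digitAvg (2 ^ m) t m (fun l => (isomHom y ^ l) (ζ v')))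
    rw [prod_dyadicPoly_Ico hSd, ← hS, pow_one] at hX
    rw [hY] at hX
    simp only [← map_pow, isomHom_apply] at hX hY
    rw [hY, hX, isoAvg_eq_aeval, isoAvg_eq_aeval, dyadicPoly_eq_mul hSa, dyadicPoly_eq_mul hTb,
      map_mul, mul_comm (dyadicPoly (Finset.range b \ T)), map_mul, mul_apply_eq_comp,
      mul_apply_eq_comp, hζv]
    exact norm_aeval_dyadicPoly_le _ _ _
  have hswap : digitAvg 2 s m (fun i => (x ^ i) (digitAvg (2 ^ m) t m (fun l => (y ^ l) (ζ v')))) =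
      digitAvg (2 ^ m) t m (fun l => (y ^ l) (digitAvg 2 s m (fun i =>
        (u ^ (i * l)) (ζ ((x ^ i) v'))))) := by
    have e1 : ∀ i, (x ^ i) (digitAvg (2 ^ m) t m (fun l => (y ^ l) (ζ v'))) =
        digitAvg (2 ^ m) t m (fun l => (x ^ i) ((y ^ l) (ζ v'))) := fun i =>
      map_digitAvg ((x ^ i).toLinearEquiv : F →ₗ[ℝ] F) _ _ _ _
    have e2 : ∀ l (g : ℕ → F), (y ^ l) (digitAvg 2 s m g) =
        digitAvg 2 s m (fun i => (y ^ l) (g i)) := fun l g =>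
      map_digitAvg ((y ^ l).toLinearEquiv : F →ₗ[ℝ] F) _ _ _ _
    simp only [e1, e2]
    rw [digitAvg_comm]
    congr 1
    ext l
    congr 1
    ext i
    rw [← LinearIsometryEquiv.coe_mul_apply, pow_mul_pow_of_heisenberg hxy hxu hyu,
      LinearIsometryEquiv.coe_mul_apply, LinearIsometryEquiv.coe_mul_apply,
      ← LinearIsometryEquiv.coe_mul_apply (x ^ i), ((hxu.pow_left i).pow_right (i * l)).eq,
      LinearIsometryEquiv.coe_mul_apply]
    have := DFunLike.congr_fun (hζx.pow_right i).eq v'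
    simp only [mul_apply_eq_comp, ← map_pow, isomHom_apply] at this
    rw [this]
  have hΛ : 0 < 2 ^ m := by positivity
  have hF := digitAvg_fourier_le hC hUC hΛ s t hmono k m
    (fun j hj => Nat.add_sub_cancel' (hsk j hj)) u ζ
    (fun j w => by
      have := DFunLike.congr_fun (hζu.pow_right j).eq w
      simp only [mul_apply_eq_comp, ← map_pow, isomHom_apply] at this
      exact this.symm)
    (e := 8 / 2 ^ m) (ε := 2 / ((2 ^ m : ℕ) : ℝ)) h0
    (by
      intro j hj
      rcases Nat.eq_zero_or_pos j with rfl | hj0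
      -- For `j = 0` there is no lower digit, so only `i = 0` has to be considered.
      · refine ⟨0, fun j' hj' => by omega, fun c hc i hi w => ?_⟩
        have : i = 0 := by simpa using hi
        subst this
        simp only [zero_mul, pow_zero, LinearIsometryEquiv.coe_one, id, sub_self, norm_zero]
        positivity
      · refine ⟨s (j - 1) + 1, fun j' hj' => ?_, fun c hc i hi w => ?_⟩
        · have : s j' ≤ s (j - 1) := hmono.monotone (by omega)
          omega
        · refine (h1 _ w).trans (mul_le_mul_of_nonneg_right ?_ (norm_nonneg _))
          -- The exponent is at most `2 ^ (k - m + 1)` because `s j - s (j - 1) = 2 * m`; then `4 *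
          -- 2 ^ (k - m + 1) / 2 ^ k` is `8 / 2 ^ m`, the chosen `e`.
          have h3 : i * (2 ^ t j * c) ≤ 2 ^ (s (j - 1) + 1) * (2 ^ t j * 2 ^ m) := by gcongr
          have h4 := hstep (j - 1) j (by omega)
          have h5 := hsk j hj
          have h6 : s (j - 1) + 1 + (t j + m) ≤ k - m + 1 := by simp only [ht]; omega
          have h7 : i * (2 ^ t j * c) ≤ 2 ^ (k - m + 1) := by
            refine h3.trans ?_
            rw [← pow_add, ← pow_add]
            exact Nat.pow_le_pow_right (by norm_num) h6
          have h8 : ((i * (2 ^ t j * c) : ℕ) : ℝ) ≤ 2 ^ (k - m + 1) := by exact_mod_cast h7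
          rw [div_le_div_iff₀ (by positivity) (by positivity)]
          have h9 : (2 : ℝ) ^ (k - m + 1) * 2 ^ m = 2 * 2 ^ k := by
            rw [← pow_add, ← pow_succ']
            congr 1
            omega
          nlinarith [pow_pos (two_pos : (0:ℝ) < 2) m])
    (fun w => h2 _ w hΛ) (by positivity) (by positivity) (fun i => (x ^ i) v')
    (fun i => by rw [LinearIsometryEquiv.norm_map]; exact hv'1)
  rw [hswap] at hle
  refine (pow_le_pow_left₀ (norm_nonneg _) (hle.trans (norm_digitAvg_le _ _ _ _)) 2).trans ?_
  refine (sq_digitAvg_le hΛ _ _ _).trans ?_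
  simp only [LinearIsometryEquiv.norm_map]
  exact hF

end Heisenberg

/-! ### Spectral bands and the two commutation rules -/

section Rules

variable {F : Type*} [SeminormedAddCommGroup F] [NormedSpace ℝ F]

/-- `isoAvg z k * (1 - z ^ (2 ^ k))`: the part of `z` of spectral scale `2 ^ (-k)`. -/
noncomputable def isoBand (z : F ≃ₗᵢ[ℝ] F) (k : ℕ) : F →L[ℝ] F :=
  isoAvg z k * (1 - isomHom z ^ (2 ^ k))

theorem isoBand_apply (z : F ≃ₗᵢ[ℝ] F) (k : ℕ) (v : F) :
    isoBand z k v = isoAvg z k (v - (z ^ (2 ^ k)) v) := by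
  rw [isoBand, mul_apply_eq_comp, ← map_pow]; rfl

theorem isoAvg_sub_succ_eq (z : F ≃ₗᵢ[ℝ] F) (k : ℕ) :
    isoAvg z k - isoAvg z (k + 1) = (2 : ℝ)⁻¹ • isoBand z k := by
  ext v
  simp only [sub_apply, smul_apply, isoBand_apply, isoAvg_sub_succ]

theorem commute_isoBand {T : F →L[ℝ] F} {z : F ≃ₗᵢ[ℝ] F} (h : Commute T (isomHom z)) (k : ℕ) :
    Commute T (isoBand z k) :=
  (commute_isoAvg h k).mul_right ((Commute.one_right _).sub_right (h.pow_right _))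

theorem isoBand_apply' (z : F ≃ₗᵢ[ℝ] F) (k : ℕ) (v : F) :
    isoBand z k v = isoAvg z k v - (z ^ (2 ^ k)) (isoAvg z k v) := by
  have h : Commute (isomHom z ^ (2 ^ k)) (isoAvg z k) :=
    commute_isoAvg ((Commute.refl (isomHom z)).pow_left _) k
  have := DFunLike.congr_fun h.eq v
  rw [isoBand_apply, map_sub]
  simp only [mul_apply_eq_comp, ← map_pow, isomHom_apply] at this
  rw [this]

theorem pow_isoBand_apply (z : F ≃ₗᵢ[ℝ] F) (k m : ℕ) (v : F) :
    (z ^ m) (isoBand z k v) = isoBand z k ((z ^ m) v) := by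
  have h : Commute (isomHom z ^ m) (isoBand z k) :=
    commute_isoBand ((Commute.refl (isomHom z)).pow_left _) k
  have := DFunLike.congr_fun h.eq v
  simpa only [mul_apply_eq_comp, ← map_pow, isomHom_apply] using this

theorem norm_isoBand_apply_le (z : F ≃ₗᵢ[ℝ] F) (k : ℕ) (v : F) : ‖isoBand z k v‖ ≤ 2 * ‖v‖ := by
  rw [isoBand_apply]
  refine (norm_isoAvg_apply_le _ _ _).trans ((norm_sub_le _ _).trans (le_of_eq ?_))
  rw [LinearIsometryEquiv.norm_map]
  ring

theorem norm_isoBand_pow_sub_le (z : F ≃ₗᵢ[ℝ] F) (k m : ℕ) (v : F) :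
    ‖isoBand z k ((z ^ m) v) - isoBand z k v‖ ≤ 4 * m / 2 ^ k * ‖v‖ := by
  have h := norm_isoAvg_pow_sub_le z k m v
  set w := (z ^ m) (isoAvg z k v) - isoAvg z k v with hw
  have e : isoBand z k ((z ^ m) v) - isoBand z k v = w - (z ^ (2 ^ k)) w := by
    rw [← pow_isoBand_apply, isoBand_apply', hw, map_sub, map_sub,
      ← LinearIsometryEquiv.coe_mul_apply, ← LinearIsometryEquiv.coe_mul_apply, ← pow_add,
      ← pow_add, add_comm m]
    abel
  rw [e]
  refine (norm_sub_le _ _).trans ?_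
  rw [LinearIsometryEquiv.norm_map]
  refine (add_le_add h h).trans (le_of_eq ?_)
  ring

/-- The factor `1 - z ^ (2 ^ k)` of the band makes the sum telescope. This is the oscillation
hypothesis of the Fourier estimate. -/
theorem norm_isoBand_avg_le (z : F ≃ₗᵢ[ℝ] F) (k Λ : ℕ) (v : F) :
    ‖(Λ : ℝ)⁻¹ • ∑ c ∈ Finset.range Λ, (z ^ (2 ^ k * c)) (isoBand z k v)‖ ≤ 2 / Λ * ‖v‖ := by
  have e : ∑ c ∈ Finset.range Λ, (z ^ (2 ^ k * c)) (isoBand z k v) =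
      isoAvg z k v - (z ^ (2 ^ k * Λ)) (isoAvg z k v) := by
    have h := Finset.sum_range_sub' (fun c => (z ^ (2 ^ k * c)) (isoAvg z k v)) Λ
    simp only [mul_zero, pow_zero, LinearIsometryEquiv.coe_one, id] at h
    rw [← h]
    refine Finset.sum_congr rfl fun c _ => ?_
    rw [isoBand_apply', map_sub, ← LinearIsometryEquiv.coe_mul_apply, ← pow_add, mul_add, mul_one]
  rw [e, norm_smul, norm_inv, Real.norm_of_nonneg (by positivity), inv_mul_eq_div,
    div_mul_eq_mul_div]
  gcongr
  refine (norm_sub_le _ _).trans ?_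
  rw [LinearIsometryEquiv.norm_map]
  linarith [norm_isoAvg_apply_le z k v]

theorem inv_pow_apply_pow_apply (z : F ≃ₗᵢ[ℝ] F) (m : ℕ) (v : F) :
    (z ^ m) ((z⁻¹ ^ m) v) = v := by
  rw [← LinearIsometryEquiv.coe_mul_apply, inv_pow, mul_inv_cancel]; rfl

theorem norm_isoBand_inv_pow_sub_le (z : F ≃ₗᵢ[ℝ] F) (k m : ℕ) (v : F) :
    ‖isoBand z k ((z⁻¹ ^ m) v) - isoBand z k v‖ ≤ 4 * m / 2 ^ k * ‖v‖ := by
  have h := norm_isoBand_pow_sub_le z k m ((z⁻¹ ^ m) v)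
  rwa [inv_pow_apply_pow_apply, norm_sub_rev, LinearIsometryEquiv.norm_map] at h

/-- Multiplication by `z ^ (2 ^ k * (Λ - 1))` reverses the order of summation. The inverse occurs
because a root element is a commutator only up to sign. -/
theorem norm_isoBand_inv_avg_le (z : F ≃ₗᵢ[ℝ] F) (k Λ : ℕ) (v : F) :
    ‖(Λ : ℝ)⁻¹ • ∑ c ∈ Finset.range Λ, (z⁻¹ ^ (2 ^ k * c)) (isoBand z k v)‖ ≤ 2 / Λ * ‖v‖ := by
  refine le_trans (le_of_eq ?_) (norm_isoBand_avg_le z k Λ v)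
  rw [← LinearIsometryEquiv.norm_map (z ^ (2 ^ k * (Λ - 1))), map_smul, map_sum,
    ← Finset.sum_range_reflect]
  congr 2
  refine Finset.sum_congr rfl fun c hc => ?_
  rw [Finset.mem_range] at hc
  rw [← LinearIsometryEquiv.coe_mul_apply]
  congr 1
  have h : 2 ^ k * (Λ - 1) = 2 ^ k * c + 2 ^ k * (Λ - 1 - c) := by
    rw [← mul_add]; congr 1; omega
  rw [inv_pow, h, pow_add, mul_inv_cancel_right]

/-- `x`, `y` generate a Heisenberg-type group with central commutator `z` or `z⁻¹`. -/
structure IsHeisenberg {G : Type*} [Group G] (x y z : G) : Prop where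
  commute_left : Commute x z
  commute_right : Commute y z
  commutator : x * y = y * x * z ∨ x * y = y * x * z⁻¹

theorem IsHeisenberg.symm {G : Type*} [Group G] {x y z : G} (h : IsHeisenberg x y z) :
    IsHeisenberg y x z where
  commute_left := h.commute_right
  commute_right := h.commute_left
  commutator := by
    have hz : Commute (x * y) z := h.commute_left.mul_left h.commute_right
    have hz' : Commute (y * x) z := h.commute_right.mul_left h.commute_left
    rcases h.commutator with h | h
    · right; rw [h]; group
    · left; rw [h]; group

theorem IsHeisenberg.map {G H : Type*} [Group G] [Group H] {x y z : G} (h : IsHeisenberg x y z)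
    (φ : G →* H) : IsHeisenberg (φ x) (φ y) (φ z) where
  commute_left := h.commute_left.map φ
  commute_right := h.commute_right.map φ
  commutator := by
    rcases h.commutator with h | h
    · left; rw [← map_mul, h, map_mul, map_mul]
    · right; rw [← map_mul, h, map_mul, map_mul, map_inv]

theorem norm_isoAvg_mul_isoAvg_mul_isoBand_le {C : ℝ} (hC : 0 ≤ C)
    (hUC : ∀ x y : F, ‖x - y‖ ^ 2 ≤ 1 / 18 * (‖x‖ ^ 2 + ‖y‖ ^ 2) +
      C * ((‖x‖ ^ 2 + ‖y‖ ^ 2) / 2 - ‖(2 : ℝ)⁻¹ • (x + y)‖ ^ 2))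
    {x y z : F ≃ₗᵢ[ℝ] F} (h : IsHeisenberg x y z) {m a b k : ℕ} (hm : 0 < m)
    (ha : scaleUnit m ≤ a) (hb : scaleUnit m ≤ b)
    (hk : scaleUnit m ≤ k) (hab : k + scaleUnit m ≤ a + b) :
    ‖isoAvg x a * isoAvg y b * isoBand z k‖ ≤ √(heisenbergBound C m) := by
  refine ContinuousLinearMap.opNorm_le_of_unit_norm (Real.sqrt_nonneg _) fun v hv => ?_
  refine Real.le_sqrt_of_sq_le ?_
  rw [mul_apply_eq_comp, mul_apply_eq_comp]
  have cx := (commute_isoBand (h.commute_left.map isomHom) k).symm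
  have cy := (commute_isoBand (h.commute_right.map isomHom) k).symm
  have cz : Commute (isoBand z k) (isomHom z) := (commute_isoBand (Commute.refl _) k).symm
  rcases h.commutator with hxy | hxy
  · exact norm_isoAvg_isoAvg_sq_le hC hUC hxy h.commute_left h.commute_right (isoBand z k)
      cx cy cz (norm_isoBand_apply_le z k) (norm_isoBand_pow_sub_le z k)
      (fun Λ v _ => norm_isoBand_avg_le z k Λ v) hm ha hb hk hab hv.le
  · have cz' : Commute (isoBand z k) (isomHom z⁻¹) :=
      (commute_isoBand (((Commute.refl z).inv_left).map isomHom) k).symm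
    exact norm_isoAvg_isoAvg_sq_le hC hUC hxy h.commute_left.inv_right h.commute_right.inv_right
      (isoBand z k) cx cy cz' (norm_isoBand_apply_le z k) (norm_isoBand_inv_pow_sub_le z k)
      (fun Λ v _ => norm_isoBand_inv_avg_le z k Λ v) hm ha hb hk hab hv.le

/-- The central scale in a Heisenberg product may be changed from `c` to `c'`. -/
theorem norm_isoAvg_mul_isoAvg_mul_sub_le {C : ℝ} (hC : 0 ≤ C)
    (hUC : ∀ x y : F, ‖x - y‖ ^ 2 ≤ 1 / 18 * (‖x‖ ^ 2 + ‖y‖ ^ 2) +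
      C * ((‖x‖ ^ 2 + ‖y‖ ^ 2) / 2 - ‖(2 : ℝ)⁻¹ • (x + y)‖ ^ 2))
    {x y z : F ≃ₗᵢ[ℝ] F} (h : IsHeisenberg x y z) {m a b c c' : ℕ} (hm : 0 < m)
    (ha : scaleUnit m ≤ a) (hb : scaleUnit m ≤ b) (hc : scaleUnit m ≤ c) (hcc : c ≤ c')
    (hab : c' + scaleUnit m ≤ a + b) :
    ‖isoAvg x a * isoAvg y b * (isoAvg z c - isoAvg z c')‖ ≤
      (c' : ℝ) * √(heisenbergBound C m) := by
  have key : ∀ n, c + n ≤ c' → ‖isoAvg x a * isoAvg y b * (isoAvg z c - isoAvg z (c + n))‖ ≤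
      (n : ℝ) * √(heisenbergBound C m) := by
    intro n
    induction n with
    | zero => simp
    | succ n ih =>
      intro hn
      have e : isoAvg x a * isoAvg y b * (isoAvg z c - isoAvg z (c + (n + 1))) =
          isoAvg x a * isoAvg y b * (isoAvg z c - isoAvg z (c + n)) +
          (2 : ℝ)⁻¹ • (isoAvg x a * isoAvg y b * isoBand z (c + n)) := by
        rw [← mul_smul_comm, ← isoAvg_sub_succ_eq, ← mul_add, ← add_assoc]
        congr 1
        abel
      rw [e]
      refine (norm_add_le _ _).trans ?_
      rw [norm_smul, Real.norm_of_nonneg (by norm_num)]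
      have h1 := ih (by omega)
      have h2 := norm_isoAvg_mul_isoAvg_mul_isoBand_le hC hUC h hm ha hb (k := c + n)
        (by omega) (by omega)
      have h3 := norm_nonneg (isoAvg x a * isoAvg y b * isoBand z (c + n))
      push_cast
      linarith
  obtain ⟨n, rfl⟩ := Nat.exists_eq_add_of_le hcc
  refine (key n le_rfl).trans ?_
  gcongr
  omega

/-- For large central scale the two averages in a Heisenberg product almost commute. -/
theorem norm_isoAvg_commutator_mul_le {x y z : F ≃ₗᵢ[ℝ] F} (h : IsHeisenberg x y z) {a b c d : ℕ}
    (hab : a + b + d ≤ c) :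
    ‖(isoAvg x a * isoAvg y b - isoAvg y b * isoAvg x a) * isoAvg z c‖ ≤ 2 / 2 ^ d := by
  obtain ⟨u, hu, hxy, hxu, hyu⟩ : ∃ u, (u = z ∨ u = z⁻¹) ∧ x * y = y * x * u ∧
      Commute x u ∧ Commute y u := by
    rcases h.commutator with h1 | h1
    · exact ⟨z, .inl rfl, h1, h.commute_left, h.commute_right⟩
    · exact ⟨z⁻¹, .inr rfl, h1, h.commute_left.inv_right, h.commute_right.inv_right⟩
  have hu' : ∀ (m : ℕ) (v : F), ‖(u ^ m) (isoAvg z c v) - isoAvg z c v‖ ≤ 2 * m / 2 ^ c * ‖v‖ := by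
    intro m v
    rcases hu with rfl | rfl
    · exact norm_isoAvg_pow_sub_le u c m v
    · rw [← LinearIsometryEquiv.norm_map (z ^ m), map_sub, inv_pow_apply_pow_apply, norm_sub_rev]
      exact norm_isoAvg_pow_sub_le z c m v
  refine ContinuousLinearMap.opNorm_le_bound _ (by positivity) fun v => ?_
  rw [mul_apply_eq_comp, sub_apply, mul_apply_eq_comp, mul_apply_eq_comp]
  set w := isoAvg z c v with hw
  -- Exchanging `x ^ i` and `y ^ l` costs `u ^ (i * l)` with `i * l < 2 ^ (a + b)`, which hardly
  -- moves a vector averaged over `2 ^ c` powers of `z`.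
  have e : isoAvg x a (isoAvg y b w) - isoAvg y b (isoAvg x a w) =
      ((2 ^ a : ℕ) : ℝ)⁻¹ • ∑ i ∈ Finset.range (2 ^ a), ((2 ^ b : ℕ) : ℝ)⁻¹ •
        ∑ l ∈ Finset.range (2 ^ b), (y ^ l) ((x ^ i) ((u ^ (i * l)) w - w)) := by
    have e2 : isoAvg y b (isoAvg x a w) = ((2 ^ a : ℕ) : ℝ)⁻¹ • ∑ i ∈ Finset.range (2 ^ a),
        ((2 ^ b : ℕ) : ℝ)⁻¹ • ∑ l ∈ Finset.range (2 ^ b), (y ^ l) ((x ^ i) w) := by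
      rw [isoAvg_apply x, map_smul, map_sum]
      simp only [isoAvg_apply]
    rw [e2, isoAvg_apply x, ← smul_sub, ← Finset.sum_sub_distrib]
    congr 1
    refine Finset.sum_congr rfl fun i _ => ?_
    rw [isoAvg_apply, map_smul, map_sum, ← smul_sub, ← Finset.sum_sub_distrib]
    congr 1
    refine Finset.sum_congr rfl fun l _ => ?_
    rw [map_sub, map_sub, ← LinearIsometryEquiv.coe_mul_apply,
      pow_mul_pow_of_heisenberg hxy hxu hyu]
    rfl
  rw [e]
  have avg_le : ∀ (n : ℕ) (g : ℕ → F) (M : ℝ), (∀ i < 2 ^ n, ‖g i‖ ≤ M) →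
      ‖((2 ^ n : ℕ) : ℝ)⁻¹ • ∑ i ∈ Finset.range (2 ^ n), g i‖ ≤ M := by
    intro n g M hg
    rw [norm_smul, norm_inv, Real.norm_of_nonneg (by positivity), inv_mul_le_iff₀ (by positivity)]
    refine (norm_sum_le_of_le _ fun i hi => hg i (Finset.mem_range.1 hi)).trans (le_of_eq ?_)
    rw [Finset.sum_const, Finset.card_range, nsmul_eq_mul]
  refine avg_le _ _ _ fun i hi => avg_le _ _ _ fun l hl => ?_
  rw [LinearIsometryEquiv.norm_map, LinearIsometryEquiv.norm_map]
  refine (hu' _ _).trans (mul_le_mul_of_nonneg_right ?_ (norm_nonneg _))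
  have h1 : i * l ≤ 2 ^ a * 2 ^ b := by gcongr
  have h2 : ((i * l : ℕ) : ℝ) ≤ 2 ^ a * 2 ^ b := by exact_mod_cast h1
  have h3 : (2 : ℝ) ^ a * 2 ^ b * 2 ^ d ≤ 2 ^ c := by
    rw [← pow_add, ← pow_add]
    exact pow_le_pow_right₀ (by norm_num) hab
  rw [div_le_div_iff₀ (by positivity) (by positivity)]
  nlinarith [pow_pos (two_pos : (0:ℝ) < 2) d]

end Rules

/-! ### Changing the scales around the hexagon -/

section Hexagon

variable {R : Type*} [SeminormedRing R]

/-- Six families of contractions, indexed cyclically by the roots of an `A₂` root system, which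
satisfy at scale `U` the commutation rules of averages over root subgroups up to an error `δ`. -/
structure HexagonRules (A : Fin 6 → ℕ → R) (U : ℕ) (δ : ℝ) : Prop where
  norm_le : ∀ i a, ‖A i a‖ ≤ 1
  comm : ∀ i a b, Commute (A i a) (A (i + 1) b)
  change : ∀ i a b c c', U ≤ a → U ≤ b → U ≤ c → U ≤ c' → c + U ≤ a + b → c' + U ≤ a + b →
    c ≤ 11 * U → c' ≤ 11 * U → ‖A i a * A (i + 2) b * (A (i + 1) c - A (i + 1) c')‖ ≤ δ
  change' : ∀ i a b c c', U ≤ a → U ≤ b → U ≤ c → U ≤ c' → c + U ≤ a + b → c' + U ≤ a + b →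
    c ≤ 11 * U → c' ≤ 11 * U → ‖A (i + 2) b * A i a * (A (i + 1) c - A (i + 1) c')‖ ≤ δ
  swap : ∀ i a b c, a + b + U ≤ c →
    ‖(A i a * A (i + 2) b - A (i + 2) b * A i a) * A (i + 1) c‖ ≤ δ

namespace HexagonRules

variable {A : Fin 6 → ℕ → R} {U : ℕ} {δ : ℝ}

theorem comm' (H : HexagonRules A U δ) (i : Fin 6) (b c : ℕ) :
    Commute (A (i + 1) c) (A (i + 2) b) := by
  have h := H.comm (i + 1) c b
  rwa [add_assoc] at h

/-- Neighbouring roots commute, so the middle factor can be moved to the end, where `change`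
applies. -/
theorem change_mid (H : HexagonRules A U δ) (i : Fin 6) {a b c c' : ℕ} (ha : U ≤ a) (hb : U ≤ b)
    (hc : U ≤ c) (hc' : U ≤ c') (h : c + U ≤ a + b) (h' : c' + U ≤ a + b) (hu : c ≤ 11 * U)
    (hu' : c' ≤ 11 * U) :
    ‖A i a * A (i + 1) c * A (i + 2) b - A i a * A (i + 1) c' * A (i + 2) b‖ ≤ δ := by
  refine le_of_eq_of_le ?_ (H.change i a b c c' ha hb hc hc' h h' hu hu')
  rw [mul_sub, mul_assoc, mul_assoc, (H.comm' i b c).eq, (H.comm' i b c').eq, mul_assoc, mul_assoc]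

theorem change_mid' (H : HexagonRules A U δ) (i : Fin 6) {a b c c' : ℕ} (ha : U ≤ a) (hb : U ≤ b)
    (hc : U ≤ c) (hc' : U ≤ c') (h : c + U ≤ a + b) (h' : c' + U ≤ a + b) (hu : c ≤ 11 * U)
    (hu' : c' ≤ 11 * U) :
    ‖A (i + 2) b * A (i + 1) c * A i a - A (i + 2) b * A (i + 1) c' * A i a‖ ≤ δ := by
  refine le_of_eq_of_le ?_ (H.change' i a b c c' ha hb hc hc' h h' hu hu')
  rw [mul_sub, mul_assoc, mul_assoc, ← (H.comm i a c).eq, ← (H.comm i a c').eq, mul_assoc,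
    mul_assoc]

theorem swap_mid (H : HexagonRules A U δ) (i : Fin 6) {a b c : ℕ} (h : a + b + U ≤ c) :
    ‖A i a * A (i + 1) c * A (i + 2) b - A (i + 2) b * A (i + 1) c * A i a‖ ≤ δ := by
  refine le_of_eq_of_le ?_ (H.swap i a b c h)
  rw [sub_mul, mul_assoc, (H.comm' i b c).eq, mul_assoc (A (i + 2) b), ← (H.comm i a c).eq,
    mul_assoc, mul_assoc]

theorem norm_mul_le_one {x y : R} (hx : ‖x‖ ≤ 1) (hy : ‖y‖ ≤ 1) : ‖x * y‖ ≤ 1 :=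
  (norm_mul_le _ _).trans (mul_le_one₀ hx (norm_nonneg _) hy)

theorem norm_mul_sub_le {x y z u : R} (hx : ‖x‖ ≤ 1) (hy : ‖y‖ ≤ 1) (h : ‖z - u‖ ≤ δ) :
    ‖x * z * y - x * u * y‖ ≤ δ := by
  rw [← sub_mul, ← mul_sub]
  calc ‖x * (z - u) * y‖ ≤ ‖x‖ * ‖z - u‖ * ‖y‖ :=
        (norm_mul_le _ _).trans (by gcongr; exact norm_mul_le _ _)
    _ ≤ 1 * ‖z - u‖ * 1 := by gcongr
    _ ≤ δ := by simpa using h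

/-- The product of six averages in cyclic order. -/
def word (A : Fin 6 → ℕ → R) (a b c d e f : ℕ) : R :=
  (A 0 a * A 1 b * A 2 c) * (A 3 d * A 4 e * A 5 f)

/-- The product of six averages with both triples reversed. -/
def word' (A : Fin 6 → ℕ → R) (a b c d e f : ℕ) : R :=
  (A 2 c * A 1 b * A 0 a) * (A 5 f * A 4 e * A 3 d)

theorem norm_three_le (H : HexagonRules A U δ) (i j k : Fin 6) (a b c : ℕ) :
    ‖A i a * A j b * A k c‖ ≤ 1 :=
  norm_mul_le_one (norm_mul_le_one (H.norm_le _ _) (H.norm_le _ _)) (H.norm_le _ _)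

theorem sub_left {x y z : R} (hx : ‖x‖ ≤ 1) (h : ‖y - z‖ ≤ δ) : ‖x * y - x * z‖ ≤ δ := by
  rw [← mul_sub]
  exact (norm_mul_le _ _).trans ((mul_le_of_le_one_left (norm_nonneg _) hx).trans h)

theorem sub_right {x y z : R} (hx : ‖x‖ ≤ 1) (h : ‖y - z‖ ≤ δ) : ‖y * x - z * x‖ ≤ δ := by
  rw [← sub_mul]
  exact (norm_mul_le _ _).trans ((mul_le_of_le_one_right (norm_nonneg _) hx).trans h)

section Steps

variable {a b c d e f x : ℕ}

theorem word_one (H : HexagonRules A U δ) (ha : U ≤ a) (hc : U ≤ c) (hb : U ≤ b) (hx : U ≤ x) (h : b + U ≤ a + c)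
    (h' : x + U ≤ a + c) (hu : b ≤ 11 * U) (hu' : x ≤ 11 * U) :
    ‖word A a b c d e f - word A a x c d e f‖ ≤ δ :=
  sub_right (H.norm_three_le _ _ _ _ _ _) (H.change_mid 0 ha hc hb hx h h' hu hu')

theorem word_four (H : HexagonRules A U δ) (hd : U ≤ d) (hf : U ≤ f) (he : U ≤ e) (hx : U ≤ x) (h : e + U ≤ d + f)
    (h' : x + U ≤ d + f) (hu : e ≤ 11 * U) (hu' : x ≤ 11 * U) :
    ‖word A a b c d e f - word A a b c d x f‖ ≤ δ :=
  sub_left (H.norm_three_le _ _ _ _ _ _) (H.change_mid 3 hd hf he hx h h' hu hu')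

theorem word_two (H : HexagonRules A U δ) (hb : U ≤ b) (hd : U ≤ d) (hc : U ≤ c) (hx : U ≤ x) (h : c + U ≤ b + d)
    (h' : x + U ≤ b + d) (hu : c ≤ 11 * U) (hu' : x ≤ 11 * U) :
    ‖word A a b c d e f - word A a b x d e f‖ ≤ δ := by
  have key := norm_mul_sub_le (H.norm_le 0 a)
    (norm_mul_le_one (H.norm_le 4 e) (H.norm_le 5 f))
    (H.change_mid 1 hb hd hc hx h h' hu hu')
  simp only [word, mul_assoc] at key ⊢
  exact key

theorem word_three (H : HexagonRules A U δ) (hc : U ≤ c) (he : U ≤ e) (hd : U ≤ d) (hx : U ≤ x) (h : d + U ≤ c + e)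
    (h' : x + U ≤ c + e) (hu : d ≤ 11 * U) (hu' : x ≤ 11 * U) :
    ‖word A a b c d e f - word A a b c x e f‖ ≤ δ := by
  have key := norm_mul_sub_le (norm_mul_le_one (H.norm_le 0 a) (H.norm_le 1 b)) (H.norm_le 5 f)
    (H.change_mid 2 hc he hd hx h h' hu hu')
  simp only [word, mul_assoc] at key ⊢
  exact key

/-- Reversing both triples puts the factors `0` and `5` side by side in the middle of the word. The
scales `a` and `f`, at the ends of `word`, can now be changed like inner ones. -/
theorem word'_zero (H : HexagonRules A U δ) (hb : U ≤ b) (hf : U ≤ f) (ha : U ≤ a) (hx : U ≤ x) (h : a + U ≤ f + b)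
    (h' : x + U ≤ f + b) (hu : a ≤ 11 * U) (hu' : x ≤ 11 * U) :
    ‖word' A a b c d e f - word' A x b c d e f‖ ≤ δ := by
  have key := norm_mul_sub_le (H.norm_le 2 c)
    (norm_mul_le_one (H.norm_le 4 e) (H.norm_le 3 d))
    (H.change_mid' 5 hf hb ha hx h h' hu hu')
  simp only [word', mul_assoc] at key ⊢
  exact key

theorem word'_five (H : HexagonRules A U δ) (ha : U ≤ a) (he : U ≤ e) (hf : U ≤ f) (hx : U ≤ x) (h : f + U ≤ e + a)
    (h' : x + U ≤ e + a) (hu : f ≤ 11 * U) (hu' : x ≤ 11 * U) :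
    ‖word' A a b c d e f - word' A a b c d e x‖ ≤ δ := by
  have key := norm_mul_sub_le (norm_mul_le_one (H.norm_le 2 c) (H.norm_le 1 b)) (H.norm_le 3 d)
    (H.change_mid' 4 he ha hf hx h h' hu hu')
  simp only [word', mul_assoc] at key ⊢
  exact key

theorem word_sub_word' (H : HexagonRules A U δ) (h : a + c + U ≤ b) (h' : d + f + U ≤ e) :
    ‖word A a b c d e f - word' A a b c d e f‖ ≤ 2 * δ := by
  have h1 := sub_right (H.norm_three_le 3 4 5 d e f) (H.swap_mid 0 h)
  have h2 := sub_left (H.norm_three_le 2 1 0 c b a) (H.swap_mid 3 h')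
  have := norm_sub_le_norm_sub_add_norm_sub (word A a b c d e f)
    ((A 2 c * A 1 b * A 0 a) * (A 3 d * A 4 e * A 5 f)) (word' A a b c d e f)
  refine this.trans ?_
  rw [two_mul]
  exact add_le_add h1 h2

end Steps

/-- The balanced words at comparable scales are close to each other. -/
theorem norm_word_sub_word_le (H : HexagonRules A U δ) {V : ℕ} (hUV : U ≤ V) (hVU : 4 * V ≤ 5 * U) :
    ‖word A (4 * U) (6 * U) (4 * U) (4 * U) (6 * U) (4 * U) -
      word A (4 * V) (6 * V) (4 * V) (4 * V) (6 * V) (4 * V)‖ ≤ 18 * δ := by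
  have tri : ∀ {x y z : R} {p q : ℝ}, ‖x - y‖ ≤ p → ‖y - z‖ ≤ q → ‖x - z‖ ≤ p + q :=
    fun h h' => (norm_sub_le_norm_sub_add_norm_sub _ _ _).trans (add_le_add h h')
  -- The inner scales are first lifted to `8 * U`, so that the two middle ones can reach `11 * U`,
  -- and then set to `4 * V`. Since `4 * V ≤ 5 * U`, the value `11 * U` suffices for swapping at
  -- both outer scales.
  have raise : ‖word A (4 * U) (6 * U) (4 * U) (4 * U) (6 * U) (4 * U) -
      word A (4 * U) (11 * U) (4 * V) (4 * V) (11 * U) (4 * U)‖ ≤ δ + δ + δ + δ + δ + δ := by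
    refine tri (tri (tri (tri (tri (H.word_two (x := 8 * U) ?_ ?_ ?_ ?_ ?_ ?_ ?_ ?_)
      (H.word_one (x := 11 * U) ?_ ?_ ?_ ?_ ?_ ?_ ?_ ?_))
      (H.word_two (x := 4 * V) ?_ ?_ ?_ ?_ ?_ ?_ ?_ ?_))
      (H.word_three (x := 8 * U) ?_ ?_ ?_ ?_ ?_ ?_ ?_ ?_))
      (H.word_four (x := 11 * U) ?_ ?_ ?_ ?_ ?_ ?_ ?_ ?_))
      (H.word_three (x := 4 * V) ?_ ?_ ?_ ?_ ?_ ?_ ?_ ?_) <;> omega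
  have outer : ‖word' A (4 * U) (11 * U) (4 * V) (4 * V) (11 * U) (4 * U) -
      word' A (4 * V) (11 * U) (4 * V) (4 * V) (11 * U) (4 * V)‖ ≤ δ + δ := by
    refine tri (H.word'_zero (x := 4 * V) ?_ ?_ ?_ ?_ ?_ ?_ ?_ ?_)
      (H.word'_five (x := 4 * V) ?_ ?_ ?_ ?_ ?_ ?_ ?_ ?_) <;> omega
  have lower : ‖word A (4 * V) (11 * U) (4 * V) (4 * V) (11 * U) (4 * V) -
      word A (4 * V) (6 * V) (4 * V) (4 * V) (6 * V) (4 * V)‖ ≤ δ + δ + δ + δ + δ + δ := by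
    refine tri (tri (tri (tri (tri (H.word_two (x := 8 * V) ?_ ?_ ?_ ?_ ?_ ?_ ?_ ?_)
      (H.word_one (x := 6 * V) ?_ ?_ ?_ ?_ ?_ ?_ ?_ ?_))
      (H.word_two (x := 4 * V) ?_ ?_ ?_ ?_ ?_ ?_ ?_ ?_))
      (H.word_three (x := 8 * V) ?_ ?_ ?_ ?_ ?_ ?_ ?_ ?_))
      (H.word_four (x := 6 * V) ?_ ?_ ?_ ?_ ?_ ?_ ?_ ?_))
      (H.word_three (x := 4 * V) ?_ ?_ ?_ ?_ ?_ ?_ ?_ ?_) <;> omega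
  have s1 := H.word_sub_word' (a := 4 * U) (b := 11 * U) (c := 4 * V) (d := 4 * V) (e := 11 * U)
    (f := 4 * U) (by omega) (by omega)
  have s2 := H.word_sub_word' (a := 4 * V) (b := 11 * U) (c := 4 * V) (d := 4 * V) (e := 11 * U)
    (f := 4 * V) (by omega) (by omega)
  rw [norm_sub_rev] at s2
  -- The count is `6 + 2 + 2 + 2 + 6 = 18`.
  refine (tri (tri (tri (tri raise s1) outer) s2) lower).trans (le_of_eq ?_)
  ring

end HexagonRules

end Hexagon

/-! ### Relative property (T) for a hexagon of isometries -/

/-- Elements indexed by the roots of `A₂` in cyclic order: neighbours commute, and elements at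
distance two generate a Heisenberg group whose centre is generated by the root in between. -/
structure IsHexagon {G : Type*} [Group G] (g : Fin 6 → G) : Prop where
  commute : ∀ i, Commute (g i) (g (i + 1))
  heisenberg : ∀ i, IsHeisenberg (g i) (g (i + 2)) (g (i + 1))

theorem IsHexagon.rotate {G : Type*} [Group G] {g : Fin 6 → G} (h : IsHexagon g) (r : Fin 6) :
    IsHexagon (fun i => g (i + r)) where
  commute i := by
    have := h.commute (i + r)
    rwa [add_right_comm] at this
  heisenberg i := by
    have := h.heisenberg (i + r)
    rwa [add_right_comm, add_right_comm i r 1] at this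

theorem IsHexagon.map {G H : Type*} [Group G] [Group H] {g : Fin 6 → G} (h : IsHexagon g)
    (φ : G →* H) : IsHexagon (fun i => φ (g i)) where
  commute i := (h.commute i).map φ
  heisenberg i := (h.heisenberg i).map φ

/-- The error in the hexagon rules at scale `scaleUnit m`. -/
noncomputable def hexagonError (C : ℝ) (m : ℕ) : ℝ :=
  11 * scaleUnit m * √(heisenbergBound C m) + 2 / 2 ^ scaleUnit m

theorem le_scaleUnit (m : ℕ) : m ≤ scaleUnit m := by
  have := Nat.le_mul_self m
  unfold scaleUnit
  omega

theorem two_div_two_pow_scaleUnit_le (m : ℕ) :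
    (2 : ℝ) / 2 ^ scaleUnit m ≤ 2 * (2⁻¹ : ℝ) ^ m := by
  rw [inv_pow, ← div_eq_mul_inv]
  exact div_le_div_of_nonneg_left (by norm_num) (by positivity)
    (pow_le_pow_right₀ (by norm_num) (le_scaleUnit m))

theorem heisenbergBound_le {C : ℝ} (hC : 0 ≤ C) (m : ℕ) :
    heisenbergBound C m ≤
      (4 + 112 / (1 - butterflyRate C)) * max (butterflyRate C) 2⁻¹ ^ m := by
  have hr0 := butterflyRate_pos hC
  have hr1 : 0 < 1 - butterflyRate C := by linarith [butterflyRate_lt_one hC]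
  unfold heisenbergBound
  generalize butterflyRate C = r at *
  have h1 : r ^ m ≤ max r 2⁻¹ ^ m := pow_le_pow_left₀ hr0.le (le_max_left _ _) m
  have h2 : ((2 : ℝ) ^ m)⁻¹ ≤ max r 2⁻¹ ^ m := by
    rw [← inv_pow]
    exact pow_le_pow_left₀ (by norm_num) (le_max_right _ _) m
  have hq0 : 0 < ((2 : ℝ) ^ m)⁻¹ := by positivity
  have hq1 : ((2 : ℝ) ^ m)⁻¹ ≤ 1 := inv_le_one_of_one_le₀ (one_le_pow₀ (by norm_num))
  push_cast
  rw [div_eq_mul_inv 2, div_eq_mul_inv 8]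
  generalize ((2 : ℝ) ^ m)⁻¹ = q at *
  generalize max r 2⁻¹ ^ m = p at *
  -- Since `q ^ 2 ≤ q`, the coefficient is `16 + 32 + 64`.
  have h3 : 4 * (2 * q) ^ 2 + 4 * (8 * q) + (8 * q) ^ 2 ≤ 112 * p := by nlinarith
  have h4 := div_le_div_of_nonneg_right h3 hr1.le
  have h5 : (4 + 112 / (1 - r)) * p = 4 * p + 112 * p / (1 - r) := by ring
  rw [h5]
  linarith

theorem hexagonError_nonneg (C : ℝ) (m : ℕ) : 0 ≤ hexagonError C m :=
  add_nonneg (mul_nonneg (by positivity) (Real.sqrt_nonneg _)) (by positivity)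

/-- The scales grow quadratically in `m` while the Heisenberg bound decays geometrically, even after
the square root. -/
theorem summable_hexagonError {C : ℝ} (hC : 0 ≤ C) : Summable (hexagonError C) := by
  have hr1 : 0 < 1 - butterflyRate C := by linarith [butterflyRate_lt_one hC]
  obtain ⟨ρ, hρ⟩ : ∃ ρ, ρ = max (butterflyRate C) 2⁻¹ := ⟨_, rfl⟩
  obtain ⟨K, hK⟩ : ∃ K, K = 4 + 112 / (1 - butterflyRate C) := ⟨_, rfl⟩
  have hρ1 : ρ < 1 := hρ ▸ max_lt (butterflyRate_lt_one hC) (by norm_num)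
  have hρ0 : 0 ≤ ρ := hρ ▸ (by norm_num : (0 : ℝ) ≤ 2⁻¹).trans (le_max_right _ _)
  have hK0 : 0 ≤ K := by rw [hK]; positivity
  have hs : √ρ < 1 := by rw [Real.sqrt_lt' one_pos]; simpa using hρ1
  have h1 : Summable fun m : ℕ => 44 * √K * ((m : ℝ) ^ 2 * √ρ ^ m) :=
    Summable.mul_left (44 * √K) (summable_pow_mul_geometric_of_norm_lt_one (r := √ρ) 2
      (by rwa [Real.norm_of_nonneg (Real.sqrt_nonneg _)]))
  have h2 : Summable fun m : ℕ => 2 * (2⁻¹ : ℝ) ^ m :=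
    (summable_geometric_of_lt_one (by norm_num) (by norm_num)).mul_left _
  refine Summable.of_nonneg_of_le (hexagonError_nonneg C) (fun m => ?_) (h1.add h2)
  refine add_le_add ?_ (two_div_two_pow_scaleUnit_le m)
  have h3 : √(heisenbergBound C m) ≤ √K * √ρ ^ m := by
    have h := Real.sqrt_le_sqrt (heisenbergBound_le hC m)
    have hsq : ρ ^ m = (√ρ ^ m) ^ 2 := by rw [← pow_mul, mul_comm, pow_mul, Real.sq_sqrt hρ0]
    rwa [← hK, ← hρ, Real.sqrt_mul hK0, hsq, Real.sqrt_sq (by positivity)] at h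
  have h4 : ((scaleUnit m : ℕ) : ℝ) = 4 * (m : ℝ) ^ 2 := by
    unfold scaleUnit; push_cast; ring
  rw [h4]
  calc 11 * (4 * (m : ℝ) ^ 2) * √(heisenbergBound C m)
      ≤ 11 * (4 * (m : ℝ) ^ 2) * (√K * √ρ ^ m) := by gcongr
    _ = _ := by ring

section Rep

variable {F : Type*} [SeminormedAddCommGroup F] [NormedSpace ℝ F]

theorem IsHexagon.rules {C : ℝ} (hC : 0 ≤ C)
    (hUC : ∀ x y : F, ‖x - y‖ ^ 2 ≤ 1 / 18 * (‖x‖ ^ 2 + ‖y‖ ^ 2) +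
      C * ((‖x‖ ^ 2 + ‖y‖ ^ 2) / 2 - ‖(2 : ℝ)⁻¹ • (x + y)‖ ^ 2))
    {g : Fin 6 → F ≃ₗᵢ[ℝ] F} (hg : IsHexagon g) {m : ℕ} (hm : 0 < m) :
    HexagonRules (fun i a => isoAvg (g i) a) (scaleUnit m) (hexagonError C m) := by
  have hsq := Real.sqrt_nonneg (heisenbergBound C m)
  have hpw : (0 : ℝ) < 2 / 2 ^ scaleUnit m := by positivity
  have change : ∀ {x y z : F ≃ₗᵢ[ℝ] F}, IsHeisenberg x y z → ∀ a b c c' : ℕ, scaleUnit m ≤ a →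
      scaleUnit m ≤ b → scaleUnit m ≤ c → scaleUnit m ≤ c' → c + scaleUnit m ≤ a + b →
      c' + scaleUnit m ≤ a + b → c ≤ 11 * scaleUnit m → c' ≤ 11 * scaleUnit m →
      ‖isoAvg x a * isoAvg y b * (isoAvg z c - isoAvg z c')‖ ≤ hexagonError C m := by
    have aux : ∀ {x y z : F ≃ₗᵢ[ℝ] F}, IsHeisenberg x y z → ∀ a b c c' : ℕ, scaleUnit m ≤ a →
        scaleUnit m ≤ b → scaleUnit m ≤ c → c ≤ c' →
        c' + scaleUnit m ≤ a + b → c' ≤ 11 * scaleUnit m →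
        ‖isoAvg x a * isoAvg y b * (isoAvg z c - isoAvg z c')‖ ≤ hexagonError C m := by
      intro x y z h a b c c' ha hb hc hcc h1 h2
      refine (norm_isoAvg_mul_isoAvg_mul_sub_le hC hUC h hm ha hb hc hcc h1).trans ?_
      unfold hexagonError
      have h3 : (c' : ℝ) ≤ 11 * scaleUnit m := by exact_mod_cast h2
      nlinarith
    intro x y z h a b c c' ha hb hc hc' h1 h2 h3 h4
    rcases le_total c c' with hcc | hcc
    · exact aux h a b c c' ha hb hc hcc h2 h4
    · rw [← norm_neg, ← mul_neg, neg_sub]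
      exact aux h a b c' c ha hb hc' hcc h1 h3
  refine ⟨fun i a => norm_isoAvg_le _ _, fun i a b => ?_, fun i a b c c' => ?_,
    fun i a b c c' ha hb hc hc' h1 h2 h3 h4 => ?_, fun i a b c h => ?_⟩
  · exact (commute_isoAvg (commute_isoAvg ((hg.commute i).map isomHom).symm a).symm b)
  · exact change (hg.heisenberg i) a b c c'
  · exact change (hg.heisenberg i).symm b a c c' hb ha hc hc' (by omega) (by omega) h3 h4
  · refine (norm_isoAvg_commutator_mul_le (hg.heisenberg i) h).trans ?_
    unfold hexagonError
    have : 0 ≤ 11 * (scaleUnit m : ℝ) * √(heisenbergBound C m) := by positivity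
    linarith

/-- The balanced word at scale `scaleUnit m`. -/
noncomputable def balancedWord (g : Fin 6 → F ≃ₗᵢ[ℝ] F) (m : ℕ) : F →L[ℝ] F :=
  HexagonRules.word (fun i a => isoAvg (g i) a) (4 * scaleUnit m) (6 * scaleUnit m)
    (4 * scaleUnit m) (4 * scaleUnit m) (6 * scaleUnit m) (4 * scaleUnit m)

/-- Consecutive scale units have ratio tending to `1`, so the hexagon rules link each balanced word
to the next, with summable errors. Only the Cauchy property is needed; no limit operator is formed.
-/
theorem IsHexagon.exists_norm_balancedWord_sub_le {C : ℝ} (hC : 0 ≤ C)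
    (hUC : ∀ x y : F, ‖x - y‖ ^ 2 ≤ 1 / 18 * (‖x‖ ^ 2 + ‖y‖ ^ 2) +
      C * ((‖x‖ ^ 2 + ‖y‖ ^ 2) / 2 - ‖(2 : ℝ)⁻¹ • (x + y)‖ ^ 2))
    {g : Fin 6 → F ≃ₗᵢ[ℝ] F} (hg : IsHexagon g) {δ : ℝ} (hδ : 0 < δ) :
    ∃ M, ∀ m ≥ M, ‖balancedWord g M - balancedWord g m‖ ≤ δ := by
  have hsum := (summable_hexagonError hC).mul_left 18
  -- The condition `4 * (m + 1) ^ 2 ≤ 5 * m ^ 2` holds from `m = 9` on.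
  have hstep : ∀ m ≥ 9, ‖balancedWord g m - balancedWord g (m + 1)‖ ≤ 18 * hexagonError C m := by
    intro m hm
    refine (hg.rules hC hUC (m := m) (by omega)).norm_word_sub_word_le ?_ ?_ <;> unfold scaleUnit <;> nlinarith
  have hc : CauchySeq fun m => ∑ i ∈ Finset.range m, 18 * hexagonError C i :=
    hsum.hasSum.tendsto_sum_nat.cauchySeq
  obtain ⟨N, hN⟩ := Metric.cauchySeq_iff'.1 hc δ hδ
  have hnn : ∀ m, 0 ≤ 18 * hexagonError C m := fun m =>
    mul_nonneg (by norm_num) (hexagonError_nonneg C m)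
  refine ⟨N + 9, fun m hm => ?_⟩
  have key : ∀ n, ‖balancedWord g (N + 9) - balancedWord g (N + 9 + n)‖ ≤
      ∑ i ∈ Finset.Ico (N + 9) (N + 9 + n), 18 * hexagonError C i := by
    intro n
    induction n with
    | zero => simp
    | succ n ih =>
      rw [← add_assoc, Finset.sum_Ico_succ_top (by omega)]
      have h1 := hstep (N + 9 + n) (by omega)
      have h2 := norm_sub_le_norm_sub_add_norm_sub (balancedWord g (N + 9))
        (balancedWord g (N + 9 + n)) (balancedWord g (N + 9 + n + 1))
      linarith
  obtain ⟨n, rfl⟩ := Nat.exists_eq_add_of_le hm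
  refine (key n).trans ?_
  have h1 := hN (N + 9 + n) (by omega)
  rw [Real.dist_eq, ← Finset.sum_Ico_eq_sub _ (by omega : N ≤ N + 9 + n)] at h1
  refine le_trans ?_ ((le_abs_self _).trans h1.le)
  exact Finset.sum_le_sum_of_subset_of_nonneg
    (Finset.Ico_subset_Ico_left (by omega)) fun i _ _ => hnn i

theorem norm_isoAvg_sub_le {x : F ≃ₗᵢ[ℝ] F} {s : ℕ} {v : F} {e : ℝ}
    (h : ∀ i < 2 ^ s, ‖(x ^ i) v - v‖ ≤ e) : ‖isoAvg x s v - v‖ ≤ e := by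
  have e1 : isoAvg x s v - v =
      ((2 ^ s : ℕ) : ℝ)⁻¹ • ∑ i ∈ Finset.range (2 ^ s), ((x ^ i) v - v) := by
    rw [Finset.sum_sub_distrib, smul_sub, ← isoAvg_apply, Finset.sum_const, Finset.card_range,
      ← Nat.cast_smul_eq_nsmul ℝ, smul_smul, inv_mul_cancel₀ (by positivity), one_smul]
  rw [e1, norm_smul, norm_inv, Real.norm_of_nonneg (by positivity), inv_mul_le_iff₀ (by positivity)]
  refine (norm_sum_le_of_le _ fun i hi => h i (Finset.mem_range.1 hi)).trans (le_of_eq ?_)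
  rw [Finset.sum_const, Finset.card_range, nsmul_eq_mul]

/-- Relative property (T) for the root subgroups: vectors that are almost invariant under a suitable
finite set are uniformly almost invariant under the cyclic group generated by `g 0`. -/
theorem IsHexagon.exists_finite_norm_zpow_sub_le {C : ℝ} (hC : 0 ≤ C)
    (hUC : ∀ x y : F, ‖x - y‖ ^ 2 ≤ 1 / 18 * (‖x‖ ^ 2 + ‖y‖ ^ 2) +
      C * ((‖x‖ ^ 2 + ‖y‖ ^ 2) / 2 - ‖(2 : ℝ)⁻¹ • (x + y)‖ ^ 2))
    {G : Type*} [Group G] (ρ : G →* (F ≃ₗᵢ[ℝ] F)) {g : Fin 6 → G} (hg : IsHexagon g)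
    {δ : ℝ} (hδ : 0 < δ) :
    ∃ K : Set G, K.Finite ∧ ∃ ε : ℝ, 0 < ε ∧ ∀ ξ : F,
      (∀ h ∈ K, ‖ρ h ξ - ξ‖ ≤ ε * ‖ξ‖) → ∀ n : ℤ, ‖ρ (g 0 ^ n) ξ - ξ‖ ≤ δ * ‖ξ‖ := by
  obtain ⟨M, hM⟩ := (hg.map ρ).exists_norm_balancedWord_sub_le hC hUC (δ := δ / 4) (by positivity)
  set w := fun i => ρ (g i) with hw
  -- `K` contains all powers occurring in the word at scale `M`; its six averages, each with error
  -- `δ / 24`, add up to `δ / 4`.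
  refine ⟨⋃ i : Fin 6, (fun j : ℕ => g i ^ j) '' (Finset.range (2 ^ (6 * scaleUnit M)) : Set ℕ),
    Set.finite_iUnion fun i => (Finset.finite_toSet _).image _, δ / 24, by positivity,
    fun ξ hξ => ?_⟩
  have havg : ∀ i s, s ≤ 6 * scaleUnit M → ‖isoAvg (w i) s ξ - ξ‖ ≤ δ / 24 * ‖ξ‖ := by
    intro i s hs
    refine norm_isoAvg_sub_le fun j hj => ?_
    have h1 := hξ (g i ^ j) (Set.mem_iUnion.2 ⟨i, j, by
      have : 2 ^ s ≤ 2 ^ (6 * scaleUnit M) := Nat.pow_le_pow_right (by norm_num) hs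
      simp only [Finset.coe_range, Set.mem_Iio]
      omega, rfl⟩)
    rwa [map_pow] at h1
  have hcomp : ∀ (T T' : F →L[ℝ] F) (a b : ℝ), ‖T‖ ≤ 1 → ‖T ξ - ξ‖ ≤ a → ‖T' ξ - ξ‖ ≤ b →
      ‖(T * T') ξ - ξ‖ ≤ a + b := by
    intro T T' a b hT h1 h2
    have e : (T * T') ξ - ξ = (T ξ - ξ) + T (T' ξ - ξ) := by
      rw [mul_apply_eq_comp, map_sub]; abel
    rw [e]
    refine (norm_add_le _ _).trans (add_le_add h1 ?_)
    exact (T.le_of_opNorm_le hT _).trans (by rwa [one_mul])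
  have hWM : ‖balancedWord w M ξ - ξ‖ ≤ δ / 4 * ‖ξ‖ := by
    have n1 := fun i s => norm_isoAvg_le (w i) s
    have c1 := fun i j s s' hs hs' => hcomp _ _ _ _ (n1 i s) (havg i s hs) (havg j s' hs')
    have c2 := fun i j k s s' s'' hs hs' hs'' => hcomp _ _ _ _
      (HexagonRules.norm_mul_le_one (n1 i s) (n1 j s')) (c1 i j s s' hs hs') (havg k s'' hs'')
    have c3 := hcomp _ _ _ _ (HexagonRules.norm_mul_le_one (HexagonRules.norm_mul_le_one
      (n1 0 (4 * scaleUnit M)) (n1 1 (6 * scaleUnit M))) (n1 2 (4 * scaleUnit M)))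
      (c2 0 1 2 (4 * scaleUnit M) (6 * scaleUnit M) (4 * scaleUnit M) (by omega) (by omega)
        (by omega))
      (c2 3 4 5 (4 * scaleUnit M) (6 * scaleUnit M) (4 * scaleUnit M) (by omega) (by omega)
        (by omega))
    refine le_trans c3 (le_of_eq ?_)
    ring
  have hWm : ∀ m ≥ M, ‖balancedWord w m ξ - ξ‖ ≤ δ / 2 * ‖ξ‖ := by
    intro m hm
    have h1 := (balancedWord w M - balancedWord w m).le_of_opNorm_le (hM m hm) ξ
    rw [sub_apply, norm_sub_rev] at h1
    refine (norm_sub_le_norm_sub_add_norm_sub _ (balancedWord w M ξ) _).trans ?_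
    linarith
  have hnat : ∀ n : ℕ, ‖(w 0 ^ n) ξ - ξ‖ ≤ δ * ‖ξ‖ := by
    intro n
    -- For fixed `n`, the word at scale `m` begins with an average over `w 0`, so its value is moved
    -- by `w 0 ^ n` by an amount vanishing as `m → ∞`. The bound that remains is independent of `n`.
    have hlim : Filter.Tendsto (fun m : ℕ => δ * ‖ξ‖ + 2 * n * ‖ξ‖ * (2⁻¹ : ℝ) ^ m) Filter.atTop
        (nhds (δ * ‖ξ‖ + 2 * n * ‖ξ‖ * 0)) :=
      ((tendsto_pow_atTop_nhds_zero_of_lt_one (by norm_num) (by norm_num)).const_mul _).const_add _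
    rw [mul_zero, add_zero] at hlim
    refine ge_of_tendsto hlim (Filter.eventually_atTop.2 ⟨M, fun m hm => ?_⟩)
    set η := balancedWord w m ξ with hη
    have h1 : ‖(w 0 ^ n) η - η‖ ≤ 2 * n * ‖ξ‖ * (2⁻¹ : ℝ) ^ m := by
      have e : η = isoAvg (w 0) (4 * scaleUnit m) ((isoAvg (w 1) (6 * scaleUnit m) *
          isoAvg (w 2) (4 * scaleUnit m) * (isoAvg (w 3) (4 * scaleUnit m) *
          isoAvg (w 4) (6 * scaleUnit m) * isoAvg (w 5) (4 * scaleUnit m))) ξ) := by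
        rw [← mul_apply_eq_comp, hη, balancedWord, HexagonRules.word]
        simp only [mul_assoc]
      rw [e]
      refine (norm_isoAvg_pow_sub_le _ _ _ _).trans ?_
      have n1 := fun i s => norm_isoAvg_le (w i) s
      have h2 := ContinuousLinearMap.le_of_opNorm_le (isoAvg (w 1) (6 * scaleUnit m) *
          isoAvg (w 2) (4 * scaleUnit m) * (isoAvg (w 3) (4 * scaleUnit m) *
          isoAvg (w 4) (6 * scaleUnit m) * isoAvg (w 5) (4 * scaleUnit m)))
        (HexagonRules.norm_mul_le_one (HexagonRules.norm_mul_le_one (n1 _ _) (n1 _ _))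
        (HexagonRules.norm_mul_le_one (HexagonRules.norm_mul_le_one (n1 _ _) (n1 _ _))
          (n1 _ _))) ξ
      rw [one_mul] at h2
      have h3 : (2 : ℝ) * n / 2 ^ (4 * scaleUnit m) ≤ 2 * n * (2⁻¹ : ℝ) ^ m := by
        rw [inv_pow, ← div_eq_mul_inv]
        refine div_le_div_of_nonneg_left (by positivity) (by positivity)
          (pow_le_pow_right₀ (by norm_num) ?_)
        have := le_scaleUnit m
        omega
      calc _ ≤ 2 * n * (2⁻¹ : ℝ) ^ m * ‖ξ‖ := by gcongr
        _ = _ := by ring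
    have h2 := hWm m hm
    have e : (w 0 ^ n) ξ - ξ = ((w 0 ^ n) η - η) + (η - ξ) - (w 0 ^ n) (η - ξ) := by
      rw [map_sub]; abel
    rw [e]
    refine (norm_sub_le _ _).trans ?_
    rw [LinearIsometryEquiv.norm_map]
    have h3 := norm_add_le ((w 0 ^ n) η - η) (η - ξ)
    linarith
  intro n
  rw [map_zpow]
  rcases Int.eq_nat_or_neg n with ⟨k, rfl | rfl⟩
  · rw [zpow_natCast]; exact hnat k
  · rw [zpow_neg, zpow_natCast, ← LinearIsometryEquiv.norm_map (ρ (g 0) ^ k), map_sub,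
      ← LinearIsometryEquiv.coe_mul_apply, mul_inv_cancel, norm_sub_rev]
    exact hnat k

end Rep

/-! ### Uniform convexity as an inequality -/

/-- A quantitative form of uniform convexity of the gauge `p` that is stable under averaging:
`p (x - y)` is controlled by the defect of the parallelogram-type inequality. -/
def UniformlyConvexGauge {E : Type*} [AddCommGroup E] (p : E → ℝ) : Prop :=
  ∀ η : ℝ, 0 < η → ∃ C : ℝ, 0 ≤ C ∧ ∀ x y : E,
    p (x - y) ^ 2 ≤ η * (p x ^ 2 + p y ^ 2) +
      C * ((p x ^ 2 + p y ^ 2) / 2 - p (x + y) ^ 2 / 4)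

/-- After scaling the longer vector to length one, either `x - y` is short and the first term
suffices, or uniform convexity forces a parallelogram defect proportional to the squared length. -/
theorem uniformlyConvexGauge_norm (E : Type*) [SeminormedAddCommGroup E] [NormedSpace ℝ E]
    [UniformConvexSpace E] : UniformlyConvexGauge (fun x : E => ‖x‖) := by
  intro η hη
  obtain ⟨δ₀, hδ₀, h₀⟩ := exists_forall_closed_ball_dist_add_le_two_sub E (Real.sqrt_pos.2 hη)
  obtain ⟨δ, hδ, hδ1, hδle⟩ : ∃ δ : ℝ, 0 < δ ∧ δ ≤ 1 ∧ δ ≤ δ₀ :=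
    ⟨min 1 δ₀, lt_min one_pos hδ₀, min_le_left _ _, min_le_right _ _⟩
  have hC : 0 ≤ 256 / δ ^ 2 := by positivity
  have aux : ∀ x y : E, ‖y‖ ≤ ‖x‖ → ‖x - y‖ ^ 2 ≤ η * (‖x‖ ^ 2 + ‖y‖ ^ 2) +
      256 / δ ^ 2 * ((‖x‖ ^ 2 + ‖y‖ ^ 2) / 2 - ‖x + y‖ ^ 2 / 4) := by
    intro x y hxy
    have hs := norm_add_le x y
    have hd := norm_sub_le x y
    have hsc : 0 < ‖x‖ → √η * ‖x‖ ≤ ‖x - y‖ → ‖x + y‖ ≤ (2 - δ) * ‖x‖ := by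
      intro hx h
      have hn : ∀ z : E, ‖‖x‖⁻¹ • z‖ = ‖z‖ / ‖x‖ := fun z => by
        rw [norm_smul, norm_inv, norm_norm, inv_mul_eq_div]
      have := h₀ (x := ‖x‖⁻¹ • x) (by rw [hn, div_self hx.ne']) (y := ‖x‖⁻¹ • y)
        (by rw [hn]; exact (div_le_one hx).2 hxy)
        (by rw [← smul_sub, hn, le_div_iff₀ hx]; exact h)
      rw [← smul_add, hn, div_le_iff₀ hx] at this
      nlinarith
    have hx0 := norm_nonneg x
    have hy0 := norm_nonneg y
    have hs0 := norm_nonneg (x + y)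
    have hd0 := norm_nonneg (x - y)
    generalize ‖x + y‖ = s at *
    generalize ‖x - y‖ = d at *
    generalize ‖x‖ = a at *
    generalize ‖y‖ = b at *
    have hdef : 0 ≤ (a ^ 2 + b ^ 2) / 2 - s ^ 2 / 4 := by nlinarith [sq_nonneg (a - b)]
    rcases lt_or_ge d (√η * a) with h | h
    · have h1 : d ^ 2 ≤ η * a ^ 2 := by
        have := pow_le_pow_left₀ hd0 h.le 2
        rwa [mul_pow, Real.sq_sqrt hη.le] at this
      have h2 := mul_nonneg hC hdef
      nlinarith [mul_nonneg hη.le (sq_nonneg b)]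
    · rcases hx0.eq_or_lt with h0 | h0
      · have : d = 0 := by linarith
        have h2 := mul_nonneg hC hdef
        subst this
        nlinarith [mul_nonneg hη.le (sq_nonneg b), mul_nonneg hη.le (sq_nonneg a)]
      · have h1 := hsc h0 h
        -- If `b` is well below `a`, the defect is at least `(a - b) ^ 2 / 4`; otherwise the bound
        -- `s ≤ (2 - δ) * a` produces it. With `d ^ 2 ≤ 4 * a ^ 2` this gives `256 = 4 * 64`.
        have h2 : δ ^ 2 / 64 * a ^ 2 ≤ (a ^ 2 + b ^ 2) / 2 - s ^ 2 / 4 := by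
          rcases le_total b ((1 - δ / 4) * a) with hb | hb
          · have h3 : δ / 4 * a ≤ a - b := by linarith
            have h4 := pow_le_pow_left₀ (by positivity) h3 2
            nlinarith
          · have h3 : s ^ 2 ≤ ((2 - δ) * a) ^ 2 := pow_le_pow_left₀ hs0 h1 2
            have h4 : ((1 - δ / 4) * a) ^ 2 ≤ b ^ 2 :=
              pow_le_pow_left₀ (mul_nonneg (by linarith) hx0) hb 2
            have h5 : δ ^ 2 * a ^ 2 ≤ δ * a ^ 2 := by
              apply mul_le_mul_of_nonneg_right _ (sq_nonneg a)
              nlinarith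
            nlinarith
        have h3 : d ^ 2 ≤ 4 * a ^ 2 := by nlinarith
        have h4 : 4 * a ^ 2 = 256 / δ ^ 2 * (δ ^ 2 / 64 * a ^ 2) := by field_simp; norm_num
        have h5 := mul_le_mul_of_nonneg_left h2 hC
        have h6 : 0 ≤ η * (a ^ 2 + b ^ 2) := by positivity
        linarith
  refine ⟨256 / δ ^ 2, hC, fun x y => ?_⟩
  rcases le_total ‖y‖ ‖x‖ with h | h
  · exact aux x y h
  · have := aux y x h
    dsimp only
    rw [norm_sub_rev, add_comm x y, add_comm (‖x‖ ^ 2)]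
    exact this

section Seminorm

variable {𝕜 : Type*} [RCLike 𝕜]

/-- The normed space structure defined by a seminorm. -/
abbrev Seminorm.normedSpaceOf {E : Type*} [AddCommGroup E] [Module 𝕜 E] (N : Seminorm 𝕜 E) :
    @NormedSpace 𝕜 E _ N.toAddGroupSeminorm.toSeminormedAddCommGroup :=
  @NormedSpace.mk 𝕜 E _ N.toAddGroupSeminorm.toSeminormedAddCommGroup _
    fun a b => (map_smul_eq_mul N a b).le

theorem Seminorm.uniformlyConvexGauge {E : Type*} [AddCommGroup E] [Module 𝕜 E]
    (N : Seminorm 𝕜 E)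
    (h : @UniformConvexSpace E N.toAddGroupSeminorm.toSeminormedAddCommGroup) :
    UniformlyConvexGauge N := by
  let := N.toAddGroupSeminorm.toSeminormedAddCommGroup
  let : NormedSpace 𝕜 E := N.normedSpaceOf
  let : NormedSpace ℝ E := NormedSpace.restrictScalars ℝ 𝕜 E
  exact uniformlyConvexGauge_norm E

theorem Seminorm.exists_quotient {E : Type*} [AddCommGroup E] [Module 𝕜 E]
    (N : Seminorm 𝕜 E) (S : Submodule 𝕜 E) :
    ∃ q : Seminorm 𝕜 (E ⧸ S), (∀ x : E, q (Submodule.Quotient.mk x) ≤ N x) ∧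
      ∀ (ξ : E ⧸ S) (ε : ℝ), 0 < ε → ∃ x : E, Submodule.Quotient.mk x = ξ ∧ N x < q ξ + ε := by
  let := N.toAddGroupSeminorm.toSeminormedAddCommGroup
  let : NormedSpace 𝕜 E := N.normedSpaceOf
  exact ⟨normSeminorm 𝕜 (E ⧸ S), fun x => Submodule.Quotient.norm_mk_le _ _,
    fun ξ ε hε => Submodule.Quotient.norm_mk_lt ξ hε⟩

/-- For nearly optimal lifts the right side changes by an arbitrarily small amount, while the gauges
of the sum and the difference can only drop in the quotient, which is the favourable direction for
both. -/
theorem UniformlyConvexGauge.quotient {E : Type*} [AddCommGroup E] [Module 𝕜 E]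
    {N : Seminorm 𝕜 E} (hN : UniformlyConvexGauge N) {S : Submodule 𝕜 E} {q : Seminorm 𝕜 (E ⧸ S)}
    (h1 : ∀ x : E, q (Submodule.Quotient.mk x) ≤ N x)
    (h2 : ∀ (ξ : E ⧸ S) (ε : ℝ), 0 < ε → ∃ x : E, Submodule.Quotient.mk x = ξ ∧ N x < q ξ + ε) :
    UniformlyConvexGauge q := by
  intro η hη
  obtain ⟨C, hC, h⟩ := hN η hη
  refine ⟨C, hC, fun ξ ζ => ?_⟩
  set f : ℝ → ℝ := fun ε => η * ((q ξ + ε) ^ 2 + (q ζ + ε) ^ 2) +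
      C * (((q ξ + ε) ^ 2 + (q ζ + ε) ^ 2) / 2 - q (ξ + ζ) ^ 2 / 4) with hf
  have hcont : Filter.Tendsto f (nhdsWithin 0 (Set.Ioi 0)) (nhds (f 0)) :=
    (by fun_prop : Continuous f).continuousAt.tendsto.mono_left nhdsWithin_le_nhds
  have h0 : f 0 = η * (q ξ ^ 2 + q ζ ^ 2) + C * ((q ξ ^ 2 + q ζ ^ 2) / 2 - q (ξ + ζ) ^ 2 / 4) := by
    simp [hf]
  rw [← h0]
  refine ge_of_tendsto hcont (Filter.eventually_of_mem self_mem_nhdsWithin fun ε hε => ?_)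
  obtain ⟨x, rfl, hx⟩ := h2 ξ ε hε
  obtain ⟨y, rfl, hy⟩ := h2 ζ ε hε
  have h3 := h x y
  have h4 : q (Submodule.Quotient.mk x - Submodule.Quotient.mk y) ^ 2 ≤ N (x - y) ^ 2 :=
    pow_le_pow_left₀ (apply_nonneg q _) (h1 (x - y)) 2
  have h5 : q (Submodule.Quotient.mk x + Submodule.Quotient.mk y) ^ 2 ≤ N (x + y) ^ 2 :=
    pow_le_pow_left₀ (apply_nonneg q _) (h1 (x + y)) 2
  have h6 := pow_le_pow_left₀ (apply_nonneg N x) hx.le 2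
  have h7 := pow_le_pow_left₀ (apply_nonneg N y) hy.le 2
  refine h4.trans (h3.trans ?_)
  simp only [hf]
  gcongr

end Seminorm

/-! ### Invariant renorming and fixed points -/

section Invariant

variable {F : Type*} [NormedAddCommGroup F] [NormedSpace ℝ F] {G : Type*} [Group G]

/-- A uniformly convex equivalent norm may be chosen invariant under a group of isometries. -/
theorem exists_invariant_gauge {N : Seminorm ℝ F} {c C : ℝ} (hc : 0 < c)
    (hle : ∀ x, c * ‖x‖ ≤ N x ∧ N x ≤ C * ‖x‖) (hN : UniformlyConvexGauge N)
    (ρ : G →* (F ≃ₗᵢ[ℝ] F)) :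
    ∃ p : Seminorm ℝ F, (∀ x, c * ‖x‖ ≤ p x ∧ p x ≤ C * ‖x‖) ∧ UniformlyConvexGauge p ∧
      ∀ g x, p (ρ g x) = p x := by
  have hbdd : ∀ x, BddAbove (Set.range fun g => N (ρ g x)) := fun x =>
    ⟨C * ‖x‖, by
      rintro _ ⟨g, rfl⟩
      simpa using (hle (ρ g x)).2⟩
  have hsup : ∀ x g, N (ρ g x) ≤ ⨆ g, N (ρ g x) := fun x g => le_ciSup (hbdd x) g
  let p : Seminorm ℝ F := Seminorm.of (fun x => ⨆ g, N (ρ g x))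
    (fun x y => ciSup_le fun g => by
      rw [map_add]
      exact (map_add_le_add N _ _).trans (add_le_add (hsup x g) (hsup y g)))
    (fun a x => by
      simp only [map_smul, map_smul_eq_mul]
      rw [Real.mul_iSup_of_nonneg (norm_nonneg a)])
  have hp : ∀ x, p x = ⨆ g, N (ρ g x) := fun x => rfl
  have hNp : ∀ x g, N (ρ g x) ≤ p x := hsup
  have hple : ∀ x, p x ≤ C * ‖x‖ := fun x => ciSup_le fun g => by simpa using (hle (ρ g x)).2
  have hcp : ∀ x, c * ‖x‖ ≤ p x := fun x => by
    have := (hle (ρ 1 x)).1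
    rw [LinearIsometryEquiv.norm_map] at this
    exact this.trans (hNp x 1)
  refine ⟨p, fun x => ⟨hcp x, hple x⟩, fun η hη => ?_, fun g x => ?_⟩
  · rcases lt_or_ge 0 C with hC | hC
    -- The gauge `p` is the supremum of `N` over the orbit. For every `g`, `N (ρ g (x - y))` is at
    -- least `c / C` times `p (x - y)`, so the inequality for `N` may be used at whichever `g`
    -- nearly attains `p (x + y)`.
    · set κ := (c / C) ^ 2 with hκ
      have hκ0 : 0 < κ := by positivity
      obtain ⟨D, hD, h⟩ := hN (η * κ) (by positivity)
      refine ⟨D / κ, by positivity, fun x y => ?_⟩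
      have key : ∀ g, κ * p (x - y) ^ 2 ≤ η * κ * (p x ^ 2 + p y ^ 2) +
          D * ((p x ^ 2 + p y ^ 2) / 2 - N (ρ g (x + y)) ^ 2 / 4) := by
        intro g
        have h1 : c / C * p (x - y) ≤ N (ρ g (x - y)) := by
          have h2 := (hle (ρ g (x - y))).1
          rw [LinearIsometryEquiv.norm_map] at h2
          refine le_trans ?_ h2
          rw [div_mul_eq_mul_div, div_le_iff₀ hC]
          nlinarith [hple (x - y)]
        have h2 := pow_le_pow_left₀ (mul_nonneg (by positivity) (apply_nonneg p _)) h1 2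
        rw [mul_pow, ← hκ] at h2
        refine h2.trans ?_
        have h3 := h (ρ g x) (ρ g y)
        rw [← map_sub, ← map_add] at h3
        refine h3.trans ?_
        have h4 := pow_le_pow_left₀ (apply_nonneg N _) (hNp x g) 2
        have h5 := pow_le_pow_left₀ (apply_nonneg N _) (hNp y g) 2
        gcongr
      have key2 : κ * p (x - y) ^ 2 ≤ η * κ * (p x ^ 2 + p y ^ 2) +
          D * ((p x ^ 2 + p y ^ 2) / 2 - p (x + y) ^ 2 / 4) := by
        rcases hD.eq_or_lt with h0 | h0
        · have := key 1
          rw [← h0] at this ⊢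
          linarith
        -- `Q` is the bound on `N (ρ g (x + y)) ^ 2` obtained by solving `key`; it does not depend
        -- on `g`, so it passes to the supremum.
        · set Q := 4 / D * (η * κ * (p x ^ 2 + p y ^ 2) + D * ((p x ^ 2 + p y ^ 2) / 2) -
            κ * p (x - y) ^ 2) with hQ
          have hQ4 : D * Q / 4 = η * κ * (p x ^ 2 + p y ^ 2) + D * ((p x ^ 2 + p y ^ 2) / 2) -
            κ * p (x - y) ^ 2 := by rw [hQ]; field_simp
          have h1 : ∀ g, N (ρ g (x + y)) ^ 2 ≤ Q := fun g => by
            have := key g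
            rw [hQ, div_mul_eq_mul_div, le_div_iff₀ h0]
            nlinarith
          have h2 : p (x + y) ≤ √Q := ciSup_le fun g => Real.le_sqrt_of_sq_le (h1 g)
          have hQ0 : 0 ≤ Q := (sq_nonneg _).trans (h1 1)
          have h3 := pow_le_pow_left₀ (apply_nonneg p _) h2 2
          rw [Real.sq_sqrt hQ0] at h3
          nlinarith
      have e : η * (p x ^ 2 + p y ^ 2) + D / κ * ((p x ^ 2 + p y ^ 2) / 2 - p (x + y) ^ 2 / 4) =
          (η * κ * (p x ^ 2 + p y ^ 2) +
            D * ((p x ^ 2 + p y ^ 2) / 2 - p (x + y) ^ 2 / 4)) / κ := by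
        field_simp
      rw [e, le_div_iff₀ hκ0]
      linarith
    · have h0 : ∀ x, p x = 0 := fun x => le_antisymm
        ((hple x).trans (mul_nonpos_of_nonpos_of_nonneg hC (norm_nonneg x))) (apply_nonneg p x)
      exact ⟨0, le_rfl, fun x y => by simp [h0]⟩
  · rw [hp, hp]
    refine (Equiv.mulRight g).iSup_congr fun h => ?_
    simp only [Equiv.coe_mulRight, map_mul]
    rfl

/-- If the orbit of a nonzero vector stays close to it, there is a nonzero invariant vector. -/
theorem exists_invariant_ne_zero [CompleteSpace F] {p : Seminorm ℝ F} {c C : ℝ} (hc : 0 < c)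
    (hle : ∀ x, c * ‖x‖ ≤ p x ∧ p x ≤ C * ‖x‖) (hp : UniformlyConvexGauge p)
    (ρ : G →* (F ≃ₗᵢ[ℝ] F)) (hρ : ∀ g x, p (ρ g x) = p x) {ξ : F} (hξ : ξ ≠ 0)
    (horb : ∀ g, p (ρ g ξ - ξ) ≤ p ξ / 2) : ∃ η : F, η ≠ 0 ∧ ∀ g, ρ g η = η := by
  have hpos : ∀ x, x ≠ 0 → 0 < p x := fun x hx =>
    (mul_pos hc (norm_pos_iff.2 hx)).trans_le (hle x).1
  have hC : 0 ≤ C := by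
    have h1 := hle ξ
    have h2 := norm_pos_iff.2 hξ
    by_contra h
    nlinarith [hpos ξ hξ]
  have hcont : Continuous p := by
    refine Seminorm.continuous_of_le (q := C.toNNReal • normSeminorm ℝ F) ?_ fun x => ?_
    · exact (continuous_const.mul continuous_norm :
        Continuous fun x : F => (C.toNNReal : ℝ) * ‖x‖)
    · refine (hle x).2.trans (le_of_eq ?_)
      change C * ‖x‖ = (C.toNNReal : ℝ) * ‖x‖
      rw [Real.coe_toNNReal _ hC]
  set H := convexHull ℝ (Set.range fun g => ρ g ξ) with hH
  have hHconv : Convex ℝ H := convex_convexHull ℝ _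
  have hξH : ξ ∈ H := subset_convexHull ℝ _ ⟨1, by simp⟩
  have hHinv : ∀ g x, x ∈ H → ρ g x ∈ H := by
    intro g x hx
    have h1 : ρ g x ∈ (ρ g).toLinearEquiv.toLinearMap '' H := ⟨x, hx, rfl⟩
    rw [hH, LinearMap.image_convexHull] at h1
    refine convexHull_mono ?_ h1
    rintro _ ⟨_, ⟨h, rfl⟩, rfl⟩
    exact ⟨g * h, by simp only [map_mul]; rfl⟩
  have hHball : ∀ x ∈ H, p (x - ξ) ≤ p ξ / 2 := by
    have h1 : H ⊆ p.closedBall ξ (p ξ / 2) :=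
      convexHull_min (by
        rintro _ ⟨g, rfl⟩
        exact (Seminorm.mem_closedBall p).2 (horb g)) (p.convex_closedBall _ _)
    exact fun x hx => (Seminorm.mem_closedBall p).1 (h1 hx)
  set m := sInf (p '' H) with hm
  have hbdd : BddBelow (p '' H) := ⟨0, by rintro _ ⟨x, _, rfl⟩; exact apply_nonneg p x⟩
  have hmle : ∀ x ∈ H, m ≤ p x := fun x hx => csInf_le hbdd ⟨x, hx, rfl⟩
  have hm0 : 0 ≤ m := le_csInf ⟨_, ξ, hξH, rfl⟩ (by rintro _ ⟨x, _, rfl⟩; exact apply_nonneg p x)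
  have happrox : ∀ t : ℝ, 0 < t → ∃ x ∈ H, p x ^ 2 < m ^ 2 + t := by
    intro t ht
    have h1 : m < √(m ^ 2 + t) := Real.lt_sqrt_of_sq_lt (by linarith)
    obtain ⟨_, ⟨x, hx, rfl⟩, h2⟩ := exists_lt_of_csInf_lt (⟨_, ξ, hξH, rfl⟩ : (p '' H).Nonempty) h1
    refine ⟨x, hx, ?_⟩
    have h3 := pow_lt_pow_left₀ h2 (apply_nonneg p x) two_ne_zero
    rwa [Real.sq_sqrt (by positivity)] at h3
  -- Near-minimisers of `p` on the convex set `H` are close to each other, since their midpoint lies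
  -- in `H` and has gauge at least `m`. This gives both a Cauchy minimising sequence and, applied to
  -- `u n` and its translate, invariance of the limit.
  have hclose : ∀ e : ℝ, 0 < e → ∃ t : ℝ, 0 < t ∧ ∀ x ∈ H, ∀ y ∈ H, p x ^ 2 ≤ m ^ 2 + t →
      p y ^ 2 ≤ m ^ 2 + t → p (x - y) ≤ e := by
    intro e he
    -- As `p x ^ 2 + p y ^ 2 ≤ 2 * (m ^ 2 + 1)`, the first term is at most `e ^ 2 / 2`; the choice
    -- of `t` bounds the second by the same.
    obtain ⟨D, hD, h⟩ := hp (e ^ 2 / (4 * (m ^ 2 + 1))) (by positivity)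
    refine ⟨min 1 (e ^ 2 / (2 * (D + 1))), by positivity, fun x hx y hy hx2 hy2 => ?_⟩
    set t := min 1 (e ^ 2 / (2 * (D + 1))) with ht
    have ht1 : t ≤ 1 := min_le_left _ _
    have ht2 : t * (2 * (D + 1)) ≤ e ^ 2 := by
      rw [← le_div_iff₀ (by positivity)]; exact min_le_right _ _
    have ht0 : 0 < t := by positivity
    have h1 : m ^ 2 ≤ p (x + y) ^ 2 / 4 := by
      have h2 := hmle _ (hHconv hx hy (a := 2⁻¹) (b := 2⁻¹) (by norm_num) (by norm_num)
        (by norm_num))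
      rw [← smul_add, map_smul_eq_mul, Real.norm_of_nonneg (by norm_num)] at h2
      have h3 := pow_le_pow_left₀ hm0 h2 2
      linarith
    have h4 := h x y
    have h5 : e ^ 2 / (4 * (m ^ 2 + 1)) * (p x ^ 2 + p y ^ 2) ≤ e ^ 2 / 2 := by
      rw [div_mul_eq_mul_div, div_le_iff₀ (by positivity)]
      nlinarith [sq_nonneg e]
    have h6 : D * ((p x ^ 2 + p y ^ 2) / 2 - p (x + y) ^ 2 / 4) ≤ D * t := by
      gcongr
      linarith
    have h7 : p (x - y) ^ 2 ≤ e ^ 2 := by nlinarith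
    exact (pow_le_pow_iff_left₀ (apply_nonneg p _) he.le two_ne_zero).1 h7
  choose u huH hu using fun n : ℕ => happrox (1 / ((n : ℝ) + 1)) (by positivity)
  have hevent : ∀ t : ℝ, 0 < t → ∃ n₀ : ℕ, ∀ n ≥ n₀, p (u n) ^ 2 ≤ m ^ 2 + t := by
    intro t ht
    obtain ⟨n₀, hn₀⟩ := exists_nat_one_div_lt ht
    refine ⟨n₀, fun n hn => (hu n).le.trans ?_⟩
    have : 1 / ((n : ℝ) + 1) ≤ 1 / ((n₀ : ℝ) + 1) :=
      one_div_le_one_div_of_le (by positivity) (by gcongr)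
    linarith
  have hcauchy : CauchySeq u := by
    refine Metric.cauchySeq_iff.2 fun e he => ?_
    obtain ⟨t, ht, h1⟩ := hclose (c * e / 2) (by positivity)
    obtain ⟨n₀, hn₀⟩ := hevent t ht
    refine ⟨n₀, fun i hi j hj => ?_⟩
    have h2 := h1 _ (huH i) _ (huH j) (hn₀ i hi) (hn₀ j hj)
    have h3 := (hle (u i - u j)).1
    rw [dist_eq_norm]
    nlinarith
  obtain ⟨x, hx⟩ := cauchySeq_tendsto_of_complete hcauchy
  refine ⟨x, ?_, fun g => ?_⟩
  · rintro rfl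
    have h1 : p (0 - ξ) ≤ p ξ / 2 :=
      le_of_tendsto ((hcont.tendsto _).comp (hx.sub_const ξ))
        (Filter.Eventually.of_forall fun n => hHball _ (huH n))
    rw [zero_sub, map_neg_eq_map] at h1
    linarith [hpos ξ hξ]
  · by_contra hne
    have hpos' := hpos _ (sub_ne_zero.2 hne)
    obtain ⟨t, ht, h1⟩ := hclose (p (ρ g x - x) / 2) (by positivity)
    obtain ⟨n₀, hn₀⟩ := hevent t ht
    have h2 : p (ρ g x - x) ≤ p (ρ g x - x) / 2 :=
      le_of_tendsto ((hcont.tendsto _).comp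
        ((((ρ g).continuous.tendsto _).comp hx).sub hx))
        (Filter.eventually_atTop.2 ⟨n₀, fun n hn =>
          h1 _ (hHinv g _ (huH n)) _ (huH n) (by rw [hρ]; exact hn₀ n hn) (hn₀ n hn)⟩)
    linarith

end Invariant

/-- Relative property (T) for root subgroups, for linear representations that preserve a uniformly
convex gauge. -/
theorem IsHexagon.exists_finite_gauge_zpow_sub_le {F : Type*} [AddCommGroup F] [Module ℝ F]
    {p : Seminorm ℝ F} (hp : UniformlyConvexGauge p) {G : Type*} [Group G]
    (ρ : G →* (F ≃ₗ[ℝ] F)) (hρ : ∀ g x, p (ρ g x) = p x) {g : Fin 6 → G} (hg : IsHexagon g)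
    {δ : ℝ} (hδ : 0 < δ) :
    ∃ K : Set G, K.Finite ∧ ∃ ε : ℝ, 0 < ε ∧ ∀ ξ : F,
      (∀ h ∈ K, p (ρ h ξ - ξ) ≤ ε * p ξ) →
        ∀ (i : Fin 6) (n : ℤ), p (ρ (g i ^ n) ξ - ξ) ≤ δ * p ξ := by
  let := p.toAddGroupSeminorm.toSeminormedAddCommGroup
  let : NormedSpace ℝ F := p.normedSpaceOf
  obtain ⟨C, hC, hUC⟩ := hp (1 / 18) (by norm_num)
  let ρ' : G →* (F ≃ₗᵢ[ℝ] F) :=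
    { toFun := fun h => { toLinearEquiv := ρ h, norm_map' := hρ h }
      map_one' := by ext x; exact DFunLike.congr_fun (map_one ρ) x
      map_mul' := fun a b => by ext x; exact DFunLike.congr_fun (map_mul ρ a b) x }
  have hUC' : ∀ x y : F, ‖x - y‖ ^ 2 ≤ 1 / 18 * (‖x‖ ^ 2 + ‖y‖ ^ 2) +
      C * ((‖x‖ ^ 2 + ‖y‖ ^ 2) / 2 - ‖(2 : ℝ)⁻¹ • (x + y)‖ ^ 2) := by
    intro x y
    have h1 : ‖(2 : ℝ)⁻¹ • (x + y)‖ ^ 2 = ‖x + y‖ ^ 2 / 4 := by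
      rw [norm_smul, Real.norm_of_nonneg (by norm_num)]; ring
    rw [h1]
    exact hUC x y
  choose K hK ε hε h using fun r : Fin 6 =>
    (hg.rotate r).exists_finite_norm_zpow_sub_le hC hUC' ρ' hδ
  refine ⟨⋃ r, K r, Set.finite_iUnion hK, Finset.univ.inf' Finset.univ_nonempty ε,
    (Finset.lt_inf'_iff _).2 fun r _ => hε r, fun ξ hξ i n => ?_⟩
  have h1 := h i ξ (fun k hk => (hξ k (Set.mem_iUnion.2 ⟨i, hk⟩)).trans
    (mul_le_mul_of_nonneg_right (Finset.inf'_le _ (Finset.mem_univ i)) (apply_nonneg p ξ))) n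
  rw [zero_add] at h1
  exact h1

/-! ### Bounded generation of SL₃(ℤ), after Carter and Keller -/

section BoundedGeneration

open Matrix MatrixGroups
open scoped Pointwise

namespace Matrix.SpecialLinearGroup

/-- The elementary matrices of `SL₃(ℤ)`. -/
def elementarySet : Set SL(3, ℤ) :=
  {g | ∃ (i j : Fin 3) (h : i ≠ j) (m : ℤ), g = transvection h m}

/-- The products of `n` elementary matrices of `SL₃(ℤ)`. -/
def elementaryBall (n : ℕ) : Set SL(3, ℤ) := elementarySet ^ n

theorem transvection_mem_elementaryBall {i j : Fin 3} (h : i ≠ j) (m : ℤ) :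
    transvection h m ∈ elementaryBall 1 := by
  rw [elementaryBall, pow_one]
  exact ⟨i, j, h, m, rfl⟩

theorem one_mem_elementarySet : (1 : SL(3, ℤ)) ∈ elementarySet :=
  ⟨0, 1, by decide, 0, by simp⟩

theorem elementaryBall_mono {m n : ℕ} (h : m ≤ n) : elementaryBall m ⊆ elementaryBall n :=
  Set.pow_subset_pow_right one_mem_elementarySet h

theorem mul_mem_elementaryBall {m n : ℕ} {g h : SL(3, ℤ)} (hg : g ∈ elementaryBall m)
    (hh : h ∈ elementaryBall n) : g * h ∈ elementaryBall (m + n) := by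
  rw [elementaryBall, pow_add]
  exact Set.mul_mem_mul hg hh

theorem inv_mem_elementaryBall {n : ℕ} {g : SL(3, ℤ)} (hg : g ∈ elementaryBall n) :
    g⁻¹ ∈ elementaryBall n := by
  have h : (elementarySet : Set SL(3, ℤ))⁻¹ = elementarySet := by
    refine Set.Subset.antisymm ?_ ?_
    · rintro g ⟨i, j, h, m, hg⟩
      exact ⟨i, j, h, -m, by rw [← transvection_inv, ← hg, inv_inv]⟩
    · rintro _ ⟨i, j, h, m, rfl⟩
      exact ⟨i, j, h, -m, transvection_inv h m⟩
  rw [elementaryBall, ← h, inv_pow]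
  exact Set.inv_mem_inv.2 hg

theorem transpose_mem_elementaryBall {n : ℕ} {g : SL(3, ℤ)} (hg : g ∈ elementaryBall n) :
    g.transpose ∈ elementaryBall n := by
  induction n generalizing g with
  | zero =>
    obtain rfl : g = 1 := by simpa [elementaryBall] using hg
    have : (1 : SL(3, ℤ)).transpose = 1 := by ext; simp [transpose]
    rw [this]
    exact hg
  | succ n ih =>
    rw [elementaryBall, pow_succ] at hg
    obtain ⟨x, hx, _, ⟨i, j, hij, m, rfl⟩, rfl⟩ := hg
    have h1 : (x * transvection hij m).transpose = transvection hij.symm m * x.transpose := by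
      apply Subtype.ext
      rw [coe_mul, coe_transpose, coe_mul, transpose_mul, coe_transpose]
      congr 1
      simp [transvection_coe]
    rw [show (fun a b => a * b) x (transvection hij m) = x * transvection hij m from rfl, h1,
      add_comm]
    exact mul_mem_elementaryBall (transvection_mem_elementaryBall _ _) (ih hx)

theorem coe_transvection_zero_one (m : ℤ) : (transvection (show (0 : Fin 3) ≠ 1 by decide) m :
    Matrix (Fin 3) (Fin 3) ℤ) = !![1, m, 0; 0, 1, 0; 0, 0, 1] := by
  ext i j; fin_cases i <;> fin_cases j <;> simp [transvection_coe, single]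

theorem coe_transvection_zero_two (m : ℤ) : (transvection (show (0 : Fin 3) ≠ 2 by decide) m :
    Matrix (Fin 3) (Fin 3) ℤ) = !![1, 0, m; 0, 1, 0; 0, 0, 1] := by
  ext i j; fin_cases i <;> fin_cases j <;> simp [transvection_coe, single]

theorem coe_transvection_one_two (m : ℤ) : (transvection (show (1 : Fin 3) ≠ 2 by decide) m :
    Matrix (Fin 3) (Fin 3) ℤ) = !![1, 0, 0; 0, 1, m; 0, 0, 1] := by
  ext i j; fin_cases i <;> fin_cases j <;> simp [transvection_coe, single]

theorem coe_transvection_one_zero (m : ℤ) : (transvection (show (1 : Fin 3) ≠ 0 by decide) m :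
    Matrix (Fin 3) (Fin 3) ℤ) = !![1, 0, 0; m, 1, 0; 0, 0, 1] := by
  ext i j; fin_cases i <;> fin_cases j <;> simp [transvection_coe, single]

theorem coe_transvection_two_zero (m : ℤ) : (transvection (show (2 : Fin 3) ≠ 0 by decide) m :
    Matrix (Fin 3) (Fin 3) ℤ) = !![1, 0, 0; 0, 1, 0; m, 0, 1] := by
  ext i j; fin_cases i <;> fin_cases j <;> simp [transvection_coe, single]

theorem coe_transvection_two_one (m : ℤ) : (transvection (show (2 : Fin 3) ≠ 1 by decide) m :
    Matrix (Fin 3) (Fin 3) ℤ) = !![1, 0, 0; 0, 1, 0; 0, m, 1] := by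
  ext i j; fin_cases i <;> fin_cases j <;> simp [transvection_coe, single]

/-- The embedding of `SL₂(ℤ)` into the upper left corner of `SL₃(ℤ)`. -/
def corner : SL(2, ℤ) →* SL(3, ℤ) where
  toFun A := ⟨!![A 0 0, A 0 1, 0; A 1 0, A 1 1, 0; 0, 0, 1], by
    have := A.det_coe
    rw [det_fin_two] at this
    simpa [det_fin_three] using this⟩
  map_one' := by
    ext i j; fin_cases i <;> fin_cases j <;> simp
  map_mul' A B := by
    apply Subtype.ext
    refine Eq.trans ?_ (coe_mul _ _).symm
    ext i j; fin_cases i <;> fin_cases j <;> simp [mul_apply, Fin.sum_univ_succ]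

theorem coe_corner (A : SL(2, ℤ)) : (corner A : Matrix (Fin 3) (Fin 3) ℤ) =
    !![A 0 0, A 0 1, 0; A 1 0, A 1 1, 0; 0, 0, 1] := rfl

theorem corner_transpose (A : SL(2, ℤ)) : corner A.transpose = (corner A).transpose := by
  apply Subtype.ext
  rw [coe_transpose, coe_corner, coe_corner, coe_transpose]
  ext i j; fin_cases i <;> fin_cases j <;> simp

theorem of_fin_three_congr {R : Type*} {a b c d e f g h i a' b' c' d' e' f' g' h' i' : R}
    (ha : a = a') (hb : b = b') (hc : c = c') (hd : d = d') (he : e = e') (hf : f = f')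
    (hg : g = g') (hh : h = h') (hi : i = i') :
    !![a, b, c; d, e, f; g, h, i] = !![a', b', c'; d', e', f'; g', h', i'] := by
  rw [ha, hb, hc, hd, he, hf, hg, hh, hi]

theorem mul_sub_mul_eq_one (A : SL(2, ℤ)) : A 0 0 * A 1 1 - A 0 1 * A 1 0 = 1 := by
  have := A.det_coe
  rwa [det_fin_two] at this

/-- All matrices of `SL₂(ℤ)` with first row `(a, b)` are products of `n` elementary matrices
of `SL₃(ℤ)`. -/
def RowBound (n : ℕ) (a b : ℤ) : Prop :=
  ∀ A : SL(2, ℤ), A 0 0 = a → A 0 1 = b → corner A ∈ elementaryBall n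

theorem RowBound.mono {m n : ℕ} {a b : ℤ} (h : RowBound m a b) (hmn : m ≤ n) : RowBound n a b :=
  fun A h0 h1 => elementaryBall_mono hmn (h A h0 h1)

/-- Two matrices with the same first row differ by a lower unipotent factor on the left, so at the
cost of one elementary matrix only the row matters, as for Mennicke symbols. -/
theorem rowBound_of_mem {n : ℕ} {A : SL(2, ℤ)} (h : corner A ∈ elementaryBall n) :
    RowBound (n + 1) (A 0 0) (A 0 1) := by
  intro B h0 h1
  have hA := A.mul_sub_mul_eq_one
  have hB := B.mul_sub_mul_eq_one
  have key : corner B = transvection (show (1 : Fin 3) ≠ 0 by decide)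
      (B 1 0 * A 1 1 - B 1 1 * A 1 0) * corner A := by
    apply Subtype.ext
    rw [coe_mul, coe_transvection_one_zero, coe_corner, coe_corner, mul_fin_three, h0, h1]
    rw [h0, h1] at hB
    apply of_fin_three_congr <;> first
      | ring1
      | linear_combination A 1 0 * hB - B 1 0 * hA
      | linear_combination A 1 1 * hB - B 1 1 * hA
  rw [key, add_comm]
  exact mul_mem_elementaryBall (transvection_mem_elementaryBall _ _) h

theorem corner_transpose_mem_iff {n : ℕ} {A : SL(2, ℤ)} :
    corner A.transpose ∈ elementaryBall n ↔ corner A ∈ elementaryBall n := by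
  refine ⟨fun h => ?_, fun h => ?_⟩
  · have := transpose_mem_elementaryBall h
    rwa [corner_transpose] at this
  · rw [corner_transpose]
    exact transpose_mem_elementaryBall h

/-- The matrix of `SL₂(ℤ)` with the given entries. -/
def mkTwo (a b c d : ℤ) (h : a * d - b * c = 1) : SL(2, ℤ) :=
  ⟨!![a, b; c, d], by rw [det_fin_two_of]; exact h⟩

theorem coe_corner_mkTwo {a b c d : ℤ} (h : a * d - b * c = 1) :
    (corner (mkTwo a b c d h) : Matrix (Fin 3) (Fin 3) ℤ) = !![a, b, 0; c, d, 0; 0, 0, 1] := rfl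

theorem corner_mul_transvection_one_zero (A : SL(2, ℤ)) (t : ℤ) :
    corner (mkTwo (A 0 0 + t * A 0 1) (A 0 1) (A 1 0 + t * A 1 1) (A 1 1)
      (by linear_combination A.mul_sub_mul_eq_one)) =
      corner A * transvection (show (1 : Fin 3) ≠ 0 by decide) t := by
  apply Subtype.ext
  rw [coe_mul, coe_transvection_one_zero, coe_corner, coe_corner, mul_fin_three]
  apply of_fin_three_congr <;> simp [mkTwo, mul_comm]

theorem RowBound.of_add_mul_left {n : ℕ} {a b : ℤ} (t : ℤ) (h : RowBound n (a + t * b) b) :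
    RowBound (n + 1) a b := by
  intro A h0 h1
  have h2 := h (mkTwo (A 0 0 + t * A 0 1) (A 0 1) (A 1 0 + t * A 1 1) (A 1 1)
      (by linear_combination A.mul_sub_mul_eq_one)) (by simp [mkTwo, h0, h1]) (by simp [mkTwo, h1])
  rw [corner_mul_transvection_one_zero] at h2
  have h3 := mul_mem_elementaryBall h2
    (transvection_mem_elementaryBall (show (1 : Fin 3) ≠ 0 by decide) (-t))
  rwa [mul_assoc, transvection_mul_neg, mul_one] at h3

theorem corner_mul_transvection_zero_one (A : SL(2, ℤ)) (t : ℤ) :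
    corner (mkTwo (A 0 0) (A 0 1 + t * A 0 0) (A 1 0) (A 1 1 + t * A 1 0)
      (by linear_combination A.mul_sub_mul_eq_one)) =
      corner A * transvection (show (0 : Fin 3) ≠ 1 by decide) t := by
  apply Subtype.ext
  rw [coe_mul, coe_transvection_zero_one, coe_corner, coe_corner, mul_fin_three]
  apply of_fin_three_congr <;> simp [mkTwo, mul_comm, add_comm]

theorem RowBound.of_add_mul_right {n : ℕ} {a b : ℤ} (t : ℤ) (h : RowBound n a (b + t * a)) :
    RowBound (n + 1) a b := by
  intro A h0 h1
  have h2 := h (mkTwo (A 0 0) (A 0 1 + t * A 0 0) (A 1 0) (A 1 1 + t * A 1 0)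
      (by linear_combination A.mul_sub_mul_eq_one)) (by simp [mkTwo, h0]) (by simp [mkTwo, h0, h1])
  rw [corner_mul_transvection_zero_one] at h2
  have h3 := mul_mem_elementaryBall h2
    (transvection_mem_elementaryBall (show (0 : Fin 3) ≠ 1 by decide) (-t))
  rwa [mul_assoc, transvection_mul_neg, mul_one] at h3

/-- The Weyl element exchanging the last two coordinates. -/
def weylOneTwo : SL(3, ℤ) := transvection (show (1 : Fin 3) ≠ 2 by decide) 1 *
  transvection (show (2 : Fin 3) ≠ 1 by decide) (-1) *
  transvection (show (1 : Fin 3) ≠ 2 by decide) 1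

/-- The Weyl element exchanging the first and last coordinates. -/
def weylZeroTwo : SL(3, ℤ) := transvection (show (0 : Fin 3) ≠ 2 by decide) 1 *
  transvection (show (2 : Fin 3) ≠ 0 by decide) (-1) *
  transvection (show (0 : Fin 3) ≠ 2 by decide) 1

theorem weylOneTwo_mem : weylOneTwo ∈ elementaryBall 3 :=
  mul_mem_elementaryBall (mul_mem_elementaryBall (transvection_mem_elementaryBall _ _)
    (transvection_mem_elementaryBall _ _)) (transvection_mem_elementaryBall _ _)

theorem weylZeroTwo_mem : weylZeroTwo ∈ elementaryBall 3 :=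
  mul_mem_elementaryBall (mul_mem_elementaryBall (transvection_mem_elementaryBall _ _)
    (transvection_mem_elementaryBall _ _)) (transvection_mem_elementaryBall _ _)

theorem coe_weylOneTwo :
    (weylOneTwo : Matrix (Fin 3) (Fin 3) ℤ) = !![1, 0, 0; 0, 0, 1; 0, -1, 0] := by
  rw [weylOneTwo, coe_mul, coe_mul, coe_transvection_one_two, coe_transvection_two_one,
    mul_fin_three, mul_fin_three]
  simp

theorem coe_weylZeroTwo :
    (weylZeroTwo : Matrix (Fin 3) (Fin 3) ℤ) = !![0, 0, 1; 0, 1, 0; -1, 0, 0] := by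
  rw [weylZeroTwo, coe_mul, coe_mul, coe_transvection_zero_two, coe_transvection_two_zero,
    mul_fin_three, mul_fin_three]
  simp

theorem coe_weylZeroTwo_inv :
    ((weylZeroTwo⁻¹ : SL(3, ℤ)) : Matrix (Fin 3) (Fin 3) ℤ) = !![0, 0, -1; 0, 1, 0; 1, 0, 0] := by
  rw [coe_inv, coe_weylZeroTwo, adjugate_fin_three_of]
  simp

/-- The multiplicativity of Mennicke symbols, as an identity in `SL₃(ℤ)`. -/
theorem mennicke_identity {a b₁ c₁ d₁ b₂ c₂ d₂ : ℤ} (h₁ : a * d₁ - b₁ * c₁ = 1)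
    (h₂ : a * d₂ - b₂ * c₂ = 1) :
    transvection (show (2 : Fin 3) ≠ 1 by decide) c₂ * corner (mkTwo a b₁ c₁ d₁ h₁) *
      (weylOneTwo * weylZeroTwo⁻¹ * corner (mkTwo a b₂ c₂ d₂ h₂) * weylZeroTwo) *
      (transvection (show (0 : Fin 3) ≠ 2 by decide) (-b₁) *
      transvection (show (2 : Fin 3) ≠ 0 by decide) (-c₁) *
      transvection (show (2 : Fin 3) ≠ 1 by decide) (-(d₁ * b₂))) =
      weylOneTwo * corner (mkTwo a (b₁ * b₂) (-(c₁ * c₂)) (d₂ - d₁ * b₂ * c₂)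
        (by linear_combination h₂ - b₂ * c₂ * h₁)) := by
  apply Subtype.ext
  simp only [coe_mul, coe_transvection_two_one, coe_transvection_two_zero,
    coe_transvection_zero_two, coe_weylOneTwo, coe_weylZeroTwo, coe_weylZeroTwo_inv,
    coe_corner_mkTwo, mul_fin_three]
  apply of_fin_three_congr
  · ring1
  · ring1
  · ring1
  · linear_combination (-c₁) * h₁
  · linear_combination (-d₁ * b₂) * h₁
  · linear_combination h₁
  · linear_combination (-c₁ * c₂) * h₁
  · linear_combination (-d₁ * b₂ * c₂) * h₁
  · linear_combination c₂ * h₁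

theorem RowBound.of_mul {m n : ℕ} {a b₁ b₂ : ℤ} (h₁ : RowBound m a b₁) (h₂ : RowBound n a b₂) :
    RowBound (m + n + 20) a (b₁ * b₂) := by
  intro A h0 h1
  have hA := A.mul_sub_mul_eq_one
  rw [h0, h1] at hA
  -- Both factors get the lower right entry of `A`; the lower left entries `b₂ * A 1 0` and `b₁ * A
  -- 1 0` then give them determinant one.
  have e1 : a * A 1 1 - b₁ * (b₂ * A 1 0) = 1 := by linear_combination hA
  have e2 : a * A 1 1 - b₂ * (b₁ * A 1 0) = 1 := by linear_combination hA
  have key := mennicke_identity e1 e2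
  rw [← inv_mul_eq_iff_eq_mul] at key
  have hC := mul_mem_elementaryBall (inv_mem_elementaryBall weylOneTwo_mem)
    (mul_mem_elementaryBall (mul_mem_elementaryBall (mul_mem_elementaryBall
      (transvection_mem_elementaryBall (show (2 : Fin 3) ≠ 1 by decide) (b₁ * A 1 0))
      (h₁ (mkTwo _ _ _ _ e1) rfl rfl)) (mul_mem_elementaryBall (mul_mem_elementaryBall
        (mul_mem_elementaryBall weylOneTwo_mem (inv_mem_elementaryBall weylZeroTwo_mem))
        (h₂ (mkTwo _ _ _ _ e2) rfl rfl)) weylZeroTwo_mem))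
      (mul_mem_elementaryBall (mul_mem_elementaryBall
        (transvection_mem_elementaryBall (show (0 : Fin 3) ≠ 2 by decide) (-b₁))
        (transvection_mem_elementaryBall (show (2 : Fin 3) ≠ 0 by decide) (-(b₂ * A 1 0))))
        (transvection_mem_elementaryBall (show (2 : Fin 3) ≠ 1 by decide) (-(A 1 1 * b₂)))))
  rw [key] at hC
  exact elementaryBall_mono (by omega) (rowBound_of_mem hC A h0 h1)

/-- The same identity solved for the first factor: a symbol may be divided by a controlled one. -/
theorem RowBound.of_mul_left {m n : ℕ} {a b₁ b₂ : ℤ} (hab : IsCoprime a b₂)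
    (h : RowBound m a (b₁ * b₂)) (h₂ : RowBound n a b₂) : RowBound (m + n + 20) a b₁ := by
  intro A h0 h1
  obtain ⟨d, c, hdc⟩ := hab
  have hA := A.mul_sub_mul_eq_one
  rw [h0, h1] at hA
  have e2 : a * d - b₂ * (-c) = 1 := by linear_combination hdc
  have key := mennicke_identity hA e2
  have hC : ∀ x B p q w : SL(3, ℤ), x * B * p * q = w → B = x⁻¹ * (w * q⁻¹ * p⁻¹) := by
    rintro x B p q w rfl
    group
  have hA' : A = mkTwo _ _ _ _ hA := by
    apply Subtype.ext
    ext i j; fin_cases i <;> fin_cases j <;> simp [mkTwo, h0, h1]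
  have hmem := mul_mem_elementaryBall (inv_mem_elementaryBall
    (transvection_mem_elementaryBall (show (2 : Fin 3) ≠ 1 by decide) (-c)))
    (mul_mem_elementaryBall (mul_mem_elementaryBall (mul_mem_elementaryBall weylOneTwo_mem
      (h (mkTwo a (b₁ * b₂) (-(A 1 0 * -c)) (d - A 1 1 * b₂ * -c)
        (by linear_combination e2 - b₂ * (-c) * hA)) rfl rfl))
      (inv_mem_elementaryBall (mul_mem_elementaryBall (mul_mem_elementaryBall
        (transvection_mem_elementaryBall (show (0 : Fin 3) ≠ 2 by decide) (-b₁))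
        (transvection_mem_elementaryBall (show (2 : Fin 3) ≠ 0 by decide) (-(A 1 0))))
        (transvection_mem_elementaryBall (show (2 : Fin 3) ≠ 1 by decide) (-(A 1 1 * b₂))))))
      (inv_mem_elementaryBall (mul_mem_elementaryBall (mul_mem_elementaryBall
        (mul_mem_elementaryBall weylOneTwo_mem (inv_mem_elementaryBall weylZeroTwo_mem))
        (h₂ (mkTwo _ _ _ _ e2) rfl rfl)) weylZeroTwo_mem)))
  rw [← hC _ _ _ _ _ key, ← hA'] at hmem
  exact elementaryBall_mono (by omega) hmem

theorem rowBound_of_dvd_sub_one {a b : ℤ} (h : b ∣ a - 1) : RowBound 3 a b := by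
  obtain ⟨t, ht⟩ := h
  refine RowBound.of_add_mul_left (n := 2) (-t) ?_
  rw [show a + -t * b = 1 by linear_combination ht]
  refine RowBound.of_add_mul_right (n := 1) (-b) ?_
  rw [show b + -b * 1 = 0 by ring]
  refine rowBound_of_mem (n := 0) (A := 1) ?_
  rw [map_one, elementaryBall, pow_zero]
  exact Set.one_mem_one

theorem eq_mkTwo {A : SL(2, ℤ)} {a b : ℤ} (h0 : A 0 0 = a) (h1 : A 0 1 = b) :
    ∃ h, A = mkTwo a b (A 1 0) (A 1 1) h := by
  refine ⟨by rw [← h0, ← h1]; exact A.mul_sub_mul_eq_one, ?_⟩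
  apply Subtype.ext
  ext i j; fin_cases i <;> fin_cases j <;> simp [mkTwo, h0, h1]

/-- Squares of Weyl elements are diagonal sign matrices, so changing signs has bounded cost. -/
theorem RowBound.of_neg_neg {n : ℕ} {a b : ℤ} (h : RowBound n (-a) (-b)) :
    RowBound (n + 12) a b := by
  intro A h0 h1
  obtain ⟨hA, hA'⟩ := eq_mkTwo h0 h1
  generalize A 1 0 = c, A 1 1 = d at hA hA'
  subst hA'
  have key : corner (mkTwo (-a) (-b) (-c) (-d) (by linear_combination hA)) *
      ((weylZeroTwo * weylZeroTwo) * (weylOneTwo * weylOneTwo)) = corner (mkTwo a b c d hA) := by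
    apply Subtype.ext
    simp only [coe_mul, coe_weylOneTwo, coe_weylZeroTwo, coe_corner_mkTwo, mul_fin_three]
    apply of_fin_three_congr <;> simp
  rw [← key]
  exact mul_mem_elementaryBall (h _ rfl rfl) (mul_mem_elementaryBall
    (mul_mem_elementaryBall weylZeroTwo_mem weylZeroTwo_mem)
    (mul_mem_elementaryBall weylOneTwo_mem weylOneTwo_mem))

theorem RowBound.of_neg_right {n : ℕ} {a b : ℤ} (h : RowBound n a (-b)) :
    RowBound (n + 12) a b := by
  intro A h0 h1
  obtain ⟨hA, hA'⟩ := eq_mkTwo h0 h1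
  generalize A 1 0 = c, A 1 1 = d at hA hA'
  subst hA'
  have key : (weylZeroTwo * weylZeroTwo) *
      corner (mkTwo a (-b) (-c) d (by linear_combination hA)) *
      (weylZeroTwo * weylZeroTwo) = corner (mkTwo a b c d hA) := by
    apply Subtype.ext
    simp only [coe_mul, coe_weylZeroTwo, coe_corner_mkTwo, mul_fin_three]
    apply of_fin_three_congr <;> simp
  rw [← key]
  refine elementaryBall_mono (by omega) (mul_mem_elementaryBall (mul_mem_elementaryBall
    (mul_mem_elementaryBall weylZeroTwo_mem weylZeroTwo_mem) (h _ rfl rfl))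
    (mul_mem_elementaryBall weylZeroTwo_mem weylZeroTwo_mem))

theorem RowBound.of_neg_left {n : ℕ} {a b : ℤ} (h : RowBound n (-a) b) :
    RowBound (n + 24) a b :=
  RowBound.of_neg_neg (n := n + 12) (RowBound.of_neg_right (by rwa [neg_neg]))

theorem rowBound_of_dvd_add_one {a b : ℤ} (h : b ∣ a + 1) : RowBound 15 a b := by
  refine RowBound.of_neg_neg (n := 3) (rowBound_of_dvd_sub_one ?_)
  rw [neg_dvd, show -a - 1 = -(a + 1) by ring, dvd_neg]
  exact h

theorem rowBound_of_dvd_sq_sub_one {a b : ℤ} (h : b ∣ a ^ 2 - 1) : RowBound 38 a b := by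
  rw [show a ^ 2 - 1 = (a - 1) * (a + 1) by ring] at h
  obtain ⟨b₁, b₂, h₁, h₂, rfl⟩ := exists_dvd_and_dvd_of_dvd_mul h
  exact ((rowBound_of_dvd_sub_one h₁).of_mul (rowBound_of_dvd_add_one h₂)).mono (by norm_num)

/-- By Cayley–Hamilton `A ^ k = u * A + v`. The third relation is `det (A ^ k) = 1`; the last holds
since `A` is triangular modulo `A 0 1`. -/
theorem exists_pow_eq (A : SL(2, ℤ)) (k : ℕ) : ∃ u v : ℤ,
    (A ^ k) 0 0 = u * A 0 0 + v ∧ (A ^ k) 0 1 = u * A 0 1 ∧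
    v ^ 2 + u * v * (A 0 0 + A 1 1) + u ^ 2 = 1 ∧ A 0 1 ∣ u * A 0 0 + v - A 0 0 ^ k := by
  have hA := A.mul_sub_mul_eq_one
  induction k with
  | zero => exact ⟨0, 1, by simp, by simp, by simp, by simp⟩
  | succ k ih =>
    obtain ⟨u, v, h0, h1, h2, ⟨w, hw⟩⟩ := ih
    refine ⟨u * (A 0 0 + A 1 1) + v, -u, ?_, ?_, by linear_combination h2,
      ⟨w * A 0 0 + u * A 1 0, ?_⟩⟩
    · rw [pow_succ, coe_mul, mul_apply, Fin.sum_univ_two, h0, h1]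
      linear_combination -u * hA
    · rw [pow_succ, coe_mul, mul_apply, Fin.sum_univ_two, h0, h1]
      ring
    · linear_combination A 0 0 * hw + u * hA

/-- The first row of `A ^ k` is `(u * a + v, u * b)`, so multiplicativity splits it. Modulo `u` the
first entry is `v` with `v ^ 2 ≡ 1`, and modulo `b` it is `a ^ k ≡ 1`. The bound `39 + 3 + 20` does
not depend on `k`. -/
theorem corner_pow_mem {A : SL(2, ℤ)} {k : ℕ} (h : A 0 1 ∣ A 0 0 ^ k - 1) :
    corner (A ^ k) ∈ elementaryBall 62 := by
  obtain ⟨u, v, h0, h1, h2, h3⟩ := exists_pow_eq A k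
  have h4 : RowBound 39 (u * A 0 0 + v) u := by
    refine RowBound.of_add_mul_left (n := 38) (-A 0 0) ?_
    rw [show u * A 0 0 + v + -A 0 0 * u = v by ring]
    exact rowBound_of_dvd_sq_sub_one ⟨-(v * (A 0 0 + A 1 1) + u), by linear_combination h2⟩
  have h5 : RowBound 3 (u * A 0 0 + v) (A 0 1) :=
    rowBound_of_dvd_sub_one (by
      rw [← sub_add_sub_cancel _ (A 0 0 ^ k)]
      exact dvd_add h3 h)
  exact h4.of_mul h5 _ h0 h1

theorem corner_zpow_mem_of_forall {A : SL(2, ℤ)} {k l : ℕ}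
    (key : ∀ m : ℕ, corner (A ^ (k * m)) ∈ elementaryBall l) (n : ℤ) :
    corner (A ^ (k * n)) ∈ elementaryBall l := by
  obtain ⟨m, rfl | rfl⟩ := n.eq_nat_or_neg
  · exact_mod_cast key m
  · rw [mul_neg, show A ^ (-(k * m : ℤ)) = (A ^ (k * m : ℤ))⁻¹ from _root_.zpow_neg A _, map_inv]
    exact inv_mem_elementaryBall (by exact_mod_cast key m)

theorem corner_zpow_mem {A : SL(2, ℤ)} {k : ℕ} (h : A 0 1 ∣ A 0 0 ^ k - 1) (n : ℤ) :
    corner (A ^ (k * n)) ∈ elementaryBall 62 :=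
  corner_zpow_mem_of_forall (fun m =>
    corner_pow_mem (h.trans (by rw [pow_mul]; exact sub_one_dvd_pow_sub_one _ m))) n

theorem corner_zpow_mem' {A : SL(2, ℤ)} {k : ℕ} (h : A 1 0 ∣ A 0 0 ^ k - 1) (n : ℤ) :
    corner (A ^ (k * n)) ∈ elementaryBall 62 := by
  have h1 : ∀ m : ℕ, (A ^ m).transpose = A.transpose ^ m := fun m => by
    apply Subtype.ext
    rw [coe_transpose, coe_pow, coe_pow, transpose_pow, coe_transpose]
  have key : ∀ m : ℕ, corner (A ^ (k * m)) ∈ elementaryBall 62 := fun m => by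
    rw [← corner_transpose_mem_iff, h1]
    exact corner_pow_mem (A := A.transpose) (h.trans (by
      rw [pow_mul]; exact sub_one_dvd_pow_sub_one _ m))
  exact corner_zpow_mem_of_forall key n

/-- The first row of `A ^ 2` is `(a ^ 2 + b * c, b * (a + d))`, and `a ^ 2 + b * c ≡ -1` modulo `a +
d`. Hence the factor `a + d` can be divided out, and a column operation removes `b * c`. -/
theorem rowBound_sq_of_sq_mem {n : ℕ} {A : SL(2, ℤ)} (h : corner (A ^ 2) ∈ elementaryBall n) :
    RowBound (n + 37) (A 0 0 ^ 2) (A 0 1) := by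
  have hA := A.mul_sub_mul_eq_one
  have h0 : (A ^ 2) 0 0 = A 0 0 ^ 2 + A 0 1 * A 1 0 := by
    rw [pow_two, coe_mul, mul_apply, Fin.sum_univ_two]; ring
  have h1 : (A ^ 2) 0 1 = A 0 1 * (A 0 0 + A 1 1) := by
    rw [pow_two, coe_mul, mul_apply, Fin.sum_univ_two]; ring
  have h2 := rowBound_of_mem h
  rw [h0, h1] at h2
  have h3 : RowBound 15 (A 0 0 ^ 2 + A 0 1 * A 1 0) (A 0 0 + A 1 1) :=
    rowBound_of_dvd_add_one ⟨A 0 0, by linear_combination -hA⟩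
  have h4 := h2.of_mul_left
    ⟨-1, A 0 0, by linear_combination hA⟩ h3
  refine RowBound.of_add_mul_left (n := n + 36) (A 1 0) ?_
  rw [show A 0 0 ^ 2 + A 1 0 * A 0 1 = A 0 0 ^ 2 + A 0 1 * A 1 0 by ring]
  exact h4.mono (by omega)

theorem dvd_pow_sub_one_of_prime {p : ℕ} (hp : p.Prime) {a : ℤ} (h : IsCoprime a p) :
    (p : ℤ) ∣ a ^ (p - 1) - 1 :=
  (Int.modEq_iff_dvd.1 (Int.ModEq.pow_card_sub_one_eq_one hp h).symm)

/-- The squares `(r², p)` for primes `p ≡ 3 mod 4`. -/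
theorem rowBound_sq_prime {r : ℤ} {p : ℕ} (hp : p.Prime) (hp4 : p % 4 = 3) (hr : r ≠ 0)
    (hrp : IsCoprime r p) : RowBound 161 (r ^ 2) p := by
  obtain ⟨m, hm⟩ : ∃ m, p = 2 * m + 1 := ⟨p / 2, by omega⟩
  have hm0 : m ≠ 0 := by omega
  -- Here `p ≡ 3` modulo `4` is used: `m = (p - 1) / 2` is odd.
  have hmodd : IsCoprime (2 : ℤ) m := by
    refine ⟨-(m / 2 : ℕ), 1, ?_⟩
    have : m = 2 * (m / 2) + 1 := by omega
    push_cast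
    omega
  have hpm : IsCoprime (p : ℤ) (r * m) := by
    refine IsCoprime.mul_right hrp.symm ⟨1, -2, ?_⟩
    rw [hm]; push_cast; ring
  obtain ⟨x, y, hxy⟩ := hpm
  have hx : IsCoprime (-x) ((r * m).natAbs : ℤ) := by
    rw [Int.natCast_natAbs, IsCoprime.abs_right_iff]
    exact ⟨-p, y, by linear_combination hxy⟩
  -- Dirichlet's theorem gives a prime `q ≡ -x` modulo `r * m`. The congruence modulo `r` completes
  -- `(r, p)` to a matrix with lower left entry `q`; the one modulo `m` yields `q ≡ -1`, because `x
  -- * p ≡ 1` and `p ≡ 1`.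
  obtain ⟨q, hq2, hq, hqx⟩ := Nat.forall_exists_prime_gt_and_zmodEq 2
    (Int.natAbs_ne_zero.2 (mul_ne_zero hr (by exact_mod_cast hm0))) hx
  obtain ⟨w, hw⟩ : r * m ∣ (q : ℤ) + x := by
    have := (Int.modEq_iff_dvd.1 hqx.symm)
    rw [Int.natAbs_dvd] at this
    simpa using this
  have hdet : r * (m * (p * w + y)) - p * q = 1 := by
    linear_combination hxy - p * hw
  set B := mkTwo r p q (m * (p * w + y)) hdet with hB
  have h1 : (p : ℤ) ∣ r ^ (p - 1) - 1 := dvd_pow_sub_one_of_prime hp hrp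
  have h2 : (q : ℤ) ∣ r ^ (q - 1) - 1 := dvd_pow_sub_one_of_prime hq
    ⟨m * (p * w + y), -p, by linear_combination hdet⟩
  -- As `q - 1 ≡ -2` modulo the odd number `m`, the greatest common divisor of `p - 1` and `q - 1`
  -- is `2`. So `B ^ 2` is a product of two powers of `B`, each controlled by Fermat's little
  -- theorem.
  obtain ⟨α, β, hαβ⟩ : ∃ α β : ℤ, ((p - 1 : ℕ) : ℤ) * α + ((q - 1 : ℕ) : ℤ) * β = 2 := by
    obtain ⟨j, hj⟩ := hq.odd_of_ne_two hq2.ne'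
    obtain ⟨h, e, hh⟩ := hmodd
    have hK : m * (2 * x + y * r + r * w) = 2 * (j + 1) := by
      rw [hj] at hw
      rw [hm] at hxy
      push_cast at hw hxy
      linear_combination hxy - hw
    refine ⟨h * (2 * x + y * r + r * w) + e * (j + 1), -1, ?_⟩
    rw [hm, hj, Nat.add_sub_cancel, Nat.add_sub_cancel]
    push_cast
    linear_combination (2 * h) * hK + 2 * (j + 1) * hh
  have h3 : corner (B ^ 2) ∈ elementaryBall (62 + 62) := by
    have : B ^ 2 = B ^ (((p - 1 : ℕ) : ℤ) * α) * B ^ (((q - 1 : ℕ) : ℤ) * β) := by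
      refine Eq.trans ?_ (_root_.zpow_add B _ _)
      rw [hαβ]; rfl
    rw [this, map_mul]
    exact mul_mem_elementaryBall (corner_zpow_mem (A := B) h1 α) (corner_zpow_mem' (A := B) h2 β)
  exact rowBound_sq_of_sq_mem h3

/-- Dirichlet's theorem replaces `b` by a prime `p ≡ 3` modulo `4`. Since `-1` is not a square
modulo `p`, either `a` or `-a` is one, and the square case applies. -/
theorem rowBound_of_odd {a b : ℤ} (ha : Odd a) (hab : IsCoprime a b) : RowBound 190 a b := by
  have ha0 : a ≠ 0 := by rintro rfl; simp at ha
  obtain ⟨t, ht⟩ := ha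
  obtain ⟨s, k, hs⟩ : ∃ s k : ℤ, s * a = 3 - b + 4 * k := by
    -- For odd `a`, `a ^ 2 ≡ 1` modulo `4`, so adding `(3 - b) * a * a` brings `b` to the class of
    -- `3`.
    exact ⟨(3 - b) * a, (3 - b) * (t ^ 2 + t), by rw [ht]; ring⟩
  have hx : IsCoprime (b + s * a) ((4 * a.natAbs : ℕ) : ℤ) := by
    rw [Nat.cast_mul, Int.natCast_natAbs]
    refine IsCoprime.mul_right ⟨-1, k + 1, ?_⟩ ((IsCoprime.abs_right_iff _ _).2 ?_)
    · linear_combination -hs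
    · exact hab.symm.add_mul_right_left s
  obtain ⟨p, hpa, hp, hpx⟩ := Nat.forall_exists_prime_gt_and_zmodEq a.natAbs
    (mul_ne_zero four_ne_zero (Int.natAbs_ne_zero.2 ha0)) hx
  have hdvd := Int.modEq_iff_dvd.1 hpx.symm
  rw [Nat.cast_mul, Int.natCast_natAbs] at hdvd
  have hp4 : p % 4 = 3 := by
    obtain ⟨w, hw⟩ := (dvd_mul_right _ _).trans hdvd
    push_cast at hw
    omega
  obtain ⟨w, hw⟩ : a ∣ (p : ℤ) - b := by
    have h1 := ((abs_dvd a _).1 ((dvd_mul_left _ _).trans hdvd)).add (dvd_mul_left a s)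
    rwa [show (p : ℤ) - (b + s * a) + s * a = p - b by ring] at h1
  have hap : IsCoprime a p := by
    rw [show (p : ℤ) = b + w * a by linear_combination hw]
    exact hab.add_mul_right_right w
  have : Fact p.Prime := ⟨hp⟩
  suffices h : RowBound 189 a p by
    refine RowBound.of_add_mul_right w ?_
    rwa [show b + w * a = p by linear_combination -hw]
  have key : ∀ c : ℤ, IsCoprime c p → IsSquare (c : ZMod p) → RowBound 162 c p := by
    rintro c hc ⟨z, hz⟩
    obtain ⟨r, rfl⟩ := ZMod.intCast_surjective z
    obtain ⟨v, hv⟩ : (p : ℤ) ∣ r ^ 2 - c := by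
      rw [← ZMod.intCast_zmod_eq_zero_iff_dvd]
      push_cast
      rw [hz]
      ring
    have hrp : IsCoprime (r * r) (p : ℤ) := by
      rw [show r * r = c + v * p by linear_combination hv]
      exact hc.add_mul_right_left v
    have hr : r ≠ 0 := by
      rintro rfl
      rw [mul_zero, isCoprime_zero_left, Int.isUnit_iff] at hrp
      have := hp.two_le
      omega
    refine RowBound.of_add_mul_left (n := 161) v ?_
    rw [show c + v * p = r ^ 2 by linear_combination -hv]
    exact rowBound_sq_prime hp hp4 hr hrp.of_mul_left_left
  by_cases hsq : IsSquare (a : ZMod p)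
  · exact (key a hap hsq).mono (by norm_num)
  · refine RowBound.mono (RowBound.of_neg_left (key (-a) hap.neg_left ?_)) (by norm_num)
    have ha : (a : ZMod p) ≠ 0 := fun h => hsq (h ▸ IsSquare.zero)
    rw [ZMod.euler_criterion p ha] at hsq
    rw [Int.cast_neg, ZMod.euler_criterion p (neg_ne_zero.2 ha),
      Odd.neg_pow ⟨p / 4, by omega⟩, (ZMod.pow_div_two_eq_neg_one_or_one p ha).resolve_left hsq,
      neg_neg]

theorem corner_mem (A : SL(2, ℤ)) : corner A ∈ elementaryBall 191 := by
  have hA := A.mul_sub_mul_eq_one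
  have hcop : IsCoprime (A 0 0) (A 0 1) := ⟨A 1 1, -A 1 0, by linear_combination hA⟩
  rcases Int.even_or_odd (A 0 0) with h | h
  · have h1 : Odd (A 0 0 + 1 * A 0 1) := by
      rw [one_mul]
      refine h.add_odd ?_
      rw [← Int.not_even_iff_odd]
      intro h2
      obtain ⟨x, hx⟩ := h
      obtain ⟨y, hy⟩ := h2
      rw [hx, hy] at hA
      have : 2 * (x * A 1 1 - y * A 1 0) = 1 := by linear_combination hA
      omega
    exact RowBound.of_add_mul_left 1 (rowBound_of_odd h1 (hcop.add_mul_right_left 1)) A rfl rfl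
  · exact elementaryBall_mono (by norm_num) (rowBound_of_odd h hcop A rfl rfl)

/-! ### Reduction from SL₃(ℤ) to the corner -/

theorem mem_of_mul_transvection {n : ℕ} {g : SL(3, ℤ)} {i j : Fin 3} (h : i ≠ j) (m : ℤ)
    (hg : g * transvection h m ∈ elementaryBall n) : g ∈ elementaryBall (n + 1) := by
  have h3 := mul_mem_elementaryBall hg (transvection_mem_elementaryBall h (-m))
  rwa [mul_assoc, transvection_mul_neg, mul_one] at h3

theorem mem_of_transvection_mul {n : ℕ} {g : SL(3, ℤ)} {i j : Fin 3} (h : i ≠ j) (m : ℤ)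
    (hg : transvection h m * g ∈ elementaryBall n) : g ∈ elementaryBall (n + 1) := by
  have h3 := mul_mem_elementaryBall (inv_mem_elementaryBall (transvection_mem_elementaryBall h m))
    hg
  rw [inv_mul_cancel_left] at h3
  exact elementaryBall_mono (by omega) h3

theorem mul_transvection_apply (g : SL(3, ℤ)) {i j : Fin 3} (h : i ≠ j) (m : ℤ) (a b : Fin 3) :
    (g * transvection h m) a b = if b = j then g a b + m * g a i else g a b := by
  rw [coe_mul]
  split_ifs with hb
  · rw [hb]
    exact mul_transvection_apply_same i j a m g
  · exact mul_transvection_apply_of_ne i j a b hb m g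

theorem transvection_mul_apply (g : SL(3, ℤ)) {i j : Fin 3} (h : i ≠ j) (m : ℤ) (a b : Fin 3) :
    (transvection h m * g) a b = if a = i then g a b + m * g j b else g a b := by
  rw [coe_mul]
  split_ifs with hb
  · rw [hb]
    exact transvection_mul_apply_same i j b m g
  · exact transvection_mul_apply_of_ne i j a b hb m g

theorem mem_of_last_row_col {g : SL(3, ℤ)} (h0 : g 2 0 = 0) (h1 : g 2 1 = 0) (h2 : g 2 2 = 1)
    (h3 : g 0 2 = 0) (h4 : g 1 2 = 0) : g ∈ elementaryBall 191 := by
  have hdet := g.det_coe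
  rw [det_fin_three, h0, h1, h2, h3, h4] at hdet
  have key : corner (mkTwo (g 0 0) (g 0 1) (g 1 0) (g 1 1) (by linear_combination hdet)) = g := by
    apply Subtype.ext
    rw [coe_corner_mkTwo, eta_fin_three (g : Matrix (Fin 3) (Fin 3) ℤ), h0, h1, h2, h3, h4]
    rfl
  rw [← key]
  exact corner_mem _

theorem mem_of_last_row {g : SL(3, ℤ)} (h0 : g 2 0 = 0) (h1 : g 2 1 = 0) (h2 : g 2 2 = 1) :
    g ∈ elementaryBall 193 := by
  refine mem_of_transvection_mul (show (0 : Fin 3) ≠ 2 by decide) (-g 0 2)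
    (mem_of_transvection_mul (show (1 : Fin 3) ≠ 2 by decide) (-g 1 2)
      (mem_of_last_row_col ?_ ?_ ?_ ?_ ?_)) <;>
    simp [transvection_mul_apply, h0, h1, h2]

theorem mem_of_apply_eq_one {g : SL(3, ℤ)} (h2 : g 2 2 = 1) : g ∈ elementaryBall 195 := by
  refine mem_of_mul_transvection (show (2 : Fin 3) ≠ 0 by decide) (-g 2 0)
    (mem_of_mul_transvection (show (2 : Fin 3) ≠ 1 by decide) (-g 2 1)
      (mem_of_last_row ?_ ?_ ?_)) <;>
    simp [mul_transvection_apply, h2]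

theorem mem_of_isCoprime {g : SL(3, ℤ)} (h : IsCoprime (g 2 0) (g 2 1)) :
    g ∈ elementaryBall 197 := by
  obtain ⟨u, v, huv⟩ := h
  refine mem_of_mul_transvection (show (0 : Fin 3) ≠ 2 by decide) ((1 - g 2 2) * u)
    (mem_of_mul_transvection (show (1 : Fin 3) ≠ 2 by decide) ((1 - g 2 2) * v)
      (mem_of_apply_eq_one ?_))
  simp [mul_transvection_apply]
  linear_combination (1 - g 2 2) * huv

/-- Dividing `x` and `z` by their gcd `d`, Dirichlet's theorem makes `x' + t * z'` a prime exceeding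
`|y|`, hence coprime to `y`; and `d` is coprime to `y` because the row is unimodular. -/
theorem exists_isCoprime_add_mul {x y z : ℤ} (hy : y ≠ 0) (hz : z ≠ 0)
    (h : ∃ u v w, u * x + v * y + w * z = 1) : ∃ t, IsCoprime (x + t * z) y := by
  obtain ⟨u, v, w, h⟩ := h
  obtain ⟨x', hx'⟩ := Int.gcd_dvd_left x z
  obtain ⟨z', hz'⟩ := Int.gcd_dvd_right x z
  have hd : (Int.gcd x z : ℤ) ≠ 0 := by
    intro h0
    rw [h0, zero_mul] at hz'
    exact hz hz'
  have hz0 : z' ≠ 0 := by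
    rintro rfl
    exact hz (by rw [hz', mul_zero])
  set d := (Nat.cast (Int.gcd x z) : ℤ) with hdd
  have hcop : IsCoprime x' z' := by
    refine ⟨Int.gcdA x z, Int.gcdB x z, mul_left_cancel₀ hd ?_⟩
    have := Int.gcd_eq_gcd_ab x z
    rw [← hdd] at this
    linear_combination -this - Int.gcdA x z * hx' - Int.gcdB x z * hz'
  obtain ⟨q, hqy, hq, hqx⟩ := Nat.forall_exists_prime_gt_and_zmodEq y.natAbs
    (Int.natAbs_ne_zero.2 hz0) (a := x') (by
      rw [Int.natCast_natAbs, IsCoprime.abs_right_iff]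
      exact hcop)
  obtain ⟨t, ht⟩ : z' ∣ (q : ℤ) - x' := by
    have := Int.modEq_iff_dvd.1 hqx.symm
    rwa [Int.natAbs_dvd] at this
  refine ⟨t, ?_⟩
  rw [show x + t * z = d * q by linear_combination hx' + t * hz' - d * ht]
  refine IsCoprime.mul_left ⟨u * x' + w * z', v, ?_⟩ ?_
  · linear_combination h - u * hx' - w * hz'
  · rw [Int.isCoprime_iff_nat_coprime, Int.natAbs_natCast, hq.coprime_iff_not_dvd]
    exact fun h => absurd (Nat.le_of_dvd (Int.natAbs_pos.2 hy) h) (by omega)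

theorem exists_last_row_combination (g : SL(3, ℤ)) :
    ∃ u v w, u * g 2 0 + v * g 2 1 + w * g 2 2 = 1 := by
  have hdet := g.det_coe
  rw [det_fin_three] at hdet
  exact ⟨g 0 1 * g 1 2 - g 0 2 * g 1 1, g 0 2 * g 1 0 - g 0 0 * g 1 2,
    g 0 0 * g 1 1 - g 0 1 * g 1 0, by linear_combination hdet⟩

theorem mem_of_ne_zero {g : SL(3, ℤ)} (h1 : g 2 1 ≠ 0) (h2 : g 2 2 ≠ 0) :
    g ∈ elementaryBall 198 := by
  obtain ⟨t, ht⟩ := exists_isCoprime_add_mul h1 h2 g.exists_last_row_combination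
  refine mem_of_mul_transvection (show (2 : Fin 3) ≠ 0 by decide) t (mem_of_isCoprime ?_)
  simpa [mul_transvection_apply] using ht

/-- `SL₃(ℤ)` is boundedly generated by the elementary matrices. -/
theorem mem_elementaryBall (g : SL(3, ℤ)) : g ∈ elementaryBall 199 := by
  by_cases h2 : g 2 2 = 0
  · refine elementaryBall_mono (by norm_num) (mem_of_isCoprime ?_)
    obtain ⟨u, v, w, h⟩ := g.exists_last_row_combination
    exact ⟨u, v, by rw [h2] at h; linear_combination h⟩
  · by_cases h1 : g 2 1 = 0
    · refine mem_of_mul_transvection (show (2 : Fin 3) ≠ 1 by decide) 1 (mem_of_ne_zero ?_ ?_)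
      · simpa [mul_transvection_apply, h1] using h2
      · simpa [mul_transvection_apply] using h2
    · exact elementaryBall_mono (by norm_num) (mem_of_ne_zero h1 h2)

/-! ### Root elements and the spectral gap -/

/-- The six elementary root elements of `SL₃(ℤ)`, in cyclic order. -/
def rootElement : Fin 6 → SL(3, ℤ) :=
  ![transvection (show (0 : Fin 3) ≠ 1 by decide) 1, transvection (show (0 : Fin 3) ≠ 2 by decide) 1,
    transvection (show (1 : Fin 3) ≠ 2 by decide) 1, transvection (show (1 : Fin 3) ≠ 0 by decide) 1,
    transvection (show (2 : Fin 3) ≠ 0 by decide) 1, transvection (show (2 : Fin 3) ≠ 1 by decide) 1]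

theorem isHexagon_rootElement : IsHexagon rootElement where
  commute := by
    unfold Commute SemiconjBy rootElement
    decide
  heisenberg := by
    have key : ∀ i, (rootElement i * rootElement (i + 1) = rootElement (i + 1) * rootElement i) ∧
        (rootElement (i + 2) * rootElement (i + 1) = rootElement (i + 1) * rootElement (i + 2)) ∧
        (rootElement i * rootElement (i + 2) =
          rootElement (i + 2) * rootElement i * rootElement (i + 1) ∨
        rootElement i * rootElement (i + 2) =
          rootElement (i + 2) * rootElement i * (rootElement (i + 1))⁻¹) := by
      unfold rootElement
      decide
    exact fun i => ⟨(key i).1, (key i).2.1, (key i).2.2⟩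

theorem transvection_eq_zpow {i j : Fin 3} (h : i ≠ j) (m : ℤ) :
    transvection h m = transvection h 1 ^ m := by
  have key : ∀ n : ℕ, transvection h (n : ℤ) = transvection h 1 ^ n := by
    intro n
    induction n with
    | zero => simp
    | succ n ih => rw [pow_succ, ← ih, ← transvection_add]; push_cast; rfl
  obtain ⟨n, rfl | rfl⟩ := m.eq_nat_or_neg
  · rw [key]; exact (_root_.zpow_natCast _ n).symm
  · rw [← transvection_inv, key]
    exact ((_root_.zpow_neg _ _).trans (congrArg _ (_root_.zpow_natCast _ n))).symm

theorem exists_eq_rootElement {i j : Fin 3} (h : i ≠ j) :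
    ∃ k, transvection h (1 : ℤ) = rootElement k := by
  fin_cases i <;> fin_cases j <;> first
    | exact absurd rfl h
    | exact ⟨0, rfl⟩
    | exact ⟨1, rfl⟩
    | exact ⟨2, rfl⟩
    | exact ⟨3, rfl⟩
    | exact ⟨4, rfl⟩
    | exact ⟨5, rfl⟩

theorem exists_eq_rootElement_zpow {g : SL(3, ℤ)} (hg : g ∈ elementarySet) :
    ∃ (k : Fin 6) (n : ℤ), g = rootElement k ^ n := by
  obtain ⟨i, j, h, m, rfl⟩ := hg
  obtain ⟨k, hk⟩ := exists_eq_rootElement h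
  exact ⟨k, m, by rw [transvection_eq_zpow, hk]⟩

theorem gauge_sub_le_of_mem_elementaryBall {F : Type*} [AddCommGroup F] [Module ℝ F]
    {p : Seminorm ℝ F} (ρ : SL(3, ℤ) →* (F ≃ₗ[ℝ] F)) (hρ : ∀ g x, p (ρ g x) = p x) {ξ : F} {t : ℝ}
    (h : ∀ (i : Fin 6) (n : ℤ), p (ρ (rootElement i ^ n) ξ - ξ) ≤ t) (n : ℕ) {g : SL(3, ℤ)}
    (hg : g ∈ elementaryBall n) : p (ρ g ξ - ξ) ≤ n * t := by
  induction n generalizing g with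
  | zero =>
    obtain rfl : g = 1 := hg
    simp
  | succ n ih =>
    rw [elementaryBall, pow_succ] at hg
    obtain ⟨x, hx, y, hy, rfl⟩ := hg
    obtain ⟨i, m, rfl⟩ := exists_eq_rootElement_zpow hy
    have h1 : ρ (x * rootElement i ^ m) ξ - ξ =
        ρ x (ρ (rootElement i ^ m) ξ - ξ) + (ρ x ξ - ξ) := by
      rw [map_mul, map_sub, LinearEquiv.mul_apply]
      abel
    change p (ρ (x * rootElement i ^ m) ξ - ξ) ≤ _
    rw [h1]
    refine (map_add_le_add p _ _).trans ?_
    rw [hρ]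
    push_cast
    linarith [ih hx, h i m]

/-- A uniform spectral gap for isometric actions without invariant vectors of `SL₃(ℤ)` on
a real Banach space with an equivalent uniformly convex norm. -/
theorem exists_finite_le_norm_sub {F : Type*} [NormedAddCommGroup F] [NormedSpace ℝ F]
    [CompleteSpace F] {N : Seminorm ℝ F} {c C : ℝ} (hc : 0 < c) (hC : 0 < C)
    (hle : ∀ x, c * ‖x‖ ≤ N x ∧ N x ≤ C * ‖x‖) (hN : UniformlyConvexGauge N)
    (ρ : SL(3, ℤ) →* (F ≃ₗᵢ[ℝ] F)) (hinv : ∀ ξ, (∀ g, ρ g ξ = ξ) → ξ = 0) :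
    ∃ K : Set SL(3, ℤ), K.Finite ∧ ∃ ε : ℝ, 0 < ε ∧ ∀ ξ : F, ‖ξ‖ = 1 →
      ∃ g ∈ K, ε ≤ ‖ρ g ξ - ξ‖ := by
  obtain ⟨p, hpN, hp, hρ⟩ := exists_invariant_gauge hc hle hN ρ
  let ρ' : SL(3, ℤ) →* (F ≃ₗ[ℝ] F) :=
    { toFun := fun h => (ρ h).toLinearEquiv
      map_one' := by ext x; exact DFunLike.congr_fun (map_one ρ) x
      map_mul' := fun a b => by ext x; exact DFunLike.congr_fun (map_mul ρ a b) x }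
  obtain ⟨K, hK, ε, hε, h⟩ := isHexagon_rootElement.exists_finite_gauge_zpow_sub_le hp ρ' hρ
    -- With `199` elementary factors the total displacement is at most `199 / 398 = 1 / 2` of the
    -- gauge of the vector, as `exists_invariant_ne_zero` requires.
    (δ := 1 / 398) (by norm_num)
  refine ⟨K, hK, ε * c / C, by positivity, fun ξ hξ => ?_⟩
  by_contra! hcon
  have hξ0 : ξ ≠ 0 := by
    rintro rfl
    simp at hξ
  have h1 := h ξ fun g hg => by
    have h2 := (hpN (ρ g ξ - ξ)).2
    have h3 := (lt_div_iff₀ hC).1 (hcon g hg)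
    have h4 := (hpN ξ).1
    rw [hξ, mul_one] at h4
    have h5 : ε * c ≤ ε * p ξ := by gcongr
    change p (ρ g ξ - ξ) ≤ _
    linarith
  obtain ⟨η, hη, hη'⟩ := exists_invariant_ne_zero hc hpN hp ρ hρ hξ0 fun g => by
    have h2 := gauge_sub_le_of_mem_elementaryBall ρ' hρ h1 199 g.mem_elementaryBall
    change p (ρ g ξ - ξ) ≤ _ at h2
    refine h2.trans (le_of_eq ?_)
    push_cast
    ring
  exact hη (hinv η hη')

end Matrix.SpecialLinearGroup

end BoundedGeneration

/-! ### The quotient representation and the conclusion -/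

namespace IsometricRep

variable {𝕜 : Type*} [RCLike 𝕜] {G : Type*} [Group G] [TopologicalSpace G]
  {E : Type*} [NormedAddCommGroup E] [NormedSpace 𝕜 E]

/-- If `π g v - v` is invariant, then `π (g ^ n) v = v + n • (π g v - v)`. Orbits of isometries are
bounded, so the increment vanishes. -/
theorem quotient_eq_zero_of_invariant (π : IsometricRep 𝕜 G E) {ξ : E ⧸ π.invariants}
    (h : ∀ g, π.quotient.toHom g ξ = ξ) : ξ = 0 := by
  obtain ⟨v, rfl⟩ := Submodule.Quotient.mk_surjective _ ξ
  have hv : ∀ g, π.toHom g v - v ∈ π.invariants := fun g =>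
    (Submodule.Quotient.eq _).1 (h g)
  rw [Submodule.Quotient.mk_eq_zero]
  intro g
  have hpow : ∀ n : ℕ, π.toHom (g ^ n) v = v + n • (π.toHom g v - v) := by
    intro n
    induction n with
    | zero => simp
    | succ n ih =>
      rw [pow_succ', map_mul]
      change π.toHom g (π.toHom (g ^ n) v) = _
      rw [ih, map_add, map_nsmul, hv g g,
        succ_nsmul]
      abel
  have hbound : ∀ n : ℕ, (n : ℝ) * ‖π.toHom g v - v‖ ≤ 2 * ‖v‖ := by
    intro n
    have h1 : n • (π.toHom g v - v) = π.toHom (g ^ n) v - v := by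
      rw [hpow]
      abel
    have h2 := norm_sub_le (π.toHom (g ^ n) v) v
    rw [LinearIsometryEquiv.norm_map, ← h1, ← Nat.cast_smul_eq_nsmul 𝕜, norm_smul,
      RCLike.norm_natCast] at h2
    linarith
  by_contra hne
  have hpos := norm_pos_iff.2 (sub_ne_zero.2 hne)
  obtain ⟨n, hn⟩ := exists_nat_gt (2 * ‖v‖ / ‖π.toHom g v - v‖)
  rw [div_lt_iff₀ hpos] at hn
  exact absurd (hbound n) (not_le.2 hn)

end IsometricRep

theorem theorem1p2 {𝕜 : Type*} [RCLike 𝕜] {E : Type*} [NormedAddCommGroup E] [NormedSpace 𝕜 E]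
    [CompleteSpace E] (hE : IsSuperReflexive 𝕜 E) :
    HasBanachPropertyT 𝕜 (Matrix.SpecialLinearGroup (Fin 3) ℤ) E := by
  intro π hπ
  obtain ⟨N, ⟨c, C, hc, hC, hle⟩, hN⟩ := hE
  have hclosed : IsClosed (π.invariants : Set E) := π.isClosed_invariants
  have : IsClosed (π.invariants.toAddSubgroup : Set E) := hclosed
  let : NormedAddCommGroup (E ⧸ π.invariants) :=
    Submodule.Quotient.normedAddCommGroup π.invariants
  let : NormedSpace ℝ (E ⧸ π.invariants) := NormedSpace.restrictScalars ℝ 𝕜 (E ⧸ π.invariants)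
  have : IsScalarTower ℝ 𝕜 (E ⧸ π.invariants) := RestrictScalars.isScalarTower ℝ 𝕜 _
  obtain ⟨q, h1, h2⟩ := N.exists_quotient π.invariants
  have hq : UniformlyConvexGauge q := (N.uniformlyConvexGauge hN).quotient h1 h2
  -- Both comparisons with the quotient norm use lifts that are optimal up to an arbitrarily small
  -- error, so the constants of `N` are preserved.
  have hqle : ∀ ξ : E ⧸ π.invariants, c * ‖ξ‖ ≤ q ξ ∧ q ξ ≤ C * ‖ξ‖ := by
    refine fun ξ => ⟨le_of_forall_pos_lt_add fun ε hε => ?_, le_of_forall_pos_lt_add fun ε hε => ?_⟩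
    · obtain ⟨x, rfl, hx⟩ := h2 ξ ε hε
      refine lt_of_le_of_lt ?_ hx
      refine le_trans ?_ (hle x).1
      gcongr
      exact Submodule.Quotient.norm_mk_le _ _
    · obtain ⟨x, rfl, hx⟩ := Submodule.Quotient.norm_mk_lt ξ (div_pos hε hC)
      refine ((h1 x).trans (hle x).2).trans_lt ?_
      rw [lt_div_iff₀' hC |>.symm, add_div, mul_div_cancel_left₀ _ hC.ne']
      exact hx
  let ρ : Matrix.SpecialLinearGroup (Fin 3) ℤ →* ((E ⧸ π.invariants) ≃ₗᵢ[ℝ] (E ⧸ π.invariants)) :=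
    { toFun := fun g =>
        { toLinearEquiv := (π.quotient.toHom g).toLinearEquiv.restrictScalars ℝ
          norm_map' := (π.quotient.toHom g).norm_map }
      map_one' := by ext x; exact DFunLike.congr_fun (map_one π.quotient.toHom) x
      map_mul' := fun a b => by ext x; exact DFunLike.congr_fun (map_mul π.quotient.toHom a b) x }
  obtain ⟨K, hK, ε, hε, h⟩ := Matrix.SpecialLinearGroup.exists_finite_le_norm_sub
    (N := q.restrictScalars ℝ) hc hC hqle hq ρ fun ξ hξ => π.quotient_eq_zero_of_invariant hξ
  obtain ⟨ξ, hξ, hlt⟩ := hπ K hK.isCompact ε hε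
  obtain ⟨g, hg, hge⟩ := h ξ hξ
  exact absurd (hlt g hg) (not_lt.2 hge)
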